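/- **Setting.** Let $V$ be a finite-dimensional real vector space, $V'$ its dual, and $W=V\times V'$ with the symplectic form $[(x,\xi),(y,\eta)]=\langle\xi,y\rangle-\langle\eta,x\rangle$; let $\sigma:W\to W'$, $\langle\sigma X,Y\rangle=[X,Y]$. Let $d\lambda$ (also $dY$) be the product of a Haar measure on $V$ with its dual measure on $V'$, i.e. the measure of the symplectic volume form; measurable means Lebesgue measurable, and $|\cdot|$ denotes any norm on $W$ or on $W\times W$. Let $g$ be a measurable Riemannian metric on $W$ with quadratic forms $g_X(T)=g_X(T,T)$ and induced isomorphisms $Q_X:W\to W'$, and let $g^\sigma_X(T,S)=\langle{}^t\sigma Q_X^{-1}\sigma T,S\rangle$, $g^\sigma_X(T)=g^\sigma_X(T,T)$. Assume that $g$ is a Hörmander metric with structure constants $C_0\ge1$, $r_0>0$, $N_0\ge0$, that is, for all $X,Y,T\in W$: - $g_X(X-Y)\le r_0^2$ implies $C_0^{-1}g_Y(T)\le g_X(T)\le C_0g_Y(T)$; - $(g_X(T)/g_Y(T))^{\pm1}\le C_0(1+g^\sigma_X(X-Y))^{N_0}$ if $T\neq 0$; - $g_X(T)\le g^\sigma_X(T)$.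 For $r>0$ let $U_{X,r}=\{Y\in W: g_X(X-Y)\le r^2\}$ and $g^\sigma_X(Y-U_{X,r})=\inf_{Z\in U_{X,r}}g^\sigma_X(Y-Z)$. For $k\in\mathbb N=\{0,1,2,\dots\}$ and $\varphi\in\mathcal S(W)$ put $$\|\varphi\|^{(k)}_{g_X,U_{X,r}}=\sup_{l\le k}\ \sup_{\substack{Y\in W\\ T_1,\dots,T_l\in W\setminus\{0\}}}\frac{|\varphi^{(l)}(Y;T_1,\dots,T_l)|\,(1+g^\sigma_X(Y-U_{X,r}))^{k/2}}{\prod_{j=1}^l g_X(T_j)^{1/2}}.$$ For $0<r\le r_0$, $\mathrm{Conf}_g(W;r)$ is the space of (classes modulo equality almost everywhere of) strongly measurable maps $\boldsymbol\varphi:W\to\mathcal S(W)$, $X\mapsto\varphi_X$, such that $$\|\boldsymbol\varphi\|^{(k)}_{g,r}=\operatorname*{ess\,sup}_{X\in W}\|\varphi_X\|^{(k)}_{g_X,U_{X,r}}<\infty\quad\text{for all }k\in\mathbb N,$$ with the topology given by these seminorms; it is of class $\mathcal C^\infty$ if it has a representative in $\mathcal C^\infty(W;\mathcal S(W))$, and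 then that representative is used. $\overline{\boldsymbol\varphi}$ is the map $X\mapsto\overline{\varphi_X}$. $\mathcal S'(W)$ carries the strong dual topology, and $\psi\in\mathcal S(W)$ is identified with $\chi\mapsto\int_W\psi\chi\,d\lambda$. For $s\in\mathbb R$, $L^\infty_{(1+|\cdot|)^s}(W\times W)$ is the Banach space of classes of measurable functions $F$ with $(1+|\cdot|)^sF\in L^\infty(W\times W)$. The geometric short-time Fourier transform of $f\in\mathcal S'(W)$ with respect to $\boldsymbol\varphi\in\mathrm{Conf}_g(W;r)$ is $$\mathcal V_{\boldsymbol\varphi}f(X,\Xi)=\langle f,e^{-2\pi i[\Xi,\cdot]}\overline{\varphi_X}\rangle,\qquad X,\Xi\in W.$$ A sesquilinear map $u:E\times F\to G$ between locally convex spaces is called hypocontinuous if for every bounded set in one of the factors $E$, $F$ and every neighbourhood $U$ of $0$ in $G$ there is a neighbourhood of $0$ in the other factor such that $u$ maps the product of these two sets into $U$. **Proposition.** Let $0<r\le r_0$. (i) The sesquilinear map $$\mathcal S'(W)\times\mathrm{Conf}_g(W;r)\to\varinjlim_{s\to\infty}L^\infty_{(1+|\cdot|)^{-s}}(W\times W),\qquad(f,\boldsymbol\varphi)\mapsto\mathcal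 V_{\boldsymbol\varphi}f,$$ into the locally convex inductive limit is well defined and hypocontinuous. Furthermore, for every bounded set $B\subseteq\mathcal S'(W)$ there is $s>0$ such that $\mathcal V_{\boldsymbol\varphi}f\in L^\infty_{(1+|\cdot|)^{-s}}(W\times W)$ for all $f\in B$ and $\boldsymbol\varphi\in\mathrm{Conf}_g(W;r)$, and the linear maps $\mathrm{Conf}_g(W;r)\to L^\infty_{(1+|\cdot|)^{-s}}(W\times W)$, $\boldsymbol\varphi\mapsto\mathcal V_{\overline{\boldsymbol\varphi}}f$, $f\in B$, are continuous and form an equicontinuous set. (ii) The sesquilinear map $$\mathcal S(W)\times\mathrm{Conf}_g(W;r)\to\varprojlim_{s\to\infty}L^\infty_{(1+|\cdot|)^{s}}(W\times W),\qquad(\psi,\boldsymbol\varphi)\mapsto\mathcal V_{\boldsymbol\varphi}\psi,$$ is well defined and continuous. (iii) Let $\boldsymbol\varphi\in\mathrm{Conf}_g(W;r)$ be of class $\mathcal C^\infty$ and put $\varphi(X,Y)=\varphi_X(Y)$. Assume that for every $k\in\mathbb N$ there is $s\ge0$ such that for all $m>0$ $$\sup_{\substack{l'\le k\\ l''\le k}}\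 \sup_{X,Y\in W}\ \sup_{\substack{T_1,\dots,T_{l'}\in W\setminus\{0\}\\ S_1,\dots,S_{l''}\in W\setminus\{0\}}}\frac{\bigl|\bigl(\prod_{j=1}^{l'}\partial_{T_j;X}\bigr)\bigl(\prod_{j=1}^{l''}\partial_{S_j;Y}\bigr)\varphi(X,Y)\bigr|\,(1+g^\sigma_X(Y-U_{X,r}))^{m/2}}{\bigl(\prod_{j=1}^{l'}g_X(T_j)^{1/2}\bigr)\bigl(\prod_{j=1}^{l''}g_X(S_j)^{1/2}\bigr)(1+|X|)^s(1+|Y|)^s}<\infty,$$ where $\partial_{T;X}$ and $\partial_{S;Y}$ are the directional derivatives in the first and in the second variable. Then $\psi\mapsto\mathcal V_{\boldsymbol\varphi}\psi$ is a well-defined continuous map $\mathcal S(W)\to\mathcal S(W\times W)$. -/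

import Mathlib

open MeasureTheory Filter Topology
open scoped SchwartzMap ENNReal NNReal

noncomputable section

/-! ### The symplectic space `W = V × V'` -/

/-- The phase space `W = V × V'`, where `V'` is the dual of the finite dimensional space `V`.
The norm of `V` only serves as an auxiliary norm. -/
abbrev PhaseSpace (V : Type*) [NormedAddCommGroup V] [NormedSpace ℝ V] : Type _ :=
  V × (V →L[ℝ] ℝ)

section Symplectic

variable {V : Type*} [NormedAddCommGroup V] [NormedSpace ℝ V]

/-- The functional `σ X = [X, ·]`, where `[(x, ξ), (y, η)] = ⟨ξ, y⟩ - ⟨η, x⟩`. -/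
def sympFunctional (X : PhaseSpace V) : PhaseSpace V →L[ℝ] ℝ :=
  X.2 ∘L ContinuousLinearMap.fst ℝ V (V →L[ℝ] ℝ) -
    (ContinuousLinearMap.apply ℝ ℝ X.1) ∘L ContinuousLinearMap.snd ℝ V (V →L[ℝ] ℝ)

/-- The canonical symplectic form `[X, Y]` on `V × V'`. -/
def sympForm (X Y : PhaseSpace V) : ℝ := sympFunctional X Y

theorem sympForm_apply (X Y : PhaseSpace V) : sympForm X Y = X.2 Y.1 - Y.2 X.1 := rfl

variable (V) in
/-- The measure `dλ` on `V × V'`: the product of a Haar measure on `V` and of its dual measure on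
`V'`.  The Haar measure is the one for which the parallelepiped of a basis of `V` has mass `1`; its
dual measure is the one for which the parallelepiped of the dual basis has mass `1`.  The product
is the measure of the symplectic volume form and does not depend on the basis. -/
def sympMeasure [FiniteDimensional ℝ V] [MeasurableSpace V] [BorelSpace V] :
    Measure (PhaseSpace V) :=
  (Module.finBasis ℝ V).addHaar.prod
    ((Module.finBasis ℝ V).dualBasis.map LinearMap.toContinuousLinearMap).addHaar

instance [FiniteDimensional ℝ V] [MeasurableSpace V] [BorelSpace V] :
    (sympMeasure V).IsAddHaarMeasure := by
  unfold sympMeasure; infer_instance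

instance [FiniteDimensional ℝ V] [MeasurableSpace V] [BorelSpace V] :
    SigmaFinite (sympMeasure V) := by
  unfold sympMeasure; infer_instance

end Symplectic

/-! ### Hörmander metrics -/

/-- A (measurable) Riemannian metric on `W = V × V'`. -/
structure RiemMetric (V : Type*) [NormedAddCommGroup V] [NormedSpace ℝ V]
    [FiniteDimensional ℝ V] [MeasurableSpace V] [BorelSpace V] where
  /-- the bilinear form `g_X` on the tangent space `W` at `X` -/
  form : PhaseSpace V → LinearMap.BilinForm ℝ (PhaseSpace V)
  symm : ∀ X T S, form X T S = form X S T
  pos : ∀ X T, T ≠ 0 → 0 < form X T T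
  meas : ∀ T S, AEMeasurable (fun X ↦ form X T S) (sympMeasure V)

namespace RiemMetric

variable {V : Type*} [NormedAddCommGroup V] [NormedSpace ℝ V]
  [FiniteDimensional ℝ V] [MeasurableSpace V] [BorelSpace V] (g : RiemMetric V)

/-- The quadratic form `g_X(T) = g_X(T, T)`. -/
def quad (X T : PhaseSpace V) : ℝ := g.form X T T

theorem nondegenerate (X : PhaseSpace V) : (g.form X).Nondegenerate := by
  constructor
  · intro T hT
    by_contra h
    exact (g.pos X T h).ne' (hT T)
  · intro T hT
    by_contra h
    exact (g.pos X T h).ne' (hT T)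

/-- The isomorphism `Q_X : W → W'` induced by `g_X`. -/
def Q (X : PhaseSpace V) : PhaseSpace V ≃ₗ[ℝ] Module.Dual ℝ (PhaseSpace V) :=
  LinearMap.BilinForm.toDual (g.form X) (g.nondegenerate X)

/-- The symplectic dual `g^σ_X(T, S) = ⟨ᵗσ Q_X⁻¹ σ T, S⟩ = ⟨σ S, Q_X⁻¹ σ T⟩`. -/
def dualForm (X T S : PhaseSpace V) : ℝ :=
  sympForm S ((g.Q X).symm (sympFunctional T : PhaseSpace V →ₗ[ℝ] ℝ))

/-- The quadratic form `g^σ_X(T) = g^σ_X(T, T)`. -/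
def dualQuad (X T : PhaseSpace V) : ℝ := g.dualForm X T T

/-- The ball `U_{X,r} = {Y | g_X(X - Y) ≤ r²}`. -/
def ball (X : PhaseSpace V) (r : ℝ) : Set (PhaseSpace V) := {Y | g.quad X (X - Y) ≤ r ^ 2}

/-- `g^σ_X(Y - U_{X,r}) = inf {g^σ_X(Y - Z) | Z ∈ U_{X,r}}`. -/
def confDist (X : PhaseSpace V) (r : ℝ) (Y : PhaseSpace V) : ℝ :=
  sInf ((fun Z ↦ g.dualQuad X (Y - Z)) '' g.ball X r)

/-- `g` is a Hörmander metric with structure constants `C₀`, `r₀`, `N₀`. -/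
structure IsHormander (C₀ r₀ N₀ : ℝ) : Prop where
  one_le : 1 ≤ C₀
  r_pos : 0 < r₀
  N_nonneg : 0 ≤ N₀
  slow : ∀ X Y T, g.quad X (X - Y) ≤ r₀ ^ 2 →
    C₀⁻¹ * g.quad Y T ≤ g.quad X T ∧ g.quad X T ≤ C₀ * g.quad Y T
  temperate : ∀ X Y T, T ≠ 0 →
    g.quad X T / g.quad Y T ≤ C₀ * (1 + g.dualQuad X (X - Y)) ^ N₀ ∧
    (g.quad X T / g.quad Y T)⁻¹ ≤ C₀ * (1 + g.dualQuad X (X - Y)) ^ N₀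
  uncertainty : ∀ X T, g.quad X T ≤ g.dualQuad X T

/-! ### Essentially uniformly confined families -/

/-- The norms `‖φ‖^{(k)}_{g_X, U_{X,r}}` of confinement, with values in `[0, ∞]`. -/
def confNorm (X : PhaseSpace V) (r : ℝ) (k : ℕ) (φ : PhaseSpace V → ℂ) : ℝ≥0∞ :=
  ⨆ (l : ℕ) (_ : l ≤ k) (Y : PhaseSpace V) (T : Fin l → {T : PhaseSpace V // T ≠ 0}),
    ENNReal.ofReal (‖iteratedFDeriv ℝ l φ Y (fun j ↦ (T j : PhaseSpace V))‖ *
      (1 + g.confDist X r Y) ^ ((k : ℝ) / 2) /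
        ∏ j, Real.sqrt (g.quad X (T j : PhaseSpace V)))

theorem dualQuad_nonneg (X T : PhaseSpace V) : 0 ≤ g.dualQuad X T := by
  set A := (g.Q X).symm (sympFunctional T : PhaseSpace V →ₗ[ℝ] ℝ) with hA
  have h1 : g.form X A A = g.dualQuad X T := by
    have := LinearMap.BilinForm.apply_toDual_symm_apply (hB := g.nondegenerate X)
      (sympFunctional T : PhaseSpace V →ₗ[ℝ] ℝ) A
    exact this
  rw [← h1]
  by_cases h : A = 0
  · simp [h]
  · exact (g.pos X A h).le

theorem confDist_nonneg (X : PhaseSpace V) (r : ℝ) (Y : PhaseSpace V) :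
    0 ≤ g.confDist X r Y := by
  apply Real.sInf_nonneg
  rintro _ ⟨Z, -, rfl⟩
  exact g.dualQuad_nonneg _ _

theorem confNorm_zero (X : PhaseSpace V) (r : ℝ) (k : ℕ) :
    g.confNorm X r k ((0 : 𝓢(PhaseSpace V, ℂ)) : PhaseSpace V → ℂ) = 0 := by
  have : ((0 : 𝓢(PhaseSpace V, ℂ)) : PhaseSpace V → ℂ) = fun _ ↦ 0 := by ext; simp
  simp only [confNorm, this]
  simp

theorem confNorm_add_le (X : PhaseSpace V) (r : ℝ) (k : ℕ) (φ ψ : 𝓢(PhaseSpace V, ℂ)) :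
    g.confNorm X r k (φ + ψ : 𝓢(PhaseSpace V, ℂ)) ≤
      g.confNorm X r k φ + g.confNorm X r k ψ := by
  have hcoe : ((φ + ψ : 𝓢(PhaseSpace V, ℂ)) : PhaseSpace V → ℂ) =
    (φ : PhaseSpace V → ℂ) + (ψ : PhaseSpace V → ℂ) := by ext; simp
  refine iSup_le fun l ↦ iSup_le fun hl ↦ iSup_le fun Y ↦ iSup_le fun T ↦ ?_
  have hle : ∀ χ : 𝓢(PhaseSpace V, ℂ),
      ENNReal.ofReal (‖iteratedFDeriv ℝ l χ Y (fun j ↦ (T j : PhaseSpace V))‖ *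
      (1 + g.confDist X r Y) ^ ((k : ℝ) / 2) /
        ∏ j, Real.sqrt (g.quad X (T j : PhaseSpace V))) ≤ g.confNorm X r k χ := fun χ ↦
    le_iSup_of_le l <| le_iSup_of_le hl <| le_iSup_of_le Y <| le_iSup_of_le T le_rfl
  refine le_trans ?_ (add_le_add (hle φ) (hle ψ))
  have hd := g.confDist_nonneg X r Y
  rw [← ENNReal.ofReal_add (by positivity) (by positivity), hcoe,
    iteratedFDeriv_add_apply (φ.smooth l).contDiffAt (ψ.smooth l).contDiffAt]
  apply ENNReal.ofReal_le_ofReal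
  rw [← add_div, ← add_mul]
  gcongr
  exact norm_add_le _ _

theorem confNorm_smul (X : PhaseSpace V) (r : ℝ) (k : ℕ) (c : ℂ) (φ : 𝓢(PhaseSpace V, ℂ)) :
    g.confNorm X r k (c • φ : 𝓢(PhaseSpace V, ℂ)) = ‖c‖ₑ * g.confNorm X r k φ := by
  have hcoe : ((c • φ : 𝓢(PhaseSpace V, ℂ)) : PhaseSpace V → ℂ) =
    c • (φ : PhaseSpace V → ℂ) := by ext; simp
  simp only [confNorm, hcoe, ENNReal.mul_iSup]
  refine iSup_congr fun l ↦ iSup_congr fun hl ↦ iSup_congr fun Y ↦ iSup_congr fun T ↦ ?_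
  rw [iteratedFDeriv_const_smul_apply (φ.smooth l).contDiffAt, ← ofReal_norm,
    ← ENNReal.ofReal_mul (norm_nonneg c)]
  congr 1
  simp only [smul_apply, norm_smul]
  ring

/-- The extended seminorms `‖φ‖^{(k)}_{g,r} = ess sup_X ‖φ(X)‖^{(k)}_{g_X, U_{X,r}}`. -/
def confESeminorm (r : ℝ) (k : ℕ) (φ : PhaseSpace V → 𝓢(PhaseSpace V, ℂ)) : ℝ≥0∞ :=
  essSup (fun X ↦ g.confNorm X r k (φ X)) (sympMeasure V)

theorem confESeminorm_zero (r : ℝ) (k : ℕ) :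
    g.confESeminorm r k (⇑(0 : PhaseSpace V →ₘ[sympMeasure V] 𝓢(PhaseSpace V, ℂ))) = 0 := by
  have : (fun X ↦ g.confNorm X r k
      ((0 : PhaseSpace V →ₘ[sympMeasure V] 𝓢(PhaseSpace V, ℂ)) X)) =ᵐ[sympMeasure V]
      (0 : PhaseSpace V → ℝ≥0∞) := by
    filter_upwards [AEEqFun.coeFn_zero (α := PhaseSpace V) (β := 𝓢(PhaseSpace V, ℂ))
      (μ := sympMeasure V)] with X hX
    rw [hX]
    exact g.confNorm_zero X r k
  exact (essSup_congr_ae this).trans (by simp [Pi.zero_def, ← bot_eq_zero'])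

theorem confESeminorm_add_le (r : ℝ) (k : ℕ)
    (φ ψ : PhaseSpace V →ₘ[sympMeasure V] 𝓢(PhaseSpace V, ℂ)) :
    g.confESeminorm r k ⇑(φ + ψ) ≤ g.confESeminorm r k ⇑φ + g.confESeminorm r k ⇑ψ := by
  refine le_trans (essSup_mono_ae ?_) (ENNReal.essSup_add_le _ _)
  filter_upwards [AEEqFun.coeFn_add φ ψ] with X hX
  rw [hX]
  exact g.confNorm_add_le X r k (φ X) (ψ X)

theorem confESeminorm_smul (r : ℝ) (k : ℕ) (c : ℂ)
    (φ : PhaseSpace V →ₘ[sympMeasure V] 𝓢(PhaseSpace V, ℂ)) :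
    g.confESeminorm r k ⇑(c • φ) = ‖c‖ₑ * g.confESeminorm r k ⇑φ := by
  rw [confESeminorm, confESeminorm, ← ENNReal.essSup_const_mul]
  refine essSup_congr_ae ?_
  filter_upwards [AEEqFun.coeFn_smul c φ] with X hX
  rw [hX]
  exact g.confNorm_smul X r k c (φ X)

/-- The classes (modulo equality a.e.) of strongly measurable maps `φ : W → 𝓢(W)` with
`‖φ‖^{(k)}_{g,r} < ∞` for all `k`. -/
def confSubmodule (r : ℝ) :
    Submodule ℂ (PhaseSpace V →ₘ[sympMeasure V] 𝓢(PhaseSpace V, ℂ)) where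
  carrier := {φ | ∀ k : ℕ, g.confESeminorm r k φ < ∞}
  zero_mem' k := by rw [confESeminorm_zero]; exact ENNReal.zero_lt_top
  add_mem' {φ ψ} hφ hψ k :=
    (g.confESeminorm_add_le r k φ ψ).trans_lt (ENNReal.add_lt_top.2 ⟨hφ k, hψ k⟩)
  smul_mem' c φ hφ k := by
    rw [confESeminorm_smul]
    exact ENNReal.mul_lt_top enorm_lt_top (hφ k)

/-- The space `Conf_g(W; r)`. -/
def Conf (r : ℝ) : Type _ := ↥(g.confSubmodule r)

namespace Conf

variable (r : ℝ)

instance : AddCommGroup (g.Conf r) := inferInstanceAs (AddCommGroup ↥(g.confSubmodule r))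

instance : Module ℂ (g.Conf r) := inferInstanceAs (Module ℂ ↥(g.confSubmodule r))

variable {g r} in
/-- The underlying class of measurable maps. -/
def toAEEqFun (φ : g.Conf r) : PhaseSpace V →ₘ[sympMeasure V] 𝓢(PhaseSpace V, ℂ) :=
  Subtype.val φ

/-- The seminorm `‖·‖^{(k)}_{g,r}` on `Conf_g(W; r)`. -/
def confSeminorm (k : ℕ) : Seminorm ℂ (g.Conf r) :=
  Seminorm.of (fun φ ↦ (g.confESeminorm r k φ.toAEEqFun).toReal)
    (fun φ ψ ↦ by
      have hφ := (φ.2 k).ne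
      have hψ := (ψ.2 k).ne
      exact (ENNReal.toReal_mono (ENNReal.add_ne_top.2 ⟨hφ, hψ⟩)
        (g.confESeminorm_add_le r k φ.toAEEqFun ψ.toAEEqFun)).trans
          (ENNReal.toReal_add hφ hψ).le)
    (fun c φ ↦ by
      have := g.confESeminorm_smul r k c φ.toAEEqFun
      change (g.confESeminorm r k ⇑(c • φ.toAEEqFun)).toReal = _
      rw [this, ENNReal.toReal_mul, toReal_enorm])

/-- The topology of `Conf_g(W; r)` is generated by the seminorms `‖·‖^{(k)}_{g,r}`, `k ∈ ℕ`. -/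
instance : TopologicalSpace (g.Conf r) :=
  SeminormFamily.moduleFilterBasis (𝕜 := ℂ) (confSeminorm g r) |>.topology

theorem withSeminorms : WithSeminorms (confSeminorm g r) := ⟨rfl⟩

end Conf

end RiemMetric

/-! ### Weighted `L^∞` spaces and their limits -/

section Weighted

variable {E : Type*} [NormedAddCommGroup E] [MeasurableSpace E]

/-- The norm of `f` in `L^∞` with weight `(1 + |·|)^s`, with values in `[0, ∞]`. -/
def wENorm (μ : Measure E) (s : ℝ) (f : E → ℂ) : ℝ≥0∞ :=
  eLpNorm (fun x ↦ (((1 + ‖x‖) ^ s : ℝ) : ℂ) * f x) ∞ μ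

variable (μ : Measure E)

theorem wENorm_zero (s : ℝ) : wENorm μ s ⇑(0 : E →ₘ[μ] ℂ) = 0 := by
  rw [wENorm, ← eLpNorm_zero (μ := μ) (p := ∞) (ε := ℂ) (α := E)]
  refine eLpNorm_congr_ae ?_
  filter_upwards [AEEqFun.coeFn_zero (α := E) (β := ℂ) (μ := μ)] with x hx
  simp [hx]

theorem wENorm_smul (s : ℝ) (c : ℂ) (f : E →ₘ[μ] ℂ) :
    wENorm μ s ⇑(c • f) = ‖c‖ₑ * wENorm μ s ⇑f := by
  rw [wENorm, wENorm, ← eLpNorm_const_smul]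
  refine eLpNorm_congr_ae ?_
  filter_upwards [AEEqFun.coeFn_smul c f] with x hx
  simp only [hx, Pi.smul_apply, smul_eq_mul]
  ring

theorem wENorm_mono {s t : ℝ} (hst : s ≤ t) (f : E → ℂ) : wENorm μ s f ≤ wENorm μ t f := by
  refine eLpNorm_mono fun x ↦ ?_
  have h1 : (1 : ℝ) ≤ 1 + ‖x‖ := by linarith [norm_nonneg x]
  rw [norm_mul, norm_mul, Complex.norm_of_nonneg (by positivity),
    Complex.norm_of_nonneg (by positivity)]
  gcongr

variable [BorelSpace E]

theorem aestronglyMeasurable_weight_mul (s : ℝ) (f : E →ₘ[μ] ℂ) :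
    AEStronglyMeasurable (fun x ↦ (((1 + ‖x‖) ^ s : ℝ) : ℂ) * f x) μ := by
  refine AEStronglyMeasurable.mul ?_ f.aestronglyMeasurable
  have : Measurable fun x : E ↦ (((1 + ‖x‖) ^ s : ℝ) : ℂ) := by fun_prop
  exact this.aestronglyMeasurable

theorem wENorm_add_le (s : ℝ) (f h : E →ₘ[μ] ℂ) :
    wENorm μ s ⇑(f + h) ≤ wENorm μ s ⇑f + wENorm μ s ⇑h := by
  refine le_trans (le_of_eq (eLpNorm_congr_ae ?_)) (eLpNorm_add_le
    (aestronglyMeasurable_weight_mul μ s f) (aestronglyMeasurable_weight_mul μ s h) le_top)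
  filter_upwards [AEEqFun.coeFn_add f h] with x hx
  simp [hx, mul_add]

/-- The measurable functions `f` with `(1 + |·|)^s f ∈ L^∞`, modulo equality a.e. -/
def wLinfSubmodule (s : ℝ) : Submodule ℂ (E →ₘ[μ] ℂ) where
  carrier := {f | wENorm μ s f < ∞}
  zero_mem' := by simp [wENorm_zero]
  add_mem' {f h} hf hh := (wENorm_add_le μ s f h).trans_lt (ENNReal.add_lt_top.2 ⟨hf, hh⟩)
  smul_mem' c f hf := by
    simp only [Set.mem_ofPred_eq, wENorm_smul]
    exact ENNReal.mul_lt_top enorm_lt_top hf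

/-- The Banach space `L^∞` with weight `(1 + |·|)^s`. -/
def WLinf (s : ℝ) : Type _ := ↥(wLinfSubmodule μ s)

namespace WLinf

variable (s : ℝ)

instance : AddCommGroup (WLinf μ s) := inferInstanceAs (AddCommGroup ↥(wLinfSubmodule μ s))

instance : Module ℂ (WLinf μ s) := inferInstanceAs (Module ℂ ↥(wLinfSubmodule μ s))

variable {μ s} in
/-- The underlying class of measurable functions. -/
def toAEEqFun (f : WLinf μ s) : E →ₘ[μ] ℂ := Subtype.val f

instance : Norm (WLinf μ s) := ⟨fun f ↦ (wENorm μ s f.toAEEqFun).toReal⟩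

theorem normedSpaceCore : NormedSpace.Core ℂ (WLinf μ s) where
  norm_nonneg f := ENNReal.toReal_nonneg
  norm_smul c f := by
    change (wENorm μ s ⇑(c • f.toAEEqFun)).toReal = _
    rw [wENorm_smul, ENNReal.toReal_mul, toReal_enorm]
    rfl
  norm_triangle f h := by
    have hf : wENorm μ s f.toAEEqFun ≠ ∞ := (LT.lt.ne f.2)
    have hh : wENorm μ s h.toAEEqFun ≠ ∞ := (LT.lt.ne h.2)
    change (wENorm μ s ⇑(f.toAEEqFun + h.toAEEqFun)).toReal ≤
      (wENorm μ s f.toAEEqFun).toReal + (wENorm μ s h.toAEEqFun).toReal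
    rw [← ENNReal.toReal_add hf hh]
    exact ENNReal.toReal_mono (ENNReal.add_ne_top.2 ⟨hf, hh⟩) (wENorm_add_le μ s _ _)
  norm_eq_zero_iff f := by
    have hf : wENorm μ s f.toAEEqFun ≠ ∞ := (LT.lt.ne f.2)
    change (wENorm μ s f.toAEEqFun).toReal = 0 ↔ _
    rw [ENNReal.toReal_eq_zero_iff, or_iff_left hf]
    constructor
    · intro h
      rw [wENorm, eLpNorm_eq_zero_iff (aestronglyMeasurable_weight_mul μ s _) (by simp)] at h
      refine Subtype.ext (AEEqFun.ext ?_)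
      change ⇑f.toAEEqFun =ᵐ[μ] ⇑(0 : E →ₘ[μ] ℂ)
      filter_upwards [h, AEEqFun.coeFn_zero (α := E) (β := ℂ) (μ := μ)] with x hx h0
      have h1 : (0 : ℝ) < (1 + ‖x‖) ^ s := Real.rpow_pos_of_pos (by positivity) _
      have h2 : (((1 + ‖x‖) ^ s : ℝ) : ℂ) ≠ 0 := by exact_mod_cast h1.ne'
      rw [h0]
      simpa [h2] using hx
    · rintro rfl
      exact wENorm_zero μ s

instance : NormedAddCommGroup (WLinf μ s) := NormedAddCommGroup.ofCore (normedSpaceCore μ s)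

instance : NormedSpace ℂ (WLinf μ s) := NormedSpace.ofCore (normedSpaceCore μ s)

end WLinf

/-- The union of the spaces `L^∞` with weight `(1 + |·|)^{-s}`, `s ≥ 0`. -/
def indLinfSubmodule : Submodule ℂ (E →ₘ[μ] ℂ) where
  carrier := {f | ∃ s : ℝ≥0, f ∈ wLinfSubmodule μ (-(s : ℝ))}
  zero_mem' := ⟨0, Submodule.zero_mem _⟩
  add_mem' := by
    rintro f h ⟨s, hs⟩ ⟨t, ht⟩
    refine ⟨max s t, Submodule.add_mem _ ?_ ?_⟩
    · exact (wENorm_mono μ (neg_le_neg (NNReal.coe_le_coe.2 (le_max_left s t))) f).trans_lt hs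
    · exact (wENorm_mono μ (neg_le_neg (NNReal.coe_le_coe.2 (le_max_right s t))) h).trans_lt ht
  smul_mem' := by
    rintro c f ⟨s, hs⟩
    exact ⟨s, Submodule.smul_mem _ c hs⟩

/-- The inductive limit of the spaces `L^∞` with weight `(1 + |·|)^{-s}` as `s → ∞`. -/
def IndLinf : Type _ := ↥(indLinfSubmodule μ)

namespace IndLinf

instance : AddCommGroup (IndLinf μ) := inferInstanceAs (AddCommGroup ↥(indLinfSubmodule μ))

instance : Module ℂ (IndLinf μ) := inferInstanceAs (Module ℂ ↥(indLinfSubmodule μ))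

instance : Module ℝ (IndLinf μ) := Module.complexToReal _

variable {μ} in
/-- The underlying class of measurable functions. -/
def toAEEqFun (f : IndLinf μ) : E →ₘ[μ] ℂ := Subtype.val f

/-- The canonical inclusion of a step into the inductive limit. -/
def incl (s : ℝ≥0) (f : WLinf μ (-(s : ℝ))) : IndLinf μ := ⟨f.toAEEqFun, s, f.2⟩

/-- The locally convex inductive limit topology: the finest locally convex topology for which all
the canonical inclusions are continuous. -/
instance topologicalSpace : TopologicalSpace (IndLinf μ) :=
  sInf {t : TopologicalSpace (IndLinf μ) |
    (∀ s : ℝ≥0, Continuous[inferInstance, t] (incl μ s)) ∧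
    @IsTopologicalAddGroup (IndLinf μ) t _ ∧
    @ContinuousSMul ℂ (IndLinf μ) _ _ t ∧
    @LocallyConvexSpace ℝ (IndLinf μ) _ _ _ _ t}

instance : IsTopologicalAddGroup (IndLinf μ) :=
  topologicalAddGroup_sInf fun _ ⟨_, ht, _, _⟩ ↦ ht

instance : ContinuousSMul ℂ (IndLinf μ) :=
  continuousSMul_sInf fun _ ⟨_, _, ht, _⟩ ↦ ht

instance : LocallyConvexSpace ℝ (IndLinf μ) :=
  .sInf fun _ ⟨_, _, _, ht⟩ ↦ ht

theorem continuous_incl (s : ℝ≥0) : Continuous (incl μ s) :=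
  continuous_sInf_rng.2 fun _ ht ↦ ht.1 s

end IndLinf

/-- The intersection of the spaces `L^∞` with weight `(1 + |·|)^s`, `s ≥ 0`. -/
def projLinfSubmodule : Submodule ℂ (E →ₘ[μ] ℂ) := ⨅ s : ℝ≥0, wLinfSubmodule μ (s : ℝ)

/-- The projective limit of the spaces `L^∞` with weight `(1 + |·|)^s` as `s → ∞`. -/
def ProjLinf : Type _ := ↥(projLinfSubmodule μ)

namespace ProjLinf

instance : AddCommGroup (ProjLinf μ) := inferInstanceAs (AddCommGroup ↥(projLinfSubmodule μ))

instance : Module ℂ (ProjLinf μ) := inferInstanceAs (Module ℂ ↥(projLinfSubmodule μ))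

variable {μ} in
/-- The underlying class of measurable functions. -/
def toAEEqFun (f : ProjLinf μ) : E →ₘ[μ] ℂ := Subtype.val f

/-- The canonical inclusion of the projective limit into a step. -/
def incl (s : ℝ≥0) (f : ProjLinf μ) : WLinf μ (s : ℝ) :=
  ⟨f.toAEEqFun, (Submodule.mem_iInf _).1 f.2 s⟩

/-- The projective limit topology. -/
instance : TopologicalSpace (ProjLinf μ) :=
  ⨅ s : ℝ≥0, TopologicalSpace.induced (incl μ s) inferInstance

end ProjLinf

end Weighted

/-! ### Hypocontinuity and smooth vector valued maps -/

/-- A biadditive map `u : E × F → G` is hypocontinuous if for every bounded subset of one factor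
and every neighbourhood `U` of `0` in `G` there is a neighbourhood of `0` in the other factor
such that `u` maps their product into `U`. -/
def IsHypocontinuous {E F G : Type*} [AddCommGroup E] [Module ℂ E] [TopologicalSpace E]
    [AddCommGroup F] [Module ℂ F] [TopologicalSpace F] [AddCommGroup G] [TopologicalSpace G]
    (u : E → F → G) : Prop :=
  (∀ B : Set E, Bornology.IsVonNBounded ℂ B → ∀ U ∈ 𝓝 (0 : G), ∃ N ∈ 𝓝 (0 : F),
    ∀ x ∈ B, ∀ y ∈ N, u x y ∈ U) ∧
  (∀ B : Set F, Bornology.IsVonNBounded ℂ B → ∀ U ∈ 𝓝 (0 : G), ∃ N ∈ 𝓝 (0 : E),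
    ∀ x ∈ N, ∀ y ∈ B, u x y ∈ U)

/-- `f : E → F` with values in a topological vector space is of class `C^k`: the iterated
directional derivatives of order at most `k` exist and are continuous (`E` is meant to be finite
dimensional). -/
def IsClassCk {E F : Type*} [AddCommGroup E] [Module ℝ E] [TopologicalSpace E]
    [AddCommGroup F] [Module ℝ F] [TopologicalSpace F] : ℕ → (E → F) → Prop
  | 0, f => Continuous f
  | k + 1, f => Continuous f ∧ ∀ v : E, ∃ f' : E → F,
      (∀ x, Tendsto (fun t : ℝ ↦ t⁻¹ • (f (x + t • v) - f x)) (𝓝[≠] 0) (𝓝 (f' x))) ∧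
      IsClassCk k f'

/-- `f` is of class `C^∞`. -/
def IsClassCinfty {E F : Type*} [AddCommGroup E] [Module ℝ E] [TopologicalSpace E]
    [AddCommGroup F] [Module ℝ F] [TopologicalSpace F] (f : E → F) : Prop :=
  ∀ k : ℕ, IsClassCk k f

/-! ### The geometric short-time Fourier transform -/

section GSTFT

variable {V : Type*} [NormedAddCommGroup V] [NormedSpace ℝ V]

/-- The function `Y ↦ e^{-2πi[Ξ, Y]}`. -/
def sympChar (Ξ Y : PhaseSpace V) : ℂ := Complex.exp (-(2 * Real.pi * sympForm Ξ Y : ℝ) * Complex.I)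

theorem hasTemperateGrowth_sympChar (Ξ : PhaseSpace V) :
    (sympChar Ξ).HasTemperateGrowth := by
  set h : ℝ → ℂ := fun t ↦ Complex.exp (-(2 * Real.pi * t : ℝ) * Complex.I) with hh
  set c : ℂ := -(2 * Real.pi : ℝ) * Complex.I with hc
  have hd : ∀ t, HasDerivAt h (c * h t) t := by
    intro t
    have h1 : HasDerivAt (fun t : ℝ ↦ c * (t : ℂ)) c t := by
      simpa using (Complex.ofRealCLM.hasDerivAt (x := t)).const_mul c
    have h2 := h1.cexp
    have h3 : h = fun t : ℝ ↦ Complex.exp (c * (t : ℂ)) := by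
      funext t
      simp only [hh, hc]
      congr 1
      push_cast
      ring
    rw [h3, mul_comm]
    exact h2
  have hn : ∀ n, iteratedDeriv n h = fun t ↦ c ^ n * h t := by
    intro n
    induction n with
    | zero => simp
    | succ n ih =>
      rw [iteratedDeriv_succ, ih]
      funext t
      rw [((hd t).const_mul (c ^ n)).deriv]
      ring
  have hg : h.HasTemperateGrowth := by
    refine ⟨?_, fun n ↦ ⟨0, ‖c‖ ^ n, fun t ↦ ?_⟩⟩
    · refine Complex.contDiff_exp.comp ?_
      exact (((Complex.ofRealCLM.contDiff.comp (contDiff_const.mul contDiff_id)).neg).mul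
        contDiff_const)
    · rw [norm_iteratedFDeriv_eq_norm_iteratedDeriv, hn, norm_mul, norm_pow]
      have : ‖h t‖ = 1 := by
        have := Complex.norm_exp_ofReal_mul_I (-(2 * Real.pi * t))
        simpa [hh] using this
      simp [this]
  exact hg.comp (sympFunctional Ξ).hasTemperateGrowth

/-- Complex conjugation on `𝓢(W)`. -/
def schwartzConj (φ : 𝓢(PhaseSpace V, ℂ)) : 𝓢(PhaseSpace V, ℂ) :=
  φ.postcompCLM (Complex.conjCLE : ℂ →L[ℝ] ℂ)

theorem schwartzConj_apply (φ : 𝓢(PhaseSpace V, ℂ)) (Y : PhaseSpace V) :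
    schwartzConj φ Y = starRingEnd ℂ (φ Y) := rfl

/-- The Schwartz function `e^{-2πi[Ξ, ·]} χ`. -/
def modulate (Ξ : PhaseSpace V) (χ : 𝓢(PhaseSpace V, ℂ)) : 𝓢(PhaseSpace V, ℂ) :=
  SchwartzMap.smulLeftCLM ℂ (sympChar Ξ) χ

theorem modulate_apply (Ξ : PhaseSpace V) (χ : 𝓢(PhaseSpace V, ℂ)) (Y : PhaseSpace V) :
    modulate Ξ χ Y = sympChar Ξ Y * χ Y :=
  SchwartzMap.smulLeftCLM_apply_apply (hasTemperateGrowth_sympChar Ξ) χ Y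

/-- The geometric short-time Fourier transform
`V_φ f (X, Ξ) = ⟨f, e^{-2πi[Ξ, ·]} \overline{φ_X}⟩` of `f ∈ 𝓢'(W)`. -/
def gstft (f : 𝓢(PhaseSpace V, ℂ) →L[ℂ] ℂ) (φ : PhaseSpace V → 𝓢(PhaseSpace V, ℂ))
    (p : PhaseSpace V × PhaseSpace V) : ℂ :=
  f (modulate p.2 (schwartzConj (φ p.1)))

variable [FiniteDimensional ℝ V] [MeasurableSpace V] [BorelSpace V]

variable (V) in
/-- The measure `dλ dλ` on `W × W`. -/
def sympMeasure₂ : Measure (PhaseSpace V × PhaseSpace V) := (sympMeasure V).prod (sympMeasure V)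

/-- The tempered distribution `χ ↦ ∫ ψ χ dλ` given by `ψ ∈ 𝓢(W)`. -/
def schwartzToDual (ψ : 𝓢(PhaseSpace V, ℂ)) : 𝓢(PhaseSpace V, ℂ) →L[ℂ] ℂ :=
  SchwartzMap.integralCLM ℂ (sympMeasure V) ∘L
    SchwartzMap.pairing (ContinuousLinearMap.mul ℂ ℂ) ψ

theorem schwartzToDual_apply (ψ χ : 𝓢(PhaseSpace V, ℂ)) :
    schwartzToDual ψ χ = ∫ Y, ψ Y * χ Y ∂(sympMeasure V) := by
  simp [schwartzToDual, SchwartzMap.integralCLM_apply]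

/-- The bounds in both variables on the derivatives of `φ(X, Y) = φ(X)(Y)`. -/
def HasMixedBounds (g : RiemMetric V) (r : ℝ) (φ : PhaseSpace V → 𝓢(PhaseSpace V, ℂ)) : Prop :=
  ∀ k : ℕ, ∃ s : ℝ, 0 ≤ s ∧ ∀ m : ℝ, 0 < m → ∃ C : ℝ, ∀ l' ≤ k, ∀ l'' ≤ k,
    ∀ (X Y : PhaseSpace V) (T : Fin l' → {T : PhaseSpace V // T ≠ 0})
      (S : Fin l'' → {S : PhaseSpace V // S ≠ 0}),
      ‖iteratedFDeriv ℝ l' (fun X' ↦ iteratedFDeriv ℝ l'' (φ X') Y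
          (fun j ↦ (S j : PhaseSpace V))) X (fun j ↦ (T j : PhaseSpace V))‖ *
        (1 + g.confDist X r Y) ^ (m / 2) /
      ((∏ j, Real.sqrt (g.quad X (T j))) * (∏ j, Real.sqrt (g.quad X (S j))) *
        (1 + ‖X‖) ^ s * (1 + ‖Y‖) ^ s) ≤ C

end GSTFT

end

noncomputable section

/-! Everything rests on comparing the weight 1 + g^σ_X(Y − U_{X,r}) with a fixed norm. Temperance at
the origin makes g_X comparable with |·|² up to powers of 1 + |X| (`polynomial_growth`). Together
with the uncertainty principle g_X ≤ g^σ_X this bounds 1 + |Y| by powers of 1 + |X| and of the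
weight (`norm_le_confDist`). Slow variation, and temperance used at a point of the ball, also bound
1 + |X| by powers of 1 + |Y| and of the weight (`center_le_confDist`). Hence a confined φ_X has
Schwartz seminorms of polynomial growth in X and, if a power of 1 + |Y| is conceded, derivatives
that decay rapidly in X.

Part (i). A bounded set of distributions is dominated by one Schwartz seminorm, and the modulation
costs powers of 1 + |Ξ|. So the transforms lie in one step of the inductive limit and are bounded
there by one seminorm of the family; this gives the equicontinuity and one half of the
hypocontinuity. For the other half, every neighbourhood of 0 in the inductive limit contains all F
with |F| ≤ h for some h that dominates all polynomials (`exists_majorant_of_mem_nhds`). For a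
bounded set of families the functions h(X, Ξ)⁻¹ e^{−2πi[Ξ,·]} \overline{φ_X} form a bounded set in
𝓢(W), and the f with |f| ≤ 1 on it form a neighbourhood of 0 in the strong dual.

Part (ii). The conceded powers of 1 + |Y| are absorbed by ψ, which gives decay in X; integration by
parts gives decay in Ξ.

Part (iii). A derivative in X replaces φ by a directional derivative, and a derivative in Ξ
multiplies ψ by a linear function. Both operations stay among pairs of a Schwartz function and a
smooth family with `HasRapidBounds`, so smoothness and decay follow by induction on the order. The
mixed bounds imply `HasRapidBounds` because their exponent s does not depend on m. -/

theorem abs_sympForm_le {V : Type*} [NormedAddCommGroup V] [NormedSpace ℝ V] (T S : PhaseSpace V) :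
    |sympForm T S| ≤ 2 * ‖T‖ * ‖S‖ := by
  rw [sympForm_apply]
  have h1 : |T.2 S.1| ≤ ‖T‖ * ‖S‖ := (T.2.le_opNorm S.1).trans
    (mul_le_mul (norm_snd_le T) (norm_fst_le S) (norm_nonneg _) (norm_nonneg _))
  have h2 : |S.2 T.1| ≤ ‖S‖ * ‖T‖ := (S.2.le_opNorm T.1).trans
    (mul_le_mul (norm_snd_le S) (norm_fst_le T) (norm_nonneg _) (norm_nonneg _))
  linarith [abs_sub (T.2 S.1) (S.2 T.1)]

/-! ### Linear algebra of g_X and its symplectic dual. -/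

namespace RiemMetric

variable {V : Type*} [NormedAddCommGroup V] [NormedSpace ℝ V]
  [FiniteDimensional ℝ V] [MeasurableSpace V] [BorelSpace V] (g : RiemMetric V)

theorem continuous_quad (X : PhaseSpace V) : Continuous (g.quad X) := by
  have h : (g.quad X) = fun T ↦ (g.form X).toContinuousBilinearMap T T := by
    ext T; simp [quad]
  rw [h]
  fun_prop

theorem quad_smul (X T : PhaseSpace V) (a : ℝ) : g.quad X (a • T) = a ^ 2 * g.quad X T := by
  simp only [quad, map_smul, LinearMap.smul_apply, smul_eq_mul]; ring

theorem quad_nonneg (X T : PhaseSpace V) : 0 ≤ g.quad X T := by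
  by_cases h : T = 0
  · simp [h, quad]
  · exact (g.pos X T h).le

theorem quad_zero (X : PhaseSpace V) : g.quad X 0 = 0 := by simp [quad]

theorem quad_add_le (X T S : PhaseSpace V) :
    g.quad X (T + S) ≤ 2 * g.quad X T + 2 * g.quad X S := by
  have := g.quad_nonneg X (T - S)
  simp only [quad, map_add, map_sub, LinearMap.add_apply, LinearMap.sub_apply] at *
  linarith

theorem form_sq_le (X T S : PhaseSpace V) : g.form X T S ^ 2 ≤ g.quad X T * g.quad X S := by
  by_cases hS : S = 0
  · simp [hS, quad]
  have hpos := g.pos X S hS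
  -- The component of T orthogonal to S, scaled by g_X(S, S); its nonnegative square is the
  -- Cauchy–Schwarz inequality.
  have h := g.quad_nonneg X (g.form X S S • T - g.form X T S • S)
  simp only [quad, map_sub, map_smul, LinearMap.sub_apply, LinearMap.smul_apply, smul_eq_mul,
    g.symm X S T] at h ⊢
  have h2 : 0 ≤ g.form X S S * (g.form X T T * g.form X S S - g.form X T S ^ 2) := by
    linarith
  nlinarith [nonneg_of_mul_nonneg_right h2 hpos]

theorem exists_quad_le (X : PhaseSpace V) : ∃ C > 0, ∀ T, g.quad X T ≤ C * ‖T‖ ^ 2 := by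
  obtain ⟨C, hC⟩ : ∃ C : ℝ, ∀ T, ‖(g.form X).toContinuousBilinearMap T T‖ ≤ C * ‖T‖ * ‖T‖ :=
    ⟨_, fun T ↦ (g.form X).toContinuousBilinearMap.le_opNorm₂ T T⟩
  refine ⟨|C| + 1, by positivity, fun T ↦ ?_⟩
  have h : g.quad X T ≤ C * ‖T‖ * ‖T‖ := (le_abs_self _).trans (hC T)
  nlinarith [sq_nonneg ‖T‖, mul_le_mul_of_nonneg_right (le_abs_self C) (sq_nonneg ‖T‖)]

theorem exists_le_quad (X : PhaseSpace V) : ∃ C > 0, ∀ T, ‖T‖ ^ 2 ≤ C * g.quad X T := by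
  rcases subsingleton_or_nontrivial (PhaseSpace V) with hV | hV
  · exact ⟨1, one_pos, fun T ↦ by simp [Subsingleton.elim T 0, quad_zero]⟩
  have hne : (Metric.sphere (0 : PhaseSpace V) 1).Nonempty :=
    NormedSpace.sphere_nonempty.2 zero_le_one
  obtain ⟨T₀, hT₀, hmin⟩ := (isCompact_sphere (0 : PhaseSpace V) 1).exists_isMinOn hne
    (g.continuous_quad X).continuousOn
  have hT₀0 : T₀ ≠ 0 := by
    rintro rfl
    simp at hT₀
  have hpos : 0 < g.quad X T₀ := g.pos X T₀ hT₀0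
  refine ⟨(g.quad X T₀)⁻¹, inv_pos.2 hpos, fun T ↦ ?_⟩
  rcases eq_or_ne T 0 with rfl | hT
  · simp [quad_zero]
  have hn : 0 < ‖T‖ := norm_pos_iff.2 hT
  have h1 : g.quad X T₀ ≤ g.quad X (‖T‖⁻¹ • T) := by
    apply hmin
    simp [norm_smul, hn.ne']
  rw [quad_smul] at h1
  rw [le_inv_mul_iff₀ hpos]
  calc g.quad X T₀ * ‖T‖ ^ 2 ≤ (‖T‖⁻¹ ^ 2 * g.quad X T) * ‖T‖ ^ 2 := by gcongr
    _ = g.quad X T := by field_simp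

/-- The vector `Q_X⁻¹ σ T` representing `[T, ·]` with respect to `g_X`. -/
def rep (X T : PhaseSpace V) : PhaseSpace V :=
  (g.Q X).symm (sympFunctional T : PhaseSpace V →ₗ[ℝ] ℝ)

theorem form_rep (X T S : PhaseSpace V) : g.form X (g.rep X T) S = sympForm T S :=
  LinearMap.BilinForm.apply_toDual_symm_apply (hB := g.nondegenerate X)
    (sympFunctional T : PhaseSpace V →ₗ[ℝ] ℝ) S

theorem quad_rep (X T : PhaseSpace V) : g.quad X (g.rep X T) = g.dualQuad X T :=
  g.form_rep X T _

/-- Duality reverses inequalities: both `rep X T` and `rep Z T` represent [T, ·], so g^σ_Z(T) =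
g_X(`rep X T`, `rep Z T`). Cauchy–Schwarz for g_X and the hypothesis then leave a factor g^σ_Z(T) to
be cancelled. -/
theorem dualQuad_le_of_quad_le {X Z : PhaseSpace V} {C : ℝ}
    (h : ∀ T, g.quad X T ≤ C * g.quad Z T) (T : PhaseSpace V) :
    g.dualQuad Z T ≤ C * g.dualQuad X T := by
  have h1 : g.dualQuad Z T = g.form X (g.rep X T) (g.rep Z T) := by
    rw [form_rep, ← quad_rep, quad, form_rep]
  have h2 := g.form_sq_le X (g.rep X T) (g.rep Z T)
  rw [← h1, quad_rep] at h2
  have h3 := h (g.rep Z T)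
  rw [quad_rep] at h3
  have h0 := g.dualQuad_nonneg X T
  have h0' := g.dualQuad_nonneg Z T
  have h4 : g.dualQuad Z T * g.dualQuad Z T ≤ (C * g.dualQuad X T) * g.dualQuad Z T := by
    nlinarith [mul_le_mul_of_nonneg_left h3 h0]
  rcases h0'.eq_or_lt with h5 | h5
  · rw [← h5]
    have h6 := (g.quad_nonneg X (g.rep X T)).trans (h (g.rep X T))
    -- The sign of C is not assumed; a negative C forces g^σ_X(T) = 0.
    by_cases hC : 0 ≤ C
    · positivity
    · have h7 : g.quad Z (g.rep X T) = 0 := by nlinarith [g.quad_nonneg Z (g.rep X T)]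
      have h8 : g.quad X (g.rep X T) ≤ C * g.quad Z (g.rep X T) := h _
      rw [quad_rep, h7] at h8
      have : g.dualQuad X T = 0 := by linarith
      simp [this]
  · exact le_of_mul_le_mul_right h4 h5

theorem exists_dualQuad_le (X : PhaseSpace V) : ∃ C > 0, ∀ T, g.dualQuad X T ≤ C * ‖T‖ ^ 2 := by
  obtain ⟨C, hC, h⟩ := g.exists_le_quad X
  refine ⟨4 * C, by positivity, fun T ↦ ?_⟩
  have h1 : g.dualQuad X T ≤ 2 * ‖T‖ * ‖g.rep X T‖ := by
    rw [← quad_rep, quad, form_rep]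
    exact (le_abs_self _).trans (abs_sympForm_le T (g.rep X T))
  have h2 := h (g.rep X T)
  rw [quad_rep] at h2
  have h0 := g.dualQuad_nonneg X T
  rcases h0.eq_or_lt with h5 | h5
  · rw [← h5]; positivity
  have h3 : g.dualQuad X T * g.dualQuad X T ≤ (4 * C * ‖T‖ ^ 2) * g.dualQuad X T := by
    calc g.dualQuad X T * g.dualQuad X T
        ≤ (2 * ‖T‖ * ‖g.rep X T‖) * (2 * ‖T‖ * ‖g.rep X T‖) := by gcongr
      _ = 4 * ‖T‖ ^ 2 * ‖g.rep X T‖ ^ 2 := by ring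
      _ ≤ 4 * ‖T‖ ^ 2 * (C * g.dualQuad X T) := by gcongr
      _ = _ := by ring
  exact le_of_mul_le_mul_right h3 h5

theorem mem_ball_self (X : PhaseSpace V) (r : ℝ) : X ∈ g.ball X r := by
  simp only [ball, Set.mem_ofPred_eq, sub_self, quad_zero]; positivity

/-- A near-minimiser replaces an attained infimum; the error 1 is harmless because only 1 +
`confDist` ever enters. -/
theorem exists_mem_ball_dualQuad_le (X : PhaseSpace V) (r : ℝ) (Y : PhaseSpace V) :
    ∃ Z ∈ g.ball X r, g.dualQuad X (Y - Z) ≤ g.confDist X r Y + 1 := by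
  have hne : ((fun Z ↦ g.dualQuad X (Y - Z)) '' g.ball X r).Nonempty :=
    ⟨_, X, g.mem_ball_self X r, rfl⟩
  obtain ⟨_, ⟨Z, hZ, rfl⟩, hlt⟩ := exists_lt_of_csInf_lt hne
    (lt_add_one (sInf ((fun Z ↦ g.dualQuad X (Y - Z)) '' g.ball X r)))
  exact ⟨Z, hZ, hlt.le⟩

/-! ### Consequences of temperance: polynomial comparison with a norm. -/

namespace IsHormander

variable {g} {C₀ r₀ N₀ : ℝ}

theorem quad_comparison (hg : g.IsHormander C₀ r₀ N₀) (X Y T : PhaseSpace V) :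
    g.quad X T ≤ C₀ * (1 + g.dualQuad X (X - Y)) ^ N₀ * g.quad Y T ∧
      g.quad Y T ≤ C₀ * (1 + g.dualQuad X (X - Y)) ^ N₀ * g.quad X T := by
  rcases eq_or_ne T 0 with rfl | hT
  · simp [quad_zero]
  obtain ⟨h1, h2⟩ := hg.temperate X Y T hT
  have hX : 0 < g.quad X T := g.pos X T hT
  have hY : 0 < g.quad Y T := g.pos Y T hT
  rw [inv_div] at h2
  exact ⟨(div_le_iff₀ hY).1 h1, (div_le_iff₀ hX).1 h2⟩

/-- Temperance compares g_X with g_0 up to (1 + g^σ_0(X))^{N₀}. This is a power of 1 + |X|, since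
g^σ_0 and g_0 are fixed quadratic forms on a finite-dimensional space. -/
theorem polynomial_growth (hg : g.IsHormander C₀ r₀ N₀) :
    ∃ (C : ℝ) (M : ℕ), 1 ≤ C ∧ ∀ X T,
      g.quad X T ≤ C * (1 + ‖X‖) ^ M * ‖T‖ ^ 2 ∧ ‖T‖ ^ 2 ≤ C * (1 + ‖X‖) ^ M * g.quad X T := by
  obtain ⟨c₁, hc₁, h₁⟩ := g.exists_quad_le 0
  obtain ⟨c₂, hc₂, h₂⟩ := g.exists_le_quad 0
  obtain ⟨c₃, hc₃, h₃⟩ := g.exists_dualQuad_le 0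
  obtain ⟨n, hn⟩ := exists_nat_ge N₀
  have hC₀ := hg.one_le
  have key : ∀ X, (1 + g.dualQuad 0 (0 - X)) ^ N₀ ≤ (1 + c₃) ^ n * (1 + ‖X‖) ^ (2 * n) := by
    intro X
    have h0 := g.dualQuad_nonneg 0 (0 - X)
    calc (1 + g.dualQuad 0 (0 - X)) ^ N₀ ≤ (1 + g.dualQuad 0 (0 - X)) ^ (n : ℝ) :=
          Real.rpow_le_rpow_of_exponent_le (by linarith) hn
      _ = (1 + g.dualQuad 0 (0 - X)) ^ n := Real.rpow_natCast _ _
      _ ≤ ((1 + c₃) * (1 + ‖X‖) ^ 2) ^ n := by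
          gcongr
          have := h₃ (0 - X)
          rw [zero_sub, norm_neg, ← zero_sub] at this
          nlinarith [norm_nonneg X, mul_nonneg hc₃.le (norm_nonneg X)]
      _ = _ := by rw [mul_pow, ← pow_mul]
  refine ⟨(1 + C₀ * (1 + c₃) ^ n * c₁) + C₀ * (1 + c₃) ^ n * c₂, 2 * n, ?_, fun X T ↦ ?_⟩
  · have : 0 ≤ C₀ * (1 + c₃) ^ n * c₁ := by positivity
    have : 0 ≤ C₀ * (1 + c₃) ^ n * c₂ := by positivity
    linarith
  obtain ⟨hA, hB⟩ := hg.quad_comparison 0 X T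
  have hq := g.quad_nonneg X T
  have hq0 := g.quad_nonneg 0 T
  constructor
  · calc g.quad X T ≤ C₀ * (1 + g.dualQuad 0 (0 - X)) ^ N₀ * g.quad 0 T := hB
      _ ≤ C₀ * ((1 + c₃) ^ n * (1 + ‖X‖) ^ (2 * n)) * (c₁ * ‖T‖ ^ 2) := by
          gcongr
          exacts [key X, h₁ T]
      _ = (C₀ * (1 + c₃) ^ n * c₁) * (1 + ‖X‖) ^ (2 * n) * ‖T‖ ^ 2 := by ring
      _ ≤ _ := by
          gcongr
          have : 0 ≤ C₀ * (1 + c₃) ^ n * c₂ := by positivity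
          linarith
  · calc ‖T‖ ^ 2 ≤ c₂ * g.quad 0 T := h₂ T
      _ ≤ c₂ * (C₀ * (1 + g.dualQuad 0 (0 - X)) ^ N₀ * g.quad X T) := by gcongr
      _ ≤ c₂ * (C₀ * ((1 + c₃) ^ n * (1 + ‖X‖) ^ (2 * n)) * g.quad X T) := by
          gcongr
          exact key X
      _ = (C₀ * (1 + c₃) ^ n * c₂) * (1 + ‖X‖) ^ (2 * n) * g.quad X T := by ring
      _ ≤ _ := by
          gcongr
          have : 0 ≤ C₀ * (1 + c₃) ^ n * c₁ := by positivity
          linarith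

end IsHormander

end RiemMetric

/-! ### The confinement weight and the pointwise size of confined functions. -/

namespace RiemMetric

variable {V : Type*} [NormedAddCommGroup V] [NormedSpace ℝ V]
  [FiniteDimensional ℝ V] [MeasurableSpace V] [BorelSpace V] (g : RiemMetric V)

theorem dualQuad_neg (X T : PhaseSpace V) : g.dualQuad X (-T) = g.dualQuad X T := by
  have h : g.rep X (-T) = -g.rep X T := by
    have : (sympFunctional (-T) : PhaseSpace V →L[ℝ] ℝ) = -sympFunctional T := by
      ext S <;> simp [sympFunctional]
    simp [rep, this]
  rw [← quad_rep, ← quad_rep, h]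
  simp [quad]

theorem norm_iteratedFDeriv_apply_le_of_confNorm_le {X : PhaseSpace V} {r A : ℝ} {k l : ℕ}
    {φ : PhaseSpace V → ℂ} (hA : 0 ≤ A) (h : g.confNorm X r k φ ≤ ENNReal.ofReal A) (hl : l ≤ k)
    (Y : PhaseSpace V) (T : Fin l → PhaseSpace V) :
    ‖iteratedFDeriv ℝ l φ Y T‖ * (1 + g.confDist X r Y) ^ ((k : ℝ) / 2) ≤
      A * ∏ j, Real.sqrt (g.quad X (T j)) := by
  by_cases hT : ∃ j, T j = 0
  · obtain ⟨j, hj⟩ := hT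
    rw [(iteratedFDeriv ℝ l φ Y).map_coord_zero j hj, norm_zero, zero_mul]
    positivity
  push Not at hT
  have hle : ENNReal.ofReal (‖iteratedFDeriv ℝ l φ Y T‖ *
      (1 + g.confDist X r Y) ^ ((k : ℝ) / 2) / ∏ j, Real.sqrt (g.quad X (T j))) ≤
      ENNReal.ofReal A :=
    (le_iSup_of_le l <| le_iSup_of_le hl <| le_iSup_of_le Y <|
      le_iSup (fun T : Fin l → {T : PhaseSpace V // T ≠ 0} ↦
        ENNReal.ofReal (‖iteratedFDeriv ℝ l φ Y (fun j ↦ (T j : PhaseSpace V))‖ *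
          (1 + g.confDist X r Y) ^ ((k : ℝ) / 2) /
            ∏ j, Real.sqrt (g.quad X (T j : PhaseSpace V)))) fun j ↦ ⟨T j, hT j⟩).trans h
  rw [ENNReal.ofReal_le_ofReal_iff hA] at hle
  rwa [div_le_iff₀] at hle
  exact Finset.prod_pos fun j _ ↦ Real.sqrt_pos.2 (g.pos X _ (hT j))

namespace IsHormander

variable {g} {C₀ r₀ N₀ : ℝ}

theorem sqrt_quad_le (hg : g.IsHormander C₀ r₀ N₀) : ∃ (C : ℝ) (M : ℕ), 1 ≤ C ∧
    ∀ X T, Real.sqrt (g.quad X T) ≤ C * (1 + ‖X‖) ^ M * ‖T‖ := by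
  obtain ⟨C, M, hC, h⟩ := hg.polynomial_growth
  refine ⟨C, M, hC, fun X T ↦ Real.sqrt_le_iff.2 ⟨by positivity, (h X T).1.trans ?_⟩⟩
  have h1 : 1 ≤ C * (1 + ‖X‖) ^ M :=
    one_le_mul_of_one_le_of_one_le hC (one_le_pow₀ (by linarith [norm_nonneg X]))
  rw [mul_pow]
  gcongr
  nlinarith

/-- With Z nearly closest to Y in the ball, Y is reached from 0 through X and Z. The uncertainty
principle turns g^σ_X(Y − Z), which the weight controls, into a bound for g_X(Y − Z) and so for |Y −
Z|. -/
theorem norm_le_confDist (hg : g.IsHormander C₀ r₀ N₀) (r : ℝ) : ∃ (C : ℝ) (M : ℕ), 1 ≤ C ∧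
    ∀ X Y, 1 + ‖Y‖ ≤ C * (1 + ‖X‖) ^ M * (1 + g.confDist X r Y) ^ M := by
  obtain ⟨C, M, hC, h⟩ := hg.polynomial_growth
  refine ⟨3 + C * r ^ 2 + C, M + 1, by nlinarith [sq_nonneg r], fun X Y ↦ ?_⟩
  obtain ⟨Z, hZ, hZY⟩ := g.exists_mem_ball_dualQuad_le X r Y
  have hZ' : g.quad X (X - Z) ≤ r ^ 2 := hZ
  set e := 1 + g.confDist X r Y with he
  set a := 1 + ‖X‖ with ha
  have he1 : 1 ≤ e := by linarith [g.confDist_nonneg X r Y]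
  have ha1 : 1 ≤ a := by linarith [norm_nonneg X]
  have h1 : ‖X - Z‖ ^ 2 ≤ C * a ^ M * r ^ 2 := (h X (X - Z)).2.trans (by gcongr)
  have h2 : ‖Y - Z‖ ^ 2 ≤ C * a ^ M * e := (h X (Y - Z)).2.trans (by
    gcongr
    exact (hg.uncertainty X _).trans (by linarith))
  have h3 : ‖Y‖ ≤ ‖Y - Z‖ + ‖X - Z‖ + ‖X‖ := by
    have := norm_add_le (Y - Z) (Z - X + X)
    have h4 := norm_add_le (Z - X) X
    rw [norm_sub_rev Z X] at h4
    rw [show Y - Z + (Z - X + X) = Y by abel] at this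
    linarith
  have hae : a ^ (M + 1) * e ^ (M + 1) ≥ 1 :=
    one_le_mul_of_one_le_of_one_le (one_le_pow₀ ha1) (one_le_pow₀ he1)
  have h5 : a ≤ a ^ (M + 1) * e ^ (M + 1) := by
    calc a = a ^ 1 * 1 := by ring
      _ ≤ a ^ (M + 1) * e ^ (M + 1) := by
        gcongr
        · omega
        · exact one_le_pow₀ he1
  have h6 : a ^ M * e ≤ a ^ (M + 1) * e ^ (M + 1) := by
    calc a ^ M * e = a ^ M * e ^ 1 := by ring
      _ ≤ a ^ (M + 1) * e ^ (M + 1) := by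
        gcongr <;> omega
  have h7 : a ^ M ≤ a ^ (M + 1) * e ^ (M + 1) := by
    refine le_trans ?_ h6
    nlinarith [pow_pos (one_pos.trans_le ha1) M]
  have h8 : C * a ^ M * r ^ 2 ≤ C * r ^ 2 * (a ^ (M + 1) * e ^ (M + 1)) := by
    rw [mul_right_comm]; gcongr
  have h9 : C * a ^ M * e ≤ C * (a ^ (M + 1) * e ^ (M + 1)) := by
    rw [mul_assoc]; gcongr
  -- Converts the bounds on squared norms into bounds on norms.
  have h10 : ∀ t : ℝ, t ≤ 1 + t ^ 2 := fun t ↦ by nlinarith [sq_nonneg (t - 1)]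
  nlinarith [h10 ‖X - Z‖, h10 ‖Y - Z‖]

/-- To keep X off the right side, |X − Y| is measured with g_Y. Temperance cannot be applied between
X and Y, because g^σ_X(X − Y) is not controlled by the distance to a g_X-ball. It is applied between
Y and a point Z of the ball, and slow variation, available since r ≤ r₀, passes from Z to X for g as
well as for g^σ. -/
theorem center_le_confDist (hg : g.IsHormander C₀ r₀ N₀) {r : ℝ} (hr : 0 < r) (hrr₀ : r ≤ r₀) :
    ∃ (C : ℝ) (M : ℕ), 1 ≤ C ∧
      ∀ X Y, 1 + ‖X‖ ≤ C * (1 + ‖Y‖) ^ M * (1 + g.confDist X r Y) ^ M := by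
  obtain ⟨C, M, hC, h⟩ := hg.polynomial_growth
  obtain ⟨n, hn⟩ := exists_nat_ge N₀
  have hC₀ := hg.one_le
  set K := C * (C₀ * (1 + C₀) ^ n) * (C₀ * (2 * r ^ 2 + 2)) with hK
  have hK0 : 0 ≤ K := by positivity
  refine ⟨2 + K, M + n + 1, by linarith, fun X Y ↦ ?_⟩
  obtain ⟨Z, hZ, hZY⟩ := g.exists_mem_ball_dualQuad_le X r Y
  have hZ' : g.quad X (X - Z) ≤ r ^ 2 := hZ
  have hZ'' : g.quad X (X - Z) ≤ r₀ ^ 2 := hZ'.trans (by gcongr)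
  set e := 1 + g.confDist X r Y with he
  set b := 1 + ‖Y‖ with hb
  have he1 : 1 ≤ e := by linarith [g.confDist_nonneg X r Y]
  have hb1 : 1 ≤ b := by linarith [norm_nonneg Y]
  have hZX : ∀ T, g.quad Z T ≤ C₀ * g.quad X T := fun T ↦
    (inv_mul_le_iff₀ (by linarith)).1 (hg.slow X Z T hZ'').1
  have hdual : g.dualQuad Z (Z - Y) ≤ C₀ * e := by
    refine (g.dualQuad_le_of_quad_le (fun T ↦ (hg.slow X Z T hZ'').2) _).trans ?_
    rw [← dualQuad_neg, neg_sub]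
    gcongr
    linarith
  have h0 := g.dualQuad_nonneg Z (Z - Y)
  have hpow : (1 + g.dualQuad Z (Z - Y)) ^ N₀ ≤ (1 + C₀) ^ n * e ^ n := by
    calc (1 + g.dualQuad Z (Z - Y)) ^ N₀ ≤ (1 + g.dualQuad Z (Z - Y)) ^ (n : ℝ) :=
          Real.rpow_le_rpow_of_exponent_le (by linarith) hn
      _ = (1 + g.dualQuad Z (Z - Y)) ^ n := Real.rpow_natCast _ _
      _ ≤ ((1 + C₀) * e) ^ n := by
          gcongr
          nlinarith
      _ = _ := mul_pow _ _ _
  have hXY : g.quad X (X - Y) ≤ (2 * r ^ 2 + 2) * e := by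
    have h1 := g.quad_add_le X (X - Z) (Z - Y)
    rw [sub_add_sub_cancel] at h1
    have h2 : g.quad X (Z - Y) ≤ e := by
      refine (hg.uncertainty X _).trans ?_
      rw [← dualQuad_neg, neg_sub]
      linarith
    nlinarith [sq_nonneg r]
  have h1 : ‖X - Y‖ ^ 2 ≤ K * (b ^ M * e ^ (n + 1)) := by
    calc ‖X - Y‖ ^ 2 ≤ C * b ^ M * g.quad Y (X - Y) := (h Y _).2
      _ ≤ C * b ^ M * (C₀ * (1 + g.dualQuad Z (Z - Y)) ^ N₀ * g.quad Z (X - Y)) := by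
          gcongr
          exact (hg.quad_comparison Z Y _).2
      _ ≤ C * b ^ M * (C₀ * ((1 + C₀) ^ n * e ^ n) * (C₀ * ((2 * r ^ 2 + 2) * e))) := by
          have hq := g.quad_nonneg Z (X - Y)
          gcongr
          exact (hZX _).trans (by gcongr)
      _ = K * (b ^ M * e ^ (n + 1)) := by rw [hK]; ring
  have h2 : b ^ M * e ^ (n + 1) ≤ b ^ (M + n + 1) * e ^ (M + n + 1) := by
    gcongr <;> omega
  have h3 : b ≤ b ^ (M + n + 1) * e ^ (M + n + 1) := by
    calc b = b ^ 1 * 1 := by ring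
      _ ≤ b ^ (M + n + 1) * e ^ (M + n + 1) := by
        gcongr
        · omega
        · exact one_le_pow₀ he1
  have h4 : ‖X‖ ≤ ‖Y‖ + ‖X - Y‖ := by
    have := norm_add_le Y (X - Y)
    rwa [add_sub_cancel] at this
  have h5 : ‖X - Y‖ ≤ 1 + ‖X - Y‖ ^ 2 := by nlinarith [sq_nonneg (‖X - Y‖ - 1)]
  have h6 := mul_le_mul_of_nonneg_left h2 hK0
  nlinarith

/-- Each direction of differentiation costs the ratio of g_X^{1/2} to the norm, a power of 1 + |X|.
The even order 2k makes the exponent of the weight the integer k. -/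
theorem norm_iteratedFDeriv_mul_confDist_le (hg : g.IsHormander C₀ r₀ N₀) (r : ℝ) :
    ∃ (C : ℝ) (M : ℕ), 1 ≤ C ∧ ∀ (X : PhaseSpace V) (φ : PhaseSpace V → ℂ) (A : ℝ) (k l : ℕ),
      0 ≤ A → l ≤ 2 * k → g.confNorm X r (2 * k) φ ≤ ENNReal.ofReal A → ∀ Y,
        ‖iteratedFDeriv ℝ l φ Y‖ * (1 + g.confDist X r Y) ^ k ≤
          A * (C * (1 + ‖X‖) ^ M) ^ l := by
  obtain ⟨C, M, hC, h⟩ := hg.sqrt_quad_le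
  refine ⟨C, M, hC, fun X φ A k l hA hl hφ Y ↦ ?_⟩
  have hd := g.confDist_nonneg X r Y
  rw [← le_div_iff₀ (by positivity)]
  refine ContinuousMultilinearMap.opNorm_le_bound (by positivity) fun T ↦ ?_
  have h1 := g.norm_iteratedFDeriv_apply_le_of_confNorm_le hA hφ hl Y T
  rw [show ((2 * k : ℕ) : ℝ) / 2 = (k : ℕ) by push_cast; ring, Real.rpow_natCast] at h1
  rw [div_mul_eq_mul_div, le_div_iff₀ (by positivity)]
  refine h1.trans ?_
  rw [mul_assoc]
  gcongr
  calc ∏ j, Real.sqrt (g.quad X (T j)) ≤ ∏ j, C * (1 + ‖X‖) ^ M * ‖T j‖ :=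
        Finset.prod_le_prod (fun _ _ ↦ Real.sqrt_nonneg _) fun j _ ↦ h X (T j)
    _ = _ := by simp [Finset.prod_mul_distrib]

/-- Confined functions are Schwartz functions with seminorms of polynomial growth in the
centre. -/
theorem norm_iteratedFDeriv_le_center (hg : g.IsHormander C₀ r₀ N₀) (r : ℝ) (n : ℕ) :
    ∃ (k : ℕ) (C : ℝ) (M : ℕ), 0 ≤ C ∧
      ∀ (X : PhaseSpace V) (φ : PhaseSpace V → ℂ) (A : ℝ), 0 ≤ A →
        g.confNorm X r k φ ≤ ENNReal.ofReal A → ∀ l ≤ n, ∀ Y,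
          (1 + ‖Y‖) ^ n * ‖iteratedFDeriv ℝ l φ Y‖ ≤ C * A * (1 + ‖X‖) ^ M := by
  obtain ⟨C₁, M₁, hC₁, h₁⟩ := hg.norm_iteratedFDeriv_mul_confDist_le r
  obtain ⟨C₂, M₂, hC₂, h₂⟩ := hg.norm_le_confDist r
  -- The weight to the power M₂n pays for (1 + |Y|)^n; the extra n only makes the order large enough
  -- for l ≤ n derivatives.
  refine ⟨2 * (M₂ * n + n), C₂ ^ n * C₁ ^ n, M₂ * n + M₁ * n, by positivity,
    fun X φ A hA hφ l hl Y ↦ ?_⟩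
  have hd := g.confDist_nonneg X r Y
  have ha : 1 ≤ 1 + ‖X‖ := by linarith [norm_nonneg X]
  calc (1 + ‖Y‖) ^ n * ‖iteratedFDeriv ℝ l φ Y‖
      ≤ (C₂ * (1 + ‖X‖) ^ M₂ * (1 + g.confDist X r Y) ^ M₂) ^ n * ‖iteratedFDeriv ℝ l φ Y‖ := by
        gcongr
        exact h₂ X Y
    _ = C₂ ^ n * (1 + ‖X‖) ^ (M₂ * n) *
          (‖iteratedFDeriv ℝ l φ Y‖ * (1 + g.confDist X r Y) ^ (M₂ * n)) := by
        rw [mul_pow, mul_pow, ← pow_mul, ← pow_mul]; ring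
    _ ≤ C₂ ^ n * (1 + ‖X‖) ^ (M₂ * n) *
          (‖iteratedFDeriv ℝ l φ Y‖ * (1 + g.confDist X r Y) ^ (M₂ * n + n)) := by
        gcongr
        · linarith
        · omega
    _ ≤ C₂ ^ n * (1 + ‖X‖) ^ (M₂ * n) * (A * (C₁ * (1 + ‖X‖) ^ M₁) ^ l) := by
        refine mul_le_mul_of_nonneg_left ?_ (by positivity)
        exact h₁ X φ A _ l hA (by omega) hφ Y
    _ ≤ C₂ ^ n * (1 + ‖X‖) ^ (M₂ * n) * (A * (C₁ * (1 + ‖X‖) ^ M₁) ^ n) := by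
        gcongr
        exact one_le_mul_of_one_le_of_one_le hC₁ (one_le_pow₀ ha)
    _ = _ := by rw [mul_pow, ← pow_mul]; ring

/-- Confined functions, estimated by powers of the distance to the origin, decay rapidly in the
centre. -/
theorem norm_iteratedFDeriv_le_point (hg : g.IsHormander C₀ r₀ N₀) {r : ℝ} (hr : 0 < r)
    (hrr₀ : r ≤ r₀) (n : ℕ) :
    ∃ (k : ℕ) (C : ℝ) (M : ℕ), 0 ≤ C ∧
      ∀ (X : PhaseSpace V) (φ : PhaseSpace V → ℂ) (A : ℝ), 0 ≤ A →
        g.confNorm X r k φ ≤ ENNReal.ofReal A → ∀ l ≤ n, ∀ Y,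
          (1 + ‖X‖) ^ n * ‖iteratedFDeriv ℝ l φ Y‖ ≤ C * A * (1 + ‖Y‖) ^ M := by
  obtain ⟨C₁, M₁, hC₁, h₁⟩ := hg.norm_iteratedFDeriv_mul_confDist_le r
  obtain ⟨C₂, M₂, hC₂, h₂⟩ := hg.center_le_confDist hr hrr₀
  -- Of the power p of 1 + |X|, the part M₁n compensates the growth caused by the change of norm in
  -- the directions and is cancelled at the end; the part n is the decay to be proved.
  set p := M₁ * n + n with hp
  refine ⟨2 * (M₂ * p + n), C₂ ^ p * C₁ ^ n, M₂ * p, by positivity,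
    fun X φ A hA hφ l hl Y ↦ ?_⟩
  have hd := g.confDist_nonneg X r Y
  have ha : 1 ≤ 1 + ‖X‖ := by linarith [norm_nonneg X]
  set a := 1 + ‖X‖ with ha'
  set e := 1 + g.confDist X r Y with he'
  have he1 : 1 ≤ e := by linarith
  have hD : ‖iteratedFDeriv ℝ l φ Y‖ * e ^ (M₂ * p) ≤ A * (C₁ ^ n * a ^ (M₁ * n)) := by
    calc ‖iteratedFDeriv ℝ l φ Y‖ * e ^ (M₂ * p)
        ≤ ‖iteratedFDeriv ℝ l φ Y‖ * e ^ (M₂ * p + n) := by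
          gcongr
          omega
      _ ≤ A * (C₁ * a ^ M₁) ^ l := h₁ X φ A _ l hA (by omega) hφ Y
      _ ≤ A * (C₁ * a ^ M₁) ^ n := by
          gcongr
          exact one_le_mul_of_one_le_of_one_le hC₁ (one_le_pow₀ ha)
      _ = _ := by rw [mul_pow, ← pow_mul]
  have hX : a ^ p ≤ C₂ ^ p * (1 + ‖Y‖) ^ (M₂ * p) * e ^ (M₂ * p) := by
    calc a ^ p ≤ (C₂ * (1 + ‖Y‖) ^ M₂ * e ^ M₂) ^ p := by
          gcongr
          exact h₂ X Y
      _ = _ := by rw [mul_pow, mul_pow, ← pow_mul, ← pow_mul]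
  have hpos : 0 < a ^ (M₁ * n) := by positivity
  refine le_of_mul_le_mul_left ?_ hpos
  calc a ^ (M₁ * n) * (a ^ n * ‖iteratedFDeriv ℝ l φ Y‖)
      = a ^ p * ‖iteratedFDeriv ℝ l φ Y‖ := by rw [hp, pow_add]; ring
    _ ≤ C₂ ^ p * (1 + ‖Y‖) ^ (M₂ * p) * e ^ (M₂ * p) * ‖iteratedFDeriv ℝ l φ Y‖ := by gcongr
    _ = C₂ ^ p * (1 + ‖Y‖) ^ (M₂ * p) * (‖iteratedFDeriv ℝ l φ Y‖ * e ^ (M₂ * p)) := by ring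
    _ ≤ C₂ ^ p * (1 + ‖Y‖) ^ (M₂ * p) * (A * (C₁ ^ n * a ^ (M₁ * n))) := by gcongr
    _ = _ := by ring

end IsHormander

end RiemMetric

/-! ### Modulation and conjugation on the Schwartz space. -/

section Modulation

variable {V : Type*} [NormedAddCommGroup V] [NormedSpace ℝ V]

theorem norm_sympFunctional_le (X : PhaseSpace V) :
    ‖(sympFunctional X : PhaseSpace V →L[ℝ] ℝ)‖ ≤ 2 * ‖X‖ :=
  ContinuousLinearMap.opNorm_le_bound _ (by positivity) fun Y ↦ abs_sympForm_le X Y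

theorem norm_iteratedFDeriv_sympChar_le (Ξ Y : PhaseSpace V) (n : ℕ) :
    ‖iteratedFDeriv ℝ n (sympChar Ξ) Y‖ ≤ (4 * Real.pi * ‖Ξ‖) ^ n := by
  set c : ℂ := -(2 * Real.pi : ℝ) * Complex.I with hc
  have hcn : ‖c‖ = 2 * Real.pi := by
    simp [hc, abs_of_pos Real.pi_pos]
  set h : ℝ → ℂ := fun t ↦ Complex.exp (c * t) with hh
  have hd : ∀ t, HasDerivAt h (c * h t) t := by
    intro t
    have h1 : HasDerivAt (fun t : ℝ ↦ c * (t : ℂ)) c t := by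
      simpa using (Complex.ofRealCLM.hasDerivAt (x := t)).const_mul c
    rw [mul_comm]
    exact h1.cexp
  have hn : ∀ n, iteratedDeriv n h = fun t ↦ c ^ n * h t := by
    intro n
    induction n with
    | zero => simp
    | succ n ih =>
      rw [iteratedDeriv_succ, ih]
      funext t
      rw [((hd t).const_mul (c ^ n)).deriv]
      ring
  have hsm : ContDiff ℝ (⊤ : ℕ∞) h :=
    Complex.contDiff_exp.comp (contDiff_const.mul Complex.ofRealCLM.contDiff)
  have hcomp : sympChar Ξ = h ∘ (sympFunctional Ξ : PhaseSpace V →L[ℝ] ℝ) := by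
    funext Y
    simp only [sympChar, hh, hc, Function.comp_apply, sympForm]
    congr 1
    push_cast
    ring
  rw [hcomp, ContinuousLinearMap.iteratedFDeriv_comp_right _ hsm _ (mod_cast le_top)]
  refine (ContinuousMultilinearMap.norm_compContinuousLinearMap_le _ _).trans ?_
  rw [norm_iteratedFDeriv_eq_norm_iteratedDeriv, hn, norm_mul, norm_pow, hcn]
  have h1 : ‖h ((sympFunctional Ξ : PhaseSpace V →L[ℝ] ℝ) Y)‖ = 1 := by
    rw [hh, hc, Complex.norm_exp]
    simp
  rw [h1, mul_one, Finset.prod_const, Finset.card_univ, Fintype.card_fin, ← mul_pow]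
  have := norm_sympFunctional_le Ξ
  have hpi := Real.pi_pos
  refine pow_le_pow_left₀ (by positivity) ?_ n
  nlinarith

/-- The Leibniz rule together with the binomial theorem. The weight w is an arbitrary constant, so
that powers of 1 + |Y| can be carried along. -/
theorem norm_iteratedFDeriv_modulate_le (Ξ Y : PhaseSpace V) (χ : 𝓢(PhaseSpace V, ℂ)) (n : ℕ)
    {w B : ℝ} (hw : 0 ≤ w) (hB : ∀ j ≤ n, w * ‖iteratedFDeriv ℝ j χ Y‖ ≤ B) :
    w * ‖iteratedFDeriv ℝ n (modulate Ξ χ) Y‖ ≤ B * (1 + 4 * Real.pi * ‖Ξ‖) ^ n := by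
  have hcoe : (modulate Ξ χ : PhaseSpace V → ℂ) = fun Y ↦ sympChar Ξ Y * χ Y := by
    funext Y; exact modulate_apply Ξ χ Y
  have h1 := norm_iteratedFDeriv_mul_le (n := n) ((hasTemperateGrowth_sympChar Ξ).1)
    (χ.smooth ⊤) Y (mod_cast le_top)
  rw [hcoe]
  have hB0 : 0 ≤ B := (by positivity : 0 ≤ w * ‖iteratedFDeriv ℝ 0 χ Y‖).trans (hB 0 (by omega))
  calc w * ‖iteratedFDeriv ℝ n (fun Y ↦ sympChar Ξ Y * χ Y) Y‖
      ≤ w * ∑ i ∈ Finset.range (n + 1), (n.choose i : ℝ) * ‖iteratedFDeriv ℝ i (sympChar Ξ) Y‖ *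
          ‖iteratedFDeriv ℝ (n - i) χ Y‖ := by gcongr
    _ = ∑ i ∈ Finset.range (n + 1), (n.choose i : ℝ) * ‖iteratedFDeriv ℝ i (sympChar Ξ) Y‖ *
          (w * ‖iteratedFDeriv ℝ (n - i) χ Y‖) := by
        rw [Finset.mul_sum]
        exact Finset.sum_congr rfl fun i _ ↦ by ring
    _ ≤ ∑ i ∈ Finset.range (n + 1), (n.choose i : ℝ) * (4 * Real.pi * ‖Ξ‖) ^ i * B := by
        gcongr with i hi
        · exact norm_iteratedFDeriv_sympChar_le Ξ Y i
        · exact hB _ (by omega)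
    _ = _ := by
        rw [add_comm 1, add_pow, Finset.mul_sum]
        exact Finset.sum_congr rfl fun i _ ↦ by simp; ring

theorem modulate_add (Ξ H : PhaseSpace V) (χ : 𝓢(PhaseSpace V, ℂ)) :
    modulate (Ξ + H) χ = modulate Ξ (modulate H χ) := by
  ext Y
  simp only [modulate_apply, ← mul_assoc]
  congr 1
  have : sympForm (Ξ + H) Y = sympForm Ξ Y + sympForm H Y := by
    simp only [sympForm_apply]; simp; ring
  rw [sympChar, sympChar, sympChar, ← Complex.exp_add, this]
  congr 1
  push_cast
  ring

theorem norm_sympChar_sub_one_le (Ξ Y : PhaseSpace V) :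
    ‖sympChar Ξ Y - 1‖ ≤ 4 * Real.pi * ‖Ξ‖ * ‖Y‖ := by
  have h := Real.norm_exp_I_mul_ofReal_sub_one_le (x := -(2 * Real.pi * sympForm Ξ Y))
  have h1 : sympChar Ξ Y = Complex.exp (Complex.I * ((-(2 * Real.pi * sympForm Ξ Y) : ℝ) : ℂ)) := by
    rw [sympChar]
    congr 1
    push_cast
    ring
  rw [h1]
  refine h.trans ?_
  rw [norm_neg, norm_mul, Real.norm_of_nonneg (by positivity)]
  have := abs_sympForm_le Ξ Y
  rw [Real.norm_eq_abs]
  have hpi := Real.pi_pos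
  nlinarith

theorem norm_iteratedFDeriv_sympChar_sub_one_le (Ξ Y : PhaseSpace V) (hΞ : ‖Ξ‖ ≤ 1) (n : ℕ) :
    ‖iteratedFDeriv ℝ n (fun Y ↦ sympChar Ξ Y - 1) Y‖ ≤
      (4 * Real.pi) ^ (n + 1) * ‖Ξ‖ * (1 + ‖Y‖) := by
  have hK : 1 ≤ 4 * Real.pi := by linarith [Real.pi_gt_three]
  rcases Nat.eq_zero_or_pos n with rfl | hn
  · rw [norm_iteratedFDeriv_zero]
    refine (norm_sympChar_sub_one_le Ξ Y).trans ?_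
    rw [zero_add, pow_one]
    gcongr
    linarith
  · have h1 : iteratedFDeriv ℝ n (fun Y ↦ sympChar Ξ Y - 1) Y = iteratedFDeriv ℝ n (sympChar Ξ) Y := by
      have hs : ContDiffAt ℝ n (sympChar Ξ) Y :=
        ((hasTemperateGrowth_sympChar Ξ).1.of_le (mod_cast le_top)).contDiffAt
      rw [fun_iteratedFDeriv_sub_apply hs contDiffAt_const,
        iteratedFDeriv_const_of_ne hn.ne']
      simp
    rw [h1]
    refine (norm_iteratedFDeriv_sympChar_le Ξ Y n).trans ?_
    rw [mul_pow]
    calc (4 * Real.pi) ^ n * ‖Ξ‖ ^ n ≤ (4 * Real.pi) ^ (n + 1) * ‖Ξ‖ ^ 1 := by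
          gcongr ?_ * ?_
          · exact pow_le_pow_right₀ hK (by omega)
          · exact pow_le_pow_of_le_one (norm_nonneg _) hΞ hn
      _ ≤ _ := by
          rw [pow_one]
          have : 0 ≤ (4 * Real.pi) ^ (n + 1) * ‖Ξ‖ := by positivity
          nlinarith [norm_nonneg Y]

theorem exists_pow_mul_norm_iteratedFDeriv_le {E F : Type*} [NormedAddCommGroup E]
    [NormedSpace ℝ E] [NormedAddCommGroup F] [NormedSpace ℝ F] (χ : 𝓢(E, F)) (k n : ℕ) :
    ∃ B, 0 ≤ B ∧ ∀ j ≤ n, ∀ x, (1 + ‖x‖) ^ k * ‖iteratedFDeriv ℝ j χ x‖ ≤ B :=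
  ⟨_, by positivity, fun _ hj x ↦
    SchwartzMap.one_add_le_sup_seminorm_apply (𝕜 := ℝ) (m := (k, n)) le_rfl hj χ x⟩

theorem tendsto_modulate_zero (χ : 𝓢(PhaseSpace V, ℂ)) :
    Tendsto (fun H ↦ modulate H χ) (𝓝 0) (𝓝 χ) := by
  rw [(schwartz_withSeminorms ℝ (PhaseSpace V) ℂ).tendsto_nhds]
  rintro ⟨k, n⟩ ε hε
  -- The additional power of 1 + |Y| absorbs the factor from |e^{it} − 1| ≤ |t|, the price of
  -- smallness in H.
  obtain ⟨B, hB0, hB⟩ := exists_pow_mul_norm_iteratedFDeriv_le χ (k + 1) n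
  set K : ℝ := 2 ^ n * (4 * Real.pi) ^ (n + 1) * B with hK
  have hK4 : 1 ≤ 4 * Real.pi := by linarith [Real.pi_gt_three]
  have key : ∀ H : PhaseSpace V, ‖H‖ ≤ 1 →
      schwartzSeminormFamily ℝ (PhaseSpace V) ℂ (k, n) (modulate H χ - χ) ≤ K * ‖H‖ := by
    intro H hH
    refine SchwartzMap.seminorm_le_bound ℝ k n _ (by positivity) fun Y ↦ ?_
    have hcoe : ((modulate H χ - χ : 𝓢(PhaseSpace V, ℂ)) : PhaseSpace V → ℂ) =
        fun Y ↦ (sympChar H Y - 1) * χ Y := by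
      funext Y
      simp only [sub_apply, modulate_apply]
      ring
    have hs : ContDiff ℝ (⊤ : ℕ∞) fun Y ↦ sympChar H Y - 1 :=
      (hasTemperateGrowth_sympChar H).1.sub contDiff_const
    have h1 := norm_iteratedFDeriv_mul_le (n := n) hs (χ.smooth ⊤) Y (mod_cast le_top)
    rw [hcoe]
    calc ‖Y‖ ^ k * ‖iteratedFDeriv ℝ n (fun Y ↦ (sympChar H Y - 1) * χ Y) Y‖
        ≤ (1 + ‖Y‖) ^ k * ∑ i ∈ Finset.range (n + 1), (n.choose i : ℝ) *
            ‖iteratedFDeriv ℝ i (fun Y ↦ sympChar H Y - 1) Y‖ *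
              ‖iteratedFDeriv ℝ (n - i) χ Y‖ := by
          gcongr
          linarith
      _ ≤ (1 + ‖Y‖) ^ k * ∑ i ∈ Finset.range (n + 1), (n.choose i : ℝ) *
            ((4 * Real.pi) ^ (n + 1) * ‖H‖ * (1 + ‖Y‖)) *
              ‖iteratedFDeriv ℝ (n - i) χ Y‖ := by
          gcongr with i hi
          refine (norm_iteratedFDeriv_sympChar_sub_one_le H Y hH i).trans ?_
          gcongr ?_ * _ * _
          exact pow_le_pow_right₀ hK4 (by simp at hi; omega)
      _ = ∑ i ∈ Finset.range (n + 1), (n.choose i : ℝ) *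
            ((4 * Real.pi) ^ (n + 1) * ‖H‖) *
              ((1 + ‖Y‖) ^ (k + 1) * ‖iteratedFDeriv ℝ (n - i) χ Y‖) := by
          rw [Finset.mul_sum]
          exact Finset.sum_congr rfl fun i _ ↦ by ring
      _ ≤ ∑ i ∈ Finset.range (n + 1), (n.choose i : ℝ) *
            ((4 * Real.pi) ^ (n + 1) * ‖H‖) * B := by
          gcongr with i hi
          exact hB _ (by omega) Y
      _ = K * ‖H‖ := by
          rw [← Finset.sum_mul, ← Finset.sum_mul, hK]
          have : ∑ i ∈ Finset.range (n + 1), (n.choose i : ℝ) = 2 ^ n := by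
            exact_mod_cast Nat.sum_range_choose n
          rw [this]
          ring
  have hlim : Tendsto (fun H : PhaseSpace V ↦ K * ‖H‖) (𝓝 0) (𝓝 0) := by
    have : Continuous fun H : PhaseSpace V ↦ K * ‖H‖ := by fun_prop
    simpa using this.tendsto 0
  filter_upwards [hlim.eventually (gt_mem_nhds hε), Metric.closedBall_mem_nhds 0 one_pos] with H h1 h2
  exact (key H (by simpa using h2)).trans_lt h1

/-- Modulations form a group, so continuity at the origin carries over to every Ξ. -/
theorem continuous_modulate (χ : 𝓢(PhaseSpace V, ℂ)) : Continuous fun Ξ ↦ modulate Ξ χ := by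
  rw [continuous_iff_continuousAt]
  intro Ξ
  have h1 : Tendsto (fun Ξ' : PhaseSpace V ↦ Ξ' - Ξ) (𝓝 Ξ) (𝓝 0) := by
    have : Continuous fun Ξ' : PhaseSpace V ↦ Ξ' - Ξ := by fun_prop
    simpa using this.tendsto Ξ
  have h2 := ((SchwartzMap.smulLeftCLM ℂ (sympChar Ξ)).continuous.tendsto χ).comp
    ((tendsto_modulate_zero χ).comp h1)
  refine h2.congr fun Ξ' ↦ ?_
  change modulate Ξ (modulate (Ξ' - Ξ) χ) = modulate Ξ' χ
  rw [← modulate_add, add_sub_cancel]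

theorem schwartzConj_schwartzConj (φ : 𝓢(PhaseSpace V, ℂ)) :
    schwartzConj (schwartzConj φ) = φ := by
  ext Y; simp [schwartzConj_apply]

theorem schwartzConj_add (φ ψ : 𝓢(PhaseSpace V, ℂ)) :
    schwartzConj (φ + ψ) = schwartzConj φ + schwartzConj ψ := by
  ext Y; simp [schwartzConj_apply]

theorem schwartzConj_smul (c : ℂ) (φ : 𝓢(PhaseSpace V, ℂ)) :
    schwartzConj (c • φ) = starRingEnd ℂ c • schwartzConj φ := by
  ext Y; simp [schwartzConj_apply]

theorem continuous_schwartzConj :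
    Continuous (schwartzConj : 𝓢(PhaseSpace V, ℂ) → 𝓢(PhaseSpace V, ℂ)) :=
  (SchwartzMap.postcompCLM (Complex.conjCLE : ℂ →L[ℝ] ℂ)).continuous

theorem iteratedFDeriv_schwartzConj_apply (φ : 𝓢(PhaseSpace V, ℂ)) (n : ℕ) (Y : PhaseSpace V)
    (T : Fin n → PhaseSpace V) : iteratedFDeriv ℝ n (schwartzConj φ) Y T =
      starRingEnd ℂ (iteratedFDeriv ℝ n φ Y T) := by
  have hcoe : (schwartzConj φ : PhaseSpace V → ℂ) = (Complex.conjCLE : ℂ →L[ℝ] ℂ) ∘ φ := rfl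
  rw [hcoe, ContinuousLinearMap.iteratedFDeriv_comp_left _ (φ.smooth ⊤).contDiffAt
    (mod_cast le_top)]
  rfl

theorem norm_iteratedFDeriv_schwartzConj (φ : 𝓢(PhaseSpace V, ℂ)) (n : ℕ) (Y : PhaseSpace V) :
    ‖iteratedFDeriv ℝ n (schwartzConj φ) Y‖ = ‖iteratedFDeriv ℝ n φ Y‖ :=
  Complex.conjLIE.toLinearIsometry.norm_iteratedFDeriv_comp_left (φ.smooth ⊤).contDiffAt
    (mod_cast le_top)

variable [FiniteDimensional ℝ V] [MeasurableSpace V] [BorelSpace V]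

theorem RiemMetric.confNorm_schwartzConj (g : RiemMetric V) (X : PhaseSpace V) (r : ℝ) (k : ℕ)
    (φ : 𝓢(PhaseSpace V, ℂ)) : g.confNorm X r k (schwartzConj φ) = g.confNorm X r k φ := by
  simp only [RiemMetric.confNorm, iteratedFDeriv_schwartzConj_apply, RCLike.norm_conj]

/-- Approximation of φ by simple functions reduces joint measurability to a fixed Schwartz function,
where the dependence on Ξ is continuous. Separate continuity in Ξ and in the Schwartz function is
enough. -/
theorem stronglyMeasurable_modulate (f : 𝓢(PhaseSpace V, ℂ) →L[ℂ] ℂ)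
    {φ : PhaseSpace V → 𝓢(PhaseSpace V, ℂ)} (hφ : StronglyMeasurable φ) :
    StronglyMeasurable fun p : PhaseSpace V × PhaseSpace V ↦ f (modulate p.2 (φ p.1)) := by
  refine Measurable.stronglyMeasurable ?_
  refine measurable_of_tendsto_metrizable (f := fun n (p : PhaseSpace V × PhaseSpace V) ↦
    f (modulate p.2 (hφ.approx n p.1))) (fun n ↦ ?_) (tendsto_pi_nhds.2 fun p ↦ ?_)
  · exact ((hφ.approx n).comp Prod.fst measurable_fst).measurable_bind
      (fun χ (p : PhaseSpace V × PhaseSpace V) ↦ f (modulate p.2 χ)) fun χ ↦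
      ((f.continuous.comp (continuous_modulate χ)).measurable).comp measurable_snd
  · exact ((f ∘L SchwartzMap.smulLeftCLM ℂ (sympChar p.2)).continuous.tendsto _).comp
      (hφ.tendsto_approx p.1)

end Modulation

/-- Bounded sets of tempered distributions are equicontinuous. -/
theorem SchwartzMap.exists_seminorm_le_of_isVonNBounded {E : Type*} [NormedAddCommGroup E]
    [NormedSpace ℝ E] {B : Set (𝓢(E, ℂ) →L[ℂ] ℂ)} (hB : Bornology.IsVonNBounded ℂ B) :
    ∃ (n : ℕ) (C : ℝ), 0 ≤ C ∧ ∀ f ∈ B, ∀ χ : 𝓢(E, ℂ),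
      ‖f χ‖ ≤ C * (Finset.Iic (n, n)).sup (schwartzSeminormFamily ℂ E ℂ) χ := by
  by_contra! hcon
  choose f hf χ hχ using fun n : ℕ ↦ hcon n n n.cast_nonneg
  set q : ℕ → Seminorm ℂ 𝓢(E, ℂ) := fun n ↦
    (Finset.Iic (n, n)).sup (schwartzSeminormFamily ℂ E ℂ) with hq
  have hpos : ∀ n, 0 < ‖f n (χ n)‖ := fun n ↦
    (mul_nonneg n.cast_nonneg (apply_nonneg (q n) (χ n))).trans_lt (hχ n)
  -- Direct Banach–Steinhaus argument: rescaling gives |f_n(y_n)| = n although the n-th seminorm of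
  -- y_n is at most 1. The y_n then form a bounded set, on which the bounded set B must be uniformly
  -- bounded.
  set y : ℕ → 𝓢(E, ℂ) := fun n ↦ ((n / ‖f n (χ n)‖ : ℝ) : ℂ) • χ n with hy
  have hfy : ∀ n, ‖f n (y n)‖ = n := by
    intro n
    rw [hy, map_smul, norm_smul, Complex.norm_of_nonneg (by positivity)]
    field_simp [(hpos n).ne']
  have hqy : ∀ n, q n (y n) ≤ 1 := by
    intro n
    rw [hy, map_smul_eq_mul, Complex.norm_of_nonneg (by positivity), div_mul_eq_mul_div,
      div_le_one (hpos n)]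
    exact (hχ n).le
  have hbdd : Bornology.IsVonNBounded ℂ (Set.range y) := by
    rw [(schwartz_withSeminorms ℂ E ℂ).isVonNBounded_iff_seminorm_bounded]
    intro i
    set N := max i.1 i.2
    have hnn : ∀ n, 0 ≤ schwartzSeminormFamily ℂ E ℂ i (y n) := fun n ↦ apply_nonneg _ _
    -- The i-th seminorm is below the n-th one for n ≥ N; the finitely many earlier terms are
    -- covered by the sum.
    refine ⟨2 + ∑ n ∈ Finset.range N, schwartzSeminormFamily ℂ E ℂ i (y n),
      by have := Finset.sum_nonneg fun n (_ : n ∈ Finset.range N) ↦ hnn n; linarith, ?_⟩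
    rintro _ ⟨n, rfl⟩
    rcases lt_or_ge n N with h | h
    · have := Finset.single_le_sum (fun n _ ↦ hnn n) (Finset.mem_range.2 h)
      linarith
    · have h1 : i ∈ Finset.Iic (n, n) := by
        rw [Finset.mem_Iic]
        exact ⟨(le_max_left _ _).trans h, (le_max_right _ _).trans h⟩
      have h2 : schwartzSeminormFamily ℂ E ℂ i (y n) ≤ q n (y n) :=
        Seminorm.le_finset_sup_apply h1
      have := Finset.sum_nonneg fun n (_ : n ∈ Finset.range N) ↦ hnn n
      linarith [hqy n]
  have himg := ContinuousLinearMap.isVonNBounded_image2_apply hB hbdd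
  obtain ⟨R, hR⟩ := (NormedSpace.isVonNBounded_iff' ℂ).1 himg
  obtain ⟨n, hn⟩ := exists_nat_gt R
  have := hR (f n (y n)) ⟨f n, hf n, y n, ⟨n, rfl⟩, rfl⟩
  rw [hfy] at this
  linarith

/-- A set of tempered distributions that are small on a bounded set is a neighbourhood of `0`. -/
theorem SchwartzMap.setOf_norm_le_mem_nhds_zero {E : Type*} [NormedAddCommGroup E]
    [NormedSpace ℝ E] {D : Set 𝓢(E, ℂ)} (hD : Bornology.IsVonNBounded ℂ D) :
    {f : 𝓢(E, ℂ) →L[ℂ] ℂ | ∀ χ ∈ D, ‖f χ‖ ≤ 1} ∈ 𝓝 0 := by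
  refine Filter.mem_of_superset ((ContinuousLinearMap.hasBasis_nhds_zero (𝕜₁ := ℂ)
    (σ := RingHom.id ℂ) (E := 𝓢(E, ℂ)) (F := ℂ)).mem_of_mem
    (i := (D, Metric.closedBall 0 1)) ⟨hD, Metric.closedBall_mem_nhds 0 one_pos⟩) ?_
  intro f hf χ hχ
  simpa using hf χ hχ

theorem pow_neg_mul_le_iff {E : Type*} [NormedAddCommGroup E] {x : E} {s t A : ℝ} :
    (1 + ‖x‖) ^ (-s) * t ≤ A ↔ t ≤ A * (1 + ‖x‖) ^ s := by
  have : 0 < 1 + ‖x‖ := by positivity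
  rw [Real.rpow_neg this.le, inv_mul_le_iff₀ (by positivity), mul_comm A]

/-! ### Neighbourhoods of zero in the inductive limit of weighted spaces. -/

section WeightedEstimates

variable {E : Type*} [NormedAddCommGroup E] [MeasurableSpace E] {μ : Measure E}

theorem wENorm_le_of_ae_bound {s A : ℝ} {f : E → ℂ}
    (h : ∀ᵐ x ∂μ, (1 + ‖x‖) ^ s * ‖f x‖ ≤ A) : wENorm μ s f ≤ ENNReal.ofReal A := by
  rw [wENorm, eLpNorm_exponent_top]
  refine eLpNormEssSup_le_of_ae_bound ?_
  filter_upwards [h] with x hx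
  rwa [norm_mul, Complex.norm_of_nonneg (by positivity)]

theorem ae_le_of_wENorm_lt_top {s : ℝ} {f : E → ℂ} (h : wENorm μ s f < ∞) :
    ∃ A : ℝ, 0 ≤ A ∧ ∀ᵐ x ∂μ, (1 + ‖x‖) ^ s * ‖f x‖ ≤ A := by
  refine ⟨(wENorm μ s f).toReal, ENNReal.toReal_nonneg, ?_⟩
  rw [wENorm, eLpNorm_exponent_top] at h ⊢
  filter_upwards [ae_le_eLpNormEssSup
    (f := fun x ↦ (((1 + ‖x‖) ^ s : ℝ) : ℂ) * f x) (μ := μ)] with x hx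
  have := ENNReal.toReal_mono h.ne hx
  rwa [toReal_enorm, norm_mul, Complex.norm_of_nonneg (by positivity)] at this

variable [BorelSpace E]

theorem WLinf.norm_le_of_ae_bound {s A : ℝ} (hA : 0 ≤ A) {f : WLinf μ s}
    (h : ∀ᵐ x ∂μ, (1 + ‖x‖) ^ s * ‖f.toAEEqFun x‖ ≤ A) : ‖f‖ ≤ A :=
  ENNReal.toReal_le_of_le_ofReal hA (wENorm_le_of_ae_bound h)

namespace IndLinf

theorem ext_ae {F G : IndLinf μ} (h : F.toAEEqFun =ᵐ[μ] G.toAEEqFun) : F = G :=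
  Subtype.ext (AEEqFun.ext h)

theorem coeFn_add (F G : IndLinf μ) :
    (F + G).toAEEqFun =ᵐ[μ] fun x ↦ F.toAEEqFun x + G.toAEEqFun x :=
  AEEqFun.coeFn_add F.toAEEqFun G.toAEEqFun

theorem coeFn_smul (c : ℂ) (F : IndLinf μ) :
    (c • F).toAEEqFun =ᵐ[μ] fun x ↦ c * F.toAEEqFun x :=
  AEEqFun.coeFn_smul c F.toAEEqFun

/-- The class of a measurable function of polynomial growth. -/
def ofBound (f : E → ℂ) (hf : AEStronglyMeasurable f μ)
    (h : ∃ (s : ℕ) (A : ℝ), ∀ᵐ x ∂μ, ‖f x‖ ≤ A * (1 + ‖x‖) ^ s) : IndLinf μ :=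
  ⟨AEEqFun.mk f hf, by
    obtain ⟨s, A, hA⟩ := h
    refine ⟨s, (wENorm_le_of_ae_bound (A := A) ?_).trans_lt ENNReal.ofReal_lt_top⟩
    filter_upwards [hA, AEEqFun.coeFn_mk f hf] with x hx hx'
    rw [hx', pow_neg_mul_le_iff, NNReal.coe_natCast, Real.rpow_natCast]
    exact hx⟩

theorem coeFn_ofBound (f : E → ℂ) (hf : AEStronglyMeasurable f μ)
    (h : ∃ (s : ℕ) (A : ℝ), ∀ᵐ x ∂μ, ‖f x‖ ≤ A * (1 + ‖x‖) ^ s) :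
    (ofBound f hf h).toAEEqFun =ᵐ[μ] f :=
  AEEqFun.coeFn_mk f hf

theorem ae_bound (F : IndLinf μ) :
    ∃ (s : ℕ) (A : ℝ), ∀ᵐ x ∂μ, ‖F.toAEEqFun x‖ ≤ A * (1 + ‖x‖) ^ s := by
  obtain ⟨s, hs⟩ := F.2
  obtain ⟨A, hA0, hA⟩ := ae_le_of_wENorm_lt_top (show wENorm μ (-(s : ℝ)) F.toAEEqFun < ∞ from hs)
  obtain ⟨n, hn⟩ := exists_nat_ge (s : ℝ)
  refine ⟨n, A, ?_⟩
  filter_upwards [hA] with x hx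
  rw [pow_neg_mul_le_iff] at hx
  refine hx.trans ?_
  rw [← Real.rpow_natCast]
  gcongr
  linarith [norm_nonneg x]

/-- Multiplication with the indicator function of a measurable set. -/
def cut (A : Set E) (hA : MeasurableSet A) (F : IndLinf μ) : IndLinf μ :=
  ofBound (A.indicator F.toAEEqFun) (F.toAEEqFun.aestronglyMeasurable.indicator hA) (by
    obtain ⟨s, B, hB⟩ := F.ae_bound
    refine ⟨s, B, ?_⟩
    filter_upwards [hB] with x hx
    exact (norm_indicator_le_norm_self _ _).trans hx)

theorem coeFn_cut (A : Set E) (hA : MeasurableSet A) (F : IndLinf μ) :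
    (cut A hA F).toAEEqFun =ᵐ[μ] A.indicator F.toAEEqFun :=
  coeFn_ofBound _ _ _

theorem cut_add_cut {A B C : Set E} (hA : MeasurableSet A) (hB : MeasurableSet B)
    (hC : MeasurableSet C) (hAB : Disjoint A B) (hC' : C = A ∪ B) (F : IndLinf μ) :
    cut C hC F = cut A hA F + cut B hB F := by
  subst hC'
  refine ext_ae ?_
  filter_upwards [coeFn_cut A hA F, coeFn_cut B hB F, coeFn_cut _ hC F,
    coeFn_add (cut A hA F) (cut B hB F)] with x h1 h2 h3 h4
  rw [h4, h1, h2, h3, Set.indicator_union_of_disjoint hAB]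

theorem cut_univ (F : IndLinf μ) : cut Set.univ .univ F = F := by
  refine ext_ae ?_
  filter_upwards [coeFn_cut Set.univ .univ F] with x h1
  rw [h1, Set.indicator_univ]

/-- The annulus `n ≤ |x| < n + 1`. -/
theorem measurableSet_annulus (n : ℕ) : MeasurableSet {x : E | ⌊‖x‖⌋₊ = n} :=
  (Nat.measurable_floor.comp measurable_norm) (measurableSet_singleton n)

theorem measurableSet_exterior (n : ℕ) : MeasurableSet {x : E | n ≤ ⌊‖x‖⌋₊} :=
  (Nat.measurable_floor.comp measurable_norm) measurableSet_Ici

/-- Only finitely many annuli are split off, which avoids convergence questions in the inductive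
limit; the remainder is handled by the polynomial growth of F itself. -/
theorem eq_sum_cut_add_cut (F : IndLinf μ) (N : ℕ) :
    F = ∑ n ∈ Finset.range N, cut _ (measurableSet_annulus n) F +
      cut _ (measurableSet_exterior N) F := by
  induction N with
  | zero =>
    conv_lhs => rw [← cut_univ F]
    simp
  | succ N ih =>
    conv_lhs => rw [ih]
    rw [Finset.sum_range_succ, add_assoc]
    congr 1
    refine cut_add_cut _ _ _ ?_ ?_ F
    · rw [Set.disjoint_left]
      intro x h1 h2
      simp only [Set.mem_ofPred_eq] at h1 h2
      omega
    · ext x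
      simp only [Set.mem_ofPred_eq, Set.mem_union]
      omega

theorem exists_pos_of_mem_nhds {U : Set (IndLinf μ)} (hU : U ∈ 𝓝 0) (s : ℕ) :
    ∃ ε > 0, ∀ F : IndLinf μ, (∀ᵐ x ∂μ, ‖F.toAEEqFun x‖ ≤ ε * (1 + ‖x‖) ^ s) → F ∈ U := by
  have h0 : incl μ (s : ℝ≥0) 0 = 0 := rfl
  have h1 : incl μ (s : ℝ≥0) ⁻¹' U ∈ 𝓝 0 := (continuous_incl μ s).continuousAt (by rwa [h0])
  obtain ⟨ε, hε, hball⟩ := Metric.mem_nhds_iff.1 h1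
  refine ⟨ε / 2, by positivity, fun F hF ↦ ?_⟩
  have hF' : ∀ᵐ x ∂μ, (1 + ‖x‖) ^ (-((s : ℝ≥0) : ℝ)) * ‖F.toAEEqFun x‖ ≤ ε / 2 := by
    filter_upwards [hF] with x hx
    rwa [pow_neg_mul_le_iff, NNReal.coe_natCast, Real.rpow_natCast]
  set G : WLinf μ (-((s : ℝ≥0) : ℝ)) :=
    ⟨F.toAEEqFun, (wENorm_le_of_ae_bound hF').trans_lt ENNReal.ofReal_lt_top⟩ with hG
  have hGn : ‖G‖ ≤ ε / 2 := WLinf.norm_le_of_ae_bound (by positivity) hF'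
  exact hball (mem_ball_zero_iff.2 (hGn.trans_lt (half_lt_self hε)))

/-- A convex neighbourhood contains a ball of radius about ε_s in each step s. On the n-th annulus
the most generous of the bounds ε_s (n + 1)^s with s ≤ n is allowed, times a weight w_n. If |F| ≤ h,
then F is a convex combination of its rescaled pieces on annuli and of a rescaled exterior piece.
The latter is small in the next step, since F has polynomial growth and the cut is made far out.
Since s ranges over more and more exponents, h dominates every polynomial. -/
theorem exists_majorant_of_mem_nhds {U : Set (IndLinf μ)} (hU : U ∈ 𝓝 0) :
    ∃ h : E → ℝ, (∀ x, 0 < h x) ∧ (∀ s : ℕ, ∃ C, 0 ≤ C ∧ ∀ x, (1 + ‖x‖) ^ s ≤ C * h x) ∧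
      ∀ F : IndLinf μ, (∀ᵐ x ∂μ, ‖F.toAEEqFun x‖ ≤ h x) → F ∈ U := by
  obtain ⟨U', ⟨hU', hconv⟩, hsub⟩ :=
    (LocallyConvexSpace.convex_basis_zero ℝ (IndLinf μ)).mem_iff.1 hU
  choose ε hε hεU using exists_pos_of_mem_nhds hU'
  choose σ hσ hσmax using fun n : ℕ ↦ Finset.exists_max_image (Finset.range (n + 1))
    (fun s ↦ ε s * ((n : ℝ) + 1) ^ s) ⟨0, by simp⟩
  -- Telescoping weights of total mass 1/2, so that at least 1/2 is left for the exterior piece;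
  -- they decay only like n⁻², which two extra powers of n + 1 recover.
  set w : ℕ → ℝ := fun n ↦ 1 / (2 * (n + 1) * (n + 2)) with hw
  have hwpos : ∀ n, 0 < w n := fun n ↦ by simp only [hw]; positivity
  have hwsum : ∀ N : ℕ, ∑ n ∈ Finset.range N, w n = 1 / 2 - 1 / (2 * (N + 1)) := by
    intro N
    induction N with
    | zero => simp
    | succ N ih =>
      rw [Finset.sum_range_succ, ih, hw]
      push_cast
      field_simp
      ring
  set H : ℕ → ℝ := fun n ↦ w n * (ε (σ n) * ((n : ℝ) + 1) ^ σ n) with hH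
  have hHpos : ∀ n, 0 < H n := fun n ↦
    mul_pos (hwpos n) (mul_pos (hε _) (by positivity))
  refine ⟨fun x ↦ H ⌊‖x‖⌋₊, fun x ↦ hHpos _, fun s ↦ ?_, fun F hF ↦ hsub ?_⟩
  · have hfloor : ∀ x : E, (1 + ‖x‖) ^ s ≤ (⌊‖x‖⌋₊ + 2 : ℝ) ^ s := fun x ↦
      pow_le_pow_left₀ (by positivity) (by linarith [Nat.lt_floor_add_one ‖x‖]) s
    set C₁ : ℝ := ∑ n ∈ Finset.range (s + 2), (n + 2 : ℝ) ^ s / H n with hC₁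
    set C₂ : ℝ := 2 ^ s * 4 / ε (s + 2) with hC₂
    have hterm : ∀ n : ℕ, 0 ≤ (n + 2 : ℝ) ^ s / H n := fun n ↦ by
      have := hHpos n
      positivity
    have hC₁0 : 0 ≤ C₁ := Finset.sum_nonneg fun n _ ↦ hterm n
    have hC₂0 : 0 ≤ C₂ := by
      have := hε (s + 2)
      positivity
    refine ⟨C₁ + C₂, by positivity, fun x ↦ (hfloor x).trans ?_⟩
    change _ ≤ (C₁ + C₂) * H ⌊‖x‖⌋₊
    generalize ⌊‖x‖⌋₊ = n
    have hHn := hHpos n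
    -- From n = s + 2 on, the exponent s + 2 competes in the maximum defining σ(n); the finitely
    -- many smaller n are covered by C₁.
    rcases lt_or_ge n (s + 2) with hn | hn
    · have h1 := Finset.single_le_sum (fun n _ ↦ hterm n) (Finset.mem_range.2 hn)
      calc (n + 2 : ℝ) ^ s = ((n + 2 : ℝ) ^ s / H n) * H n := by field_simp
        _ ≤ (C₁ + C₂) * H n := by
            gcongr
            linarith
    · have h1 := hσmax n (s + 2) (Finset.mem_range.2 (by omega))
      have hes := hε (s + 2)
      have h2 : ε (s + 2) * (n + 1 : ℝ) ^ s / 4 ≤ H n := by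
        calc ε (s + 2) * (n + 1 : ℝ) ^ s / 4
            = 1 / (4 * (n + 1) * (n + 1)) * (ε (s + 2) * (n + 1 : ℝ) ^ (s + 2)) := by
              rw [pow_add]
              field_simp
          _ ≤ w n * (ε (s + 2) * (n + 1 : ℝ) ^ (s + 2)) := by
              gcongr
              refine one_div_le_one_div_of_le (by positivity) ?_
              have : (0 : ℝ) ≤ n := n.cast_nonneg
              nlinarith
          _ ≤ H n := mul_le_mul_of_nonneg_left h1 (hwpos n).le
      calc (n + 2 : ℝ) ^ s ≤ (2 * (n + 1)) ^ s := by
            gcongr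
            linarith [(n.cast_nonneg : (0 : ℝ) ≤ n)]
        _ = C₂ * (ε (s + 2) * (n + 1 : ℝ) ^ s / 4) := by
            rw [hC₂, mul_pow]
            field_simp
        _ ≤ (C₁ + C₂) * H n := by
            gcongr
            linarith
  · obtain ⟨s, A, hA⟩ := F.ae_bound
    -- Beyond this radius, 2|A|(1 + |x|)^s ≤ ε_{s+1}(1 + |x|)^{s+1}; the 2 bounds the inverse of the
    -- exterior weight v.
    obtain ⟨N, hN⟩ := exists_nat_ge (2 * |A| / ε (s + 1))
    set v : ℝ := 1 / 2 + 1 / (2 * (N + 1)) with hv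
    have hvpos : 1 / 2 < v := by
      rw [hv]
      have : (0 : ℝ) < 1 / (2 * (N + 1)) := by positivity
      linarith
    set z : ℕ → IndLinf μ := fun n ↦ if n < N
      then (((w n)⁻¹ : ℝ) : ℂ) • cut _ (measurableSet_annulus n) F
      else ((v⁻¹ : ℝ) : ℂ) • cut _ (measurableSet_exterior N) F with hz
    set u : ℕ → ℝ := fun n ↦ if n < N then w n else v with hu
    have hsum : F = ∑ n ∈ Finset.range (N + 1), u n • z n := by
      conv_lhs => rw [F.eq_sum_cut_add_cut N]
      rw [Finset.sum_range_succ]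
      congr 1
      · refine Finset.sum_congr rfl fun n hn ↦ ?_
        rw [hu, hz]
        simp only [Finset.mem_range.1 hn, if_true]
        rw [← Complex.coe_smul, smul_smul, ← Complex.ofReal_mul, mul_inv_cancel₀ (hwpos n).ne',
          Complex.ofReal_one, one_smul]
      · rw [hu, hz]
        simp only [lt_irrefl, if_false]
        rw [← Complex.coe_smul, smul_smul, ← Complex.ofReal_mul,
          mul_inv_cancel₀ (by linarith), Complex.ofReal_one, one_smul]
    rw [hsum]
    refine hconv.sum_mem (fun n _ ↦ ?_) ?_ fun n _ ↦ ?_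
    · rw [hu]
      dsimp only
      split_ifs
      · exact (hwpos n).le
      · linarith
    · rw [Finset.sum_range_succ, hu]
      have : ∑ n ∈ Finset.range N, (if n < N then w n else v) = ∑ n ∈ Finset.range N, w n :=
        Finset.sum_congr rfl fun n hn ↦ if_pos (Finset.mem_range.1 hn)
      rw [this, hwsum]
      simp [hv]
      ring
    · rw [hz]
      dsimp only
      split_ifs with hn
      · refine hεU (σ n) _ ?_
        filter_upwards [coeFn_smul (((w n)⁻¹ : ℝ) : ℂ) (cut _ (measurableSet_annulus n) F),
          coeFn_cut _ (measurableSet_annulus n) F, hF] with x h1 h2 h3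
        have hwn := hwpos n
        have heσ := hε (σ n)
        rw [h1, h2]
        by_cases hx : ⌊‖x‖⌋₊ = n
        · rw [Set.indicator_of_mem (by exact hx), norm_mul,
            Complex.norm_of_nonneg (by positivity), inv_mul_le_iff₀ hwn]
          refine h3.trans ?_
          rw [hx, hH]
          dsimp only
          refine mul_le_mul_of_nonneg_left (mul_le_mul_of_nonneg_left
            (pow_le_pow_left₀ (by positivity) ?_ _) heσ.le) hwn.le
          rw [add_comm, ← hx]
          linarith [Nat.floor_le (norm_nonneg x)]
        · rw [Set.indicator_of_notMem (by exact hx), mul_zero, norm_zero]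
          positivity
      · refine hεU (s + 1) _ ?_
        filter_upwards [coeFn_smul ((v⁻¹ : ℝ) : ℂ) (cut _ (measurableSet_exterior N) F),
          coeFn_cut _ (measurableSet_exterior N) F, hA] with x h1 h2 h3
        have hes := hε (s + 1)
        rw [h1, h2]
        by_cases hx : N ≤ ⌊‖x‖⌋₊
        · have hNx : (N : ℝ) ≤ ‖x‖ := (Nat.le_floor_iff (norm_nonneg _)).1 hx
          rw [Set.indicator_of_mem (by exact hx), norm_mul,
            Complex.norm_of_nonneg (by positivity)]
          rw [div_le_iff₀ hes] at hN
          have hv2 : v⁻¹ ≤ 2 := by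
            rw [inv_le_comm₀ (by linarith) two_pos]
            linarith
          calc v⁻¹ * ‖F.toAEEqFun x‖ ≤ 2 * (|A| * (1 + ‖x‖) ^ s) := by
                gcongr
                exact h3.trans (by gcongr; exact le_abs_self A)
            _ = (2 * |A|) * (1 + ‖x‖) ^ s := by ring
            _ ≤ ((1 + ‖x‖) * ε (s + 1)) * (1 + ‖x‖) ^ s := by
                refine mul_le_mul_of_nonneg_right (hN.trans ?_) (by positivity)
                gcongr
                linarith
            _ = _ := by ring
        · rw [Set.indicator_of_notMem (by exact hx), mul_zero, norm_zero]
          positivity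

end IndLinf

end WeightedEstimates

section

variable {E : Type*} [NormedAddCommGroup E] [MeasurableSpace E] {μ : Measure E} [BorelSpace E]

/-- The class of a measurable function with a pointwise bound. -/
def WLinf.ofBound {s : ℝ} (f : E → ℂ) (hf : AEStronglyMeasurable f μ)
    (h : ∃ A : ℝ, ∀ᵐ x ∂μ, (1 + ‖x‖) ^ s * ‖f x‖ ≤ A) : WLinf μ s :=
  ⟨AEEqFun.mk f hf, by
    obtain ⟨A, hA⟩ := h
    refine (wENorm_le_of_ae_bound (A := A) ?_).trans_lt ENNReal.ofReal_lt_top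
    filter_upwards [hA, AEEqFun.coeFn_mk f hf] with x hx hx'
    rwa [hx']⟩

theorem WLinf.coeFn_ofBound {s : ℝ} (f : E → ℂ) (hf : AEStronglyMeasurable f μ)
    (h : ∃ A : ℝ, ∀ᵐ x ∂μ, (1 + ‖x‖) ^ s * ‖f x‖ ≤ A) :
    (WLinf.ofBound f hf h).toAEEqFun =ᵐ[μ] f :=
  AEEqFun.coeFn_mk f hf

theorem WLinf.ext_ae {s : ℝ} {F G : WLinf μ s} (h : F.toAEEqFun =ᵐ[μ] G.toAEEqFun) : F = G :=
  Subtype.ext (AEEqFun.ext h)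

theorem WLinf.coeFn_add {s : ℝ} (F G : WLinf μ s) :
    (F + G).toAEEqFun =ᵐ[μ] fun x ↦ F.toAEEqFun x + G.toAEEqFun x :=
  AEEqFun.coeFn_add F.toAEEqFun G.toAEEqFun

theorem WLinf.coeFn_smul {s : ℝ} (c : ℂ) (F : WLinf μ s) :
    (c • F).toAEEqFun =ᵐ[μ] fun x ↦ c * F.toAEEqFun x :=
  AEEqFun.coeFn_smul c F.toAEEqFun

end

/-! ### Part (i): transforms of tempered distributions. -/

section

variable {V : Type*} [NormedAddCommGroup V] [NormedSpace ℝ V]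

theorem gstft_add_right (f : 𝓢(PhaseSpace V, ℂ) →L[ℂ] ℂ)
    (φ ψ : PhaseSpace V → 𝓢(PhaseSpace V, ℂ)) (p : PhaseSpace V × PhaseSpace V) :
    gstft f (fun X ↦ φ X + ψ X) p = gstft f φ p + gstft f ψ p := by
  simp only [gstft, modulate, schwartzConj_add, map_add]

theorem gstft_smul_right (f : 𝓢(PhaseSpace V, ℂ) →L[ℂ] ℂ) (c : ℂ)
    (φ : PhaseSpace V → 𝓢(PhaseSpace V, ℂ)) (p : PhaseSpace V × PhaseSpace V) :
    gstft f (fun X ↦ c • φ X) p = starRingEnd ℂ c * gstft f φ p := by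
  simp only [gstft, modulate, schwartzConj_smul, map_smul, smul_eq_mul]

end

variable {V : Type*} [NormedAddCommGroup V] [NormedSpace ℝ V]
  [FiniteDimensional ℝ V] [MeasurableSpace V] [BorelSpace V] {g : RiemMetric V}

namespace RiemMetric

/-- Polynomial growth in X comes from confinement and polynomial growth in Ξ from the modulation;
both are collected in one power of the norm of (X, Ξ). -/
theorem IsHormander.seminorm_modulate_le {C₀ r₀ N₀ : ℝ} (hg : g.IsHormander C₀ r₀ N₀) (r : ℝ)
    (n : ℕ) : ∃ (k : ℕ) (C : ℝ) (M : ℕ), 0 ≤ C ∧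
      ∀ (X : PhaseSpace V) (χ : 𝓢(PhaseSpace V, ℂ)) (A : ℝ), 0 ≤ A →
        g.confNorm X r k χ ≤ ENNReal.ofReal A → ∀ Ξ,
          (Finset.Iic (n, n)).sup (schwartzSeminormFamily ℂ (PhaseSpace V) ℂ) (modulate Ξ χ) ≤
            C * A * (1 + ‖(X, Ξ)‖) ^ M := by
  obtain ⟨k, C, M, hC, h⟩ := hg.norm_iteratedFDeriv_le_center r n
  have hK : 1 ≤ 4 * Real.pi := by linarith [Real.pi_gt_three]
  refine ⟨k, C * (4 * Real.pi) ^ n, M + n, by positivity, fun X χ A hA hχ Ξ ↦ ?_⟩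
  have hX : ‖X‖ ≤ ‖(X, Ξ)‖ := norm_fst_le (X, Ξ)
  have hΞ : ‖Ξ‖ ≤ ‖(X, Ξ)‖ := norm_snd_le (X, Ξ)
  set t := ‖(X, Ξ)‖
  refine Seminorm.finset_sup_apply_le (by positivity) fun i hi ↦ ?_
  obtain ⟨a, l⟩ := i
  rw [Finset.mem_Iic] at hi
  have ha : a ≤ n := hi.1
  have hl : l ≤ n := hi.2
  refine SchwartzMap.seminorm_le_bound ℂ a l _ (by positivity) fun Y ↦ ?_
  calc ‖Y‖ ^ a * ‖iteratedFDeriv ℝ l (modulate Ξ χ) Y‖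
      ≤ (1 + ‖Y‖) ^ n * ‖iteratedFDeriv ℝ l (modulate Ξ χ) Y‖ := by
        gcongr
        calc ‖Y‖ ^ a ≤ (1 + ‖Y‖) ^ a := by gcongr; linarith
          _ ≤ (1 + ‖Y‖) ^ n := pow_le_pow_right₀ (by linarith [norm_nonneg Y]) ha
    _ ≤ C * A * (1 + ‖X‖) ^ M * (1 + 4 * Real.pi * ‖Ξ‖) ^ l :=
        norm_iteratedFDeriv_modulate_le Ξ Y χ l (by positivity)
          fun j hj ↦ h X χ A hA hχ j (hj.trans hl) Y
    _ ≤ C * A * (1 + t) ^ M * (4 * Real.pi * (1 + t)) ^ n := by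
        have h1 : 1 + 4 * Real.pi * ‖Ξ‖ ≤ 4 * Real.pi * (1 + t) := by nlinarith
        have h2 : 1 ≤ 1 + 4 * Real.pi * ‖Ξ‖ := by
          have : 0 ≤ 4 * Real.pi * ‖Ξ‖ := by positivity
          linarith
        have h3 : (1 + 4 * Real.pi * ‖Ξ‖) ^ l ≤ (4 * Real.pi * (1 + t)) ^ n :=
          (pow_le_pow_right₀ h2 hl).trans (pow_le_pow_left₀ (by linarith) h1 n)
        gcongr
    _ = C * (4 * Real.pi) ^ n * A * (1 + t) ^ (M + n) := by
        rw [mul_pow, pow_add]; ring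

theorem IsHormander.norm_apply_modulate_le {C₀ r₀ N₀ : ℝ} (hg : g.IsHormander C₀ r₀ N₀) (r : ℝ)
    {B : Set (𝓢(PhaseSpace V, ℂ) →L[ℂ] ℂ)} (hB : Bornology.IsVonNBounded ℂ B) :
    ∃ (k : ℕ) (C : ℝ) (M : ℕ), 0 ≤ C ∧ ∀ f ∈ B,
      ∀ (X : PhaseSpace V) (χ : 𝓢(PhaseSpace V, ℂ)) (A : ℝ), 0 ≤ A →
        g.confNorm X r k χ ≤ ENNReal.ofReal A → ∀ Ξ,
          ‖f (modulate Ξ χ)‖ ≤ C * A * (1 + ‖(X, Ξ)‖) ^ M := by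
  obtain ⟨n, C₁, hC₁, h₁⟩ := SchwartzMap.exists_seminorm_le_of_isVonNBounded hB
  obtain ⟨k, C, M, hC, h⟩ := hg.seminorm_modulate_le r n
  refine ⟨k, C₁ * C, M, by positivity, fun f hf X χ A hA hχ Ξ ↦ (h₁ f hf _).trans ?_⟩
  rw [mul_assoc C₁ C, mul_assoc C₁]
  gcongr
  exact h X χ A hA hχ Ξ

namespace Conf

variable {r : ℝ}

theorem ae_confNorm_le (Φ : g.Conf r) (k : ℕ) :
    ∀ᵐ X ∂sympMeasure V, g.confNorm X r k (Φ.toAEEqFun X) ≤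
      ENNReal.ofReal (confSeminorm g r k Φ) := by
  have h : ENNReal.ofReal (confSeminorm g r k Φ) = g.confESeminorm r k Φ.toAEEqFun :=
    ENNReal.ofReal_toReal (Φ.2 k).ne
  rw [h]
  exact ENNReal.ae_le_essSup _

theorem ae_fst {p : PhaseSpace V → Prop} (h : ∀ᵐ X ∂sympMeasure V, p X) :
    ∀ᵐ q ∂sympMeasure₂ V, p q.1 :=
  Measure.quasiMeasurePreserving_fst.ae h

theorem coeFn_add (Φ Ψ : g.Conf r) :
    (Φ + Ψ).toAEEqFun =ᵐ[sympMeasure V] fun X ↦ Φ.toAEEqFun X + Ψ.toAEEqFun X :=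
  AEEqFun.coeFn_add Φ.toAEEqFun Ψ.toAEEqFun

theorem coeFn_smul (c : ℂ) (Φ : g.Conf r) :
    (c • Φ).toAEEqFun =ᵐ[sympMeasure V] fun X ↦ c • Φ.toAEEqFun X :=
  AEEqFun.coeFn_smul c Φ.toAEEqFun

theorem aestronglyMeasurable_gstft (f : 𝓢(PhaseSpace V, ℂ) →L[ℂ] ℂ) (Φ : g.Conf r) :
    AEStronglyMeasurable (gstft f Φ.toAEEqFun) (sympMeasure₂ V) :=
  (stronglyMeasurable_modulate f (continuous_schwartzConj.comp_stronglyMeasurable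
    Φ.toAEEqFun.stronglyMeasurable)).aestronglyMeasurable

theorem aestronglyMeasurable_gstft_conj (f : 𝓢(PhaseSpace V, ℂ) →L[ℂ] ℂ) (Φ : g.Conf r) :
    AEStronglyMeasurable (gstft f fun X ↦ schwartzConj (Φ.toAEEqFun X)) (sympMeasure₂ V) := by
  have h : (gstft f fun X ↦ schwartzConj (Φ.toAEEqFun X)) =
      fun p ↦ f (modulate p.2 (Φ.toAEEqFun p.1)) := by
    funext p
    simp only [gstft, schwartzConj_schwartzConj]
  rw [h]
  exact (stronglyMeasurable_modulate f Φ.toAEEqFun.stronglyMeasurable).aestronglyMeasurable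

theorem gstft_congr (f : 𝓢(PhaseSpace V, ℂ) →L[ℂ] ℂ) {φ ψ : PhaseSpace V → 𝓢(PhaseSpace V, ℂ)}
    (h : φ =ᵐ[sympMeasure V] ψ) : gstft f φ =ᵐ[sympMeasure₂ V] gstft f ψ := by
  filter_upwards [ae_fst h] with p hp
  simp only [gstft, hp]

/-- The pointwise estimates for the geometric short-time Fourier transform, uniformly for
bounded sets of distributions. -/
theorem ae_norm_gstft_le {C₀ r₀ N₀ : ℝ} (hg : g.IsHormander C₀ r₀ N₀)
    {B : Set (𝓢(PhaseSpace V, ℂ) →L[ℂ] ℂ)} (hB : Bornology.IsVonNBounded ℂ B) :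
    ∃ (k : ℕ) (C : ℝ) (M : ℕ), 0 ≤ C ∧ ∀ f ∈ B, ∀ Φ : g.Conf r, ∀ᵐ p ∂sympMeasure₂ V,
      ‖gstft f Φ.toAEEqFun p‖ ≤ C * confSeminorm g r k Φ * (1 + ‖p‖) ^ M ∧
      ‖gstft f (fun X ↦ schwartzConj (Φ.toAEEqFun X)) p‖ ≤
        C * confSeminorm g r k Φ * (1 + ‖p‖) ^ M := by
  obtain ⟨k, C, M, hC, h⟩ := hg.norm_apply_modulate_le r hB
  refine ⟨k, C, M, hC, fun f hf Φ ↦ ?_⟩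
  filter_upwards [ae_fst (Φ.ae_confNorm_le k)] with p hp
  refine ⟨h f hf p.1 _ _ (apply_nonneg _ _) ?_ p.2, h f hf p.1 _ _ (apply_nonneg _ _) ?_ p.2⟩
  · rwa [g.confNorm_schwartzConj]
  · rwa [schwartzConj_schwartzConj]

variable {C₀ r₀ N₀ : ℝ}

theorem exists_ae_norm_gstft_le (hg : g.IsHormander C₀ r₀ N₀) (f : 𝓢(PhaseSpace V, ℂ) →L[ℂ] ℂ)
    (Φ : g.Conf r) : ∃ (s : ℕ) (A : ℝ), ∀ᵐ p ∂sympMeasure₂ V,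
      ‖gstft f Φ.toAEEqFun p‖ ≤ A * (1 + ‖p‖) ^ s := by
  obtain ⟨k, C, M, hC, h⟩ := ae_norm_gstft_le (r := r) hg
    (Bornology.isVonNBounded_singleton (𝕜 := ℂ) f)
  exact ⟨M, _, (h f rfl Φ).mono fun p hp ↦ hp.1⟩

/-- The geometric short-time Fourier transform of tempered distributions. -/
def stft (hg : g.IsHormander C₀ r₀ N₀) (r : ℝ) : (𝓢(PhaseSpace V, ℂ) →L[ℂ] ℂ) →ₗ[ℂ]
    (g.Conf r →ₛₗ[starRingEnd ℂ] IndLinf (sympMeasure₂ V)) :=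
  LinearMap.mk₂'ₛₗ (RingHom.id ℂ) (starRingEnd ℂ)
    (fun f Φ ↦ IndLinf.ofBound (gstft f Φ.toAEEqFun) (aestronglyMeasurable_gstft f Φ) (exists_ae_norm_gstft_le hg f Φ))
    (fun f f' Φ ↦ by
      refine IndLinf.ext_ae ?_
      refine (IndLinf.coeFn_ofBound _ _ _).trans (.trans ?_ (IndLinf.coeFn_add _ _).symm)
      filter_upwards [IndLinf.coeFn_ofBound (gstft f Φ.toAEEqFun) (aestronglyMeasurable_gstft f Φ) _,
        IndLinf.coeFn_ofBound (gstft f' Φ.toAEEqFun) (aestronglyMeasurable_gstft f' Φ) _]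
        with p h1 h2
      rw [h1, h2]
      rfl)
    (fun c f Φ ↦ by
      refine IndLinf.ext_ae ?_
      refine (IndLinf.coeFn_ofBound _ _ _).trans (.trans ?_ (IndLinf.coeFn_smul _ _).symm)
      filter_upwards [IndLinf.coeFn_ofBound (gstft f Φ.toAEEqFun)
        (aestronglyMeasurable_gstft f Φ) _] with p h1
      rw [h1]
      rfl)
    (fun f Φ Ψ ↦ by
      refine IndLinf.ext_ae ?_
      refine (IndLinf.coeFn_ofBound _ _ _).trans (.trans ?_ (IndLinf.coeFn_add _ _).symm)
      filter_upwards [IndLinf.coeFn_ofBound (gstft f Φ.toAEEqFun) (aestronglyMeasurable_gstft f Φ) _,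
        IndLinf.coeFn_ofBound (gstft f Ψ.toAEEqFun) (aestronglyMeasurable_gstft f Ψ) _,
        gstft_congr f (coeFn_add Φ Ψ)] with p h1 h2 h3
      rw [h1, h2, h3, gstft_add_right])
    (fun c f Φ ↦ by
      refine IndLinf.ext_ae ?_
      refine (IndLinf.coeFn_ofBound _ _ _).trans (.trans ?_ (IndLinf.coeFn_smul _ _).symm)
      filter_upwards [IndLinf.coeFn_ofBound (gstft f Φ.toAEEqFun)
        (aestronglyMeasurable_gstft f Φ) _, gstft_congr f (coeFn_smul c Φ)] with p h1 h2
      rw [h1, h2, gstft_smul_right])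

theorem coeFn_stft (hg : g.IsHormander C₀ r₀ N₀) (f : 𝓢(PhaseSpace V, ℂ) →L[ℂ] ℂ)
    (Φ : g.Conf r) : (stft hg r f Φ).toAEEqFun =ᵐ[sympMeasure₂ V] gstft f Φ.toAEEqFun :=
  IndLinf.coeFn_ofBound _ _ (exists_ae_norm_gstft_le hg f Φ)

theorem tendsto_confSeminorm (k : ℕ) (Φ : g.Conf r) :
    Tendsto (fun Ψ ↦ confSeminorm g r k (Φ - Ψ)) (𝓝 Φ) (𝓝 0) := by
  have := (withSeminorms g r).topologicalAddGroup
  have h1 : Continuous (confSeminorm g r k) := (withSeminorms g r).continuous_seminorm k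
  have h2 : Continuous fun Ψ : g.Conf r ↦ confSeminorm g r k (Φ - Ψ) :=
    h1.comp (continuous_const.sub continuous_id)
  simpa using h2.tendsto Φ

/-- Each Schwartz seminorm grows at most polynomially in (X, Ξ), and division by h removes all such
growth at once. -/
theorem isVonNBounded_modulate (hg : g.IsHormander C₀ r₀ N₀) (r : ℝ) {R : ℕ → ℝ}
    (hR : ∀ k, 0 ≤ R k) {h : PhaseSpace V × PhaseSpace V → ℝ} (hpos : ∀ p, 0 < h p)
    (hh : ∀ s : ℕ, ∃ C, 0 ≤ C ∧ ∀ p, (1 + ‖p‖) ^ s ≤ C * h p) :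
    Bornology.IsVonNBounded ℂ {η : 𝓢(PhaseSpace V, ℂ) | ∃ (p : PhaseSpace V × PhaseSpace V)
      (χ : 𝓢(PhaseSpace V, ℂ)), (∀ k, g.confNorm p.1 r k χ ≤ ENNReal.ofReal (R k)) ∧
        η = (((h p)⁻¹ : ℝ) : ℂ) • modulate p.2 (schwartzConj χ)} := by
  rw [(schwartz_withSeminorms ℂ (PhaseSpace V) ℂ).isVonNBounded_iff_seminorm_bounded]
  intro i
  obtain ⟨k, C, M, hC, hCM⟩ := hg.seminorm_modulate_le r (max i.1 i.2)
  obtain ⟨C', hC', hM⟩ := hh M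
  have hRk := hR k
  -- The 1 is added because the criterion for boundedness asks for a positive bound and a strict
  -- inequality.
  refine ⟨C * R k * C' + 1, by positivity, ?_⟩
  rintro _ ⟨p, χ, hχ, rfl⟩
  have hi : i ∈ Finset.Iic (max i.1 i.2, max i.1 i.2) :=
    Finset.mem_Iic.2 ⟨le_max_left _ _, le_max_right _ _⟩
  have h1 : schwartzSeminormFamily ℂ (PhaseSpace V) ℂ i (modulate p.2 (schwartzConj χ)) ≤
      C * R k * (1 + ‖p‖) ^ M :=
    (Seminorm.le_finset_sup_apply hi).trans (hCM p.1 _ _ (hR k)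
      (by rw [g.confNorm_schwartzConj]; exact hχ k) p.2)
  have hp := hpos p
  rw [map_smul_eq_mul, Complex.norm_of_nonneg (by positivity), inv_mul_lt_iff₀ hp]
  calc _ ≤ C * R k * (1 + ‖p‖) ^ M := h1
    _ ≤ C * R k * (C' * h p) := by
        gcongr
        exact hM p
    _ < h p * (C * R k * C' + 1) := by nlinarith

theorem isHypocontinuous_stft (hg : g.IsHormander C₀ r₀ N₀) (r : ℝ) :
    IsHypocontinuous (fun f (Φ : g.Conf r) ↦ stft hg r f Φ) := by
  refine ⟨fun B hB U hU ↦ ?_, fun B hB U hU ↦ ?_⟩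
  · obtain ⟨k, C, M, hC, h⟩ := ae_norm_gstft_le (r := r) hg hB
    obtain ⟨ε, hε, hεU⟩ := IndLinf.exists_pos_of_mem_nhds hU M
    have hlim : Tendsto (fun Φ : g.Conf r ↦ C * confSeminorm g r k Φ) (𝓝 0) (𝓝 0) := by
      simpa using (tendsto_confSeminorm k (0 : g.Conf r)).const_mul C
    refine ⟨_, hlim.eventually (gt_mem_nhds hε), fun f hf Φ hΦ ↦ hεU _ ?_⟩
    filter_upwards [h f hf Φ, coeFn_stft hg f Φ] with p h1 h2
    rw [h2]
    exact h1.1.trans (by gcongr; exact le_of_lt hΦ)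
  -- No single step works for a neighbourhood of distributions, since their orders are unbounded.
  -- With the majorant h, being in U reduces to |f| ≤ 1 on one bounded set of modulated functions.
  · obtain ⟨h, hpos, hh, hU'⟩ := IndLinf.exists_majorant_of_mem_nhds hU
    rw [(withSeminorms g r).isVonNBounded_iff_seminorm_bounded] at hB
    choose R hR hBR using hB
    refine ⟨_, SchwartzMap.setOf_norm_le_mem_nhds_zero
      (isVonNBounded_modulate hg r (fun k ↦ (hR k).le) hpos hh), fun f hf Φ hΦ ↦ hU' _ ?_⟩
    filter_upwards [coeFn_stft hg f Φ, ae_all_iff.2 fun k ↦ ae_fst (Φ.ae_confNorm_le k)]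
      with p h1 h2
    have h3 := hf _ ⟨p, Φ.toAEEqFun p.1, fun k ↦ (h2 k).trans
      (ENNReal.ofReal_le_ofReal (hBR k Φ hΦ).le), rfl⟩
    have hp := hpos p
    rw [map_smul, norm_smul, Complex.norm_of_nonneg (by positivity), inv_mul_le_iff₀ hp,
      mul_one] at h3
    rw [h1]
    exact h3

theorem equicontinuous_of_norm_le {ι G : Type*} [NormedAddCommGroup G] [NormedSpace ℂ G]
    {L : ι → g.Conf r →ₗ[ℂ] G} {C : ℝ} {k : ℕ}
    (h : ∀ i Φ, ‖L i Φ‖ ≤ C * confSeminorm g r k Φ) : Equicontinuous fun i Φ ↦ L i Φ := by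
  intro Φ
  rw [Metric.equicontinuousAt_iff_right]
  intro ε hε
  have hlim : Tendsto (fun Ψ : g.Conf r ↦ C * confSeminorm g r k (Φ - Ψ)) (𝓝 Φ) (𝓝 0) := by
    simpa using (tendsto_confSeminorm k Φ).const_mul C
  filter_upwards [hlim.eventually (gt_mem_nhds hε)] with Ψ hΨ i
  rw [dist_eq_norm, ← map_sub]
  exact (h i _).trans_lt hΨ

theorem exists_equicontinuous_stft (hg : g.IsHormander C₀ r₀ N₀) (r : ℝ)
    {B : Set (𝓢(PhaseSpace V, ℂ) →L[ℂ] ℂ)} (hB : Bornology.IsVonNBounded ℂ B) :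
    ∃ s : ℝ, 0 < s ∧
      (∀ f ∈ B, ∀ Φ : g.Conf r,
        (stft hg r f Φ).toAEEqFun ∈ wLinfSubmodule (sympMeasure₂ V) (-s)) ∧
      ∃ A : B → (g.Conf r →L[ℂ] WLinf (sympMeasure₂ V) (-s)),
        (∀ (f : B) (Φ : g.Conf r) (φ : PhaseSpace V → 𝓢(PhaseSpace V, ℂ)),
          φ =ᵐ[sympMeasure V] Φ.toAEEqFun →
          (A f Φ).toAEEqFun =ᵐ[sympMeasure₂ V]
            gstft (f : 𝓢(PhaseSpace V, ℂ) →L[ℂ] ℂ) (fun X ↦ schwartzConj (φ X))) ∧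
        Equicontinuous (fun (f : B) (Φ : g.Conf r) ↦ A f Φ) := by
  obtain ⟨k, C, M, hC, h⟩ := ae_norm_gstft_le (r := r) hg hB
  have hM : ∀ (f : 𝓢(PhaseSpace V, ℂ) →L[ℂ] ℂ), f ∈ B → ∀ Φ : g.Conf r, ∀ᵐ p ∂sympMeasure₂ V,
      (1 + ‖p‖) ^ (-((M : ℝ) + 1)) * ‖gstft f Φ.toAEEqFun p‖ ≤ C * confSeminorm g r k Φ ∧
      (1 + ‖p‖) ^ (-((M : ℝ) + 1)) * ‖gstft f (fun X ↦ schwartzConj (Φ.toAEEqFun X)) p‖ ≤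
        C * confSeminorm g r k Φ := by
    intro f hf Φ
    filter_upwards [h f hf Φ] with p hp
    have h1 : C * confSeminorm g r k Φ * (1 + ‖p‖) ^ M ≤
        C * confSeminorm g r k Φ * (1 + ‖p‖) ^ ((M : ℝ) + 1) := by
      rw [← Real.rpow_natCast]
      have : 0 ≤ C * confSeminorm g r k Φ := mul_nonneg hC (apply_nonneg _ _)
      gcongr
      · linarith [norm_nonneg p]
      · linarith
    rw [pow_neg_mul_le_iff, pow_neg_mul_le_iff]
    exact ⟨hp.1.trans h1, hp.2.trans h1⟩
  -- M may vanish, whereas s has to be positive.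
  refine ⟨M + 1, by positivity, fun f hf Φ ↦ ?_, ?_⟩
  · refine (wENorm_le_of_ae_bound (A := C * confSeminorm g r k Φ) ?_).trans_lt
      ENNReal.ofReal_lt_top
    filter_upwards [hM f hf Φ, coeFn_stft hg f Φ] with p h1 h2
    rw [h2]
    exact h1.1
  set W : B → g.Conf r → WLinf (sympMeasure₂ V) (-((M : ℝ) + 1)) := fun f Φ ↦
    WLinf.ofBound (gstft f fun X ↦ schwartzConj (Φ.toAEEqFun X))
      (aestronglyMeasurable_gstft_conj f Φ) ⟨_, (hM f f.2 Φ).mono fun p hp ↦ hp.2⟩ with hW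
  have hcoe : ∀ (f : B) (Φ : g.Conf r), (W f Φ).toAEEqFun =ᵐ[sympMeasure₂ V]
      fun p ↦ (f : 𝓢(PhaseSpace V, ℂ) →L[ℂ] ℂ) (modulate p.2 (Φ.toAEEqFun p.1)) := fun f Φ ↦ by
    have h1 := WLinf.coeFn_ofBound (s := -((M : ℝ) + 1))
      (gstft (f : 𝓢(PhaseSpace V, ℂ) →L[ℂ] ℂ) fun X ↦ schwartzConj (Φ.toAEEqFun X))
      (aestronglyMeasurable_gstft_conj (f : 𝓢(PhaseSpace V, ℂ) →L[ℂ] ℂ) Φ)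
      ⟨_, (hM f f.2 Φ).mono fun p hp ↦ hp.2⟩
    filter_upwards [h1] with p hp
    rw [hW, hp, gstft, schwartzConj_schwartzConj]
  set L : B → g.Conf r →ₗ[ℂ] WLinf (sympMeasure₂ V) (-((M : ℝ) + 1)) := fun f ↦
    { toFun := W f
      map_add' := fun Φ Ψ ↦ by
        refine WLinf.ext_ae ?_
        filter_upwards [hcoe f (Φ + Ψ), hcoe f Φ, hcoe f Ψ, WLinf.coeFn_add (W f Φ) (W f Ψ),
          ae_fst (coeFn_add Φ Ψ)] with p h1 h2 h3 h4 h5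
        rw [h1, h4, h2, h3, h5]
        simp [modulate]
      map_smul' := fun c Φ ↦ by
        refine WLinf.ext_ae ?_
        filter_upwards [hcoe f (c • Φ), hcoe f Φ, WLinf.coeFn_smul c (W f Φ),
          ae_fst (coeFn_smul c Φ)] with p h1 h2 h3 h4
        rw [h1, RingHom.id_apply, h3, h2, h4]
        simp [modulate] } with hL
  have hLn : ∀ f Φ, ‖L f Φ‖ ≤ C * confSeminorm g r k Φ := by
    intro f Φ
    refine WLinf.norm_le_of_ae_bound (mul_nonneg hC (apply_nonneg _ _)) ?_
    filter_upwards [hM f f.2 Φ, hcoe f Φ] with p h1 h2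
    rw [hL]
    change _ * ‖(W f Φ).toAEEqFun p‖ ≤ _
    rw [h2]
    simpa only [gstft, schwartzConj_schwartzConj] using h1.2
  have hequi := equicontinuous_of_norm_le hLn
  refine ⟨fun f ↦ ⟨L f, hequi.continuous f⟩, fun f Φ φ hφ ↦ ?_, hequi⟩
  refine (hcoe f Φ).trans ?_
  filter_upwards [ae_fst hφ] with p hp
  rw [gstft, schwartzConj_schwartzConj, hp]

end Conf

end RiemMetric

/-! ### Fourier decay in Ξ by integration by parts. -/

section

variable {V : Type*} [NormedAddCommGroup V] [NormedSpace ℝ V]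

variable (V) in
/-- The symplectic form as a continuous bilinear map, with the arguments exchanged. -/
def sympBilin : PhaseSpace V →L[ℝ] PhaseSpace V →L[ℝ] ℝ :=
  LinearMap.mkContinuous₂ (LinearMap.mk₂ ℝ (fun Y Ξ ↦ sympForm Ξ Y)
    (fun X Y Z ↦ by simp only [sympForm_apply]; simp; ring)
    (fun c X Y ↦ by simp only [sympForm_apply]; simp; ring)
    (fun X Y Z ↦ by simp only [sympForm_apply]; simp; ring)
    (fun c X Y ↦ by simp only [sympForm_apply]; simp; ring)) 2 fun X Y ↦ by
      refine (abs_sympForm_le Y X).trans (le_of_eq ?_)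
      ring

theorem sympBilin_apply (Y Ξ : PhaseSpace V) : sympBilin V Y Ξ = sympForm Ξ Y := rfl

/-- Quantitative nondegeneracy, supplying a direction for the integration by parts. The larger
component of Ξ is tested against a norming functional or a nearly norming vector; the factor 1/2
makes the latter sufficient. -/
theorem exists_half_norm_le_abs_sympForm (Ξ : PhaseSpace V) :
    ∃ Y, ‖Y‖ ≤ 1 ∧ ‖Ξ‖ / 2 ≤ |sympForm Ξ Y| := by
  obtain ⟨x, ξ⟩ := Ξ
  rcases le_total ‖ξ‖ ‖x‖ with h | h
  · obtain ⟨η, hη, hηx⟩ := exists_dual_vector'' ℝ x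
    refine ⟨(0, η), by simpa using hη, ?_⟩
    rw [sympForm_apply, Prod.norm_def]
    simp only [map_zero, zero_sub, abs_neg, sup_eq_left.2 h]
    have h2 : η x = ‖x‖ := by simpa using hηx
    rw [h2, abs_of_nonneg (norm_nonneg _)]
    linarith [norm_nonneg x]
  · rcases (norm_nonneg ξ).eq_or_lt with h0 | h0
    · refine ⟨0, by simp, ?_⟩
      rw [Prod.norm_def, sup_eq_right.2 h, ← h0]
      simp
    · obtain ⟨y, hy, hyξ⟩ := ξ.exists_lt_apply_of_lt_opNorm (half_lt_self h0)
      refine ⟨(y, 0), by simpa using hy.le, ?_⟩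
      rw [sympForm_apply, Prod.norm_def]
      simp only [zero_apply, sub_zero, sup_eq_right.2 h]
      exact hyξ.le

variable [FiniteDimensional ℝ V] [MeasurableSpace V] [BorelSpace V]

theorem fourierIntegral_sympBilin (h : PhaseSpace V → ℂ) (Ξ : PhaseSpace V) :
    VectorFourier.fourierIntegral Real.fourierChar (sympMeasure V) (sympBilin V).toLinearMap₁₂ h Ξ =
      ∫ Y, sympChar Ξ Y * h Y ∂sympMeasure V := by
  rw [VectorFourier.fourierIntegral]
  congr 1
  funext Y
  rw [Circle.smul_def, smul_eq_mul, Real.fourierChar_apply]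
  congr 1
  change Complex.exp (((2 * Real.pi * -(sympForm Ξ Y) : ℝ) : ℂ) * Complex.I) = _
  rw [sympChar]
  congr 1
  push_cast
  ring

/-- The integral is a vector-valued Fourier integral for the form [Ξ, Y], differentiated n times
along a direction that detects Ξ. One factor 2^n comes from the detection and one from the general
Fourier estimate. -/
theorem pow_mul_norm_integral_sympChar_le (h : 𝓢(PhaseSpace V, ℂ)) (Ξ : PhaseSpace V) (n : ℕ) :
    ‖Ξ‖ ^ n * ‖∫ Y, sympChar Ξ Y * h Y ∂sympMeasure V‖ ≤
      4 ^ n * ∑ l ∈ Finset.range (n + 1), ∫ Y, ‖iteratedFDeriv ℝ l h Y‖ ∂sympMeasure V := by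
  obtain ⟨Y, hY, hΞY⟩ := exists_half_norm_le_abs_sympForm Ξ
  have h1 := VectorFourier.pow_mul_norm_iteratedFDeriv_fourierIntegral_le (μ := sympMeasure V)
    (K := 0) (N := ⊤) (k := 0) (n := n) (sympBilin V) (h.smooth ⊤)
    (fun k n _ _ ↦ h.integrable_pow_mul_iteratedFDeriv (sympMeasure V) k n) le_rfl le_top Y Ξ
  rw [norm_iteratedFDeriv_zero, fourierIntegral_sympBilin, sympBilin_apply] at h1
  have hS : 0 ≤ ∑ l ∈ Finset.range (n + 1), ∫ Y, ‖iteratedFDeriv ℝ l h Y‖ ∂sympMeasure V :=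
    Finset.sum_nonneg fun _ _ ↦ integral_nonneg (μ := sympMeasure V) fun Y ↦ by positivity
  have h2 : ∑ p ∈ Finset.range (0 + 1) ×ˢ Finset.range (n + 1),
      ∫ Y, ‖Y‖ ^ p.1 * ‖iteratedFDeriv ℝ p.2 h Y‖ ∂sympMeasure V =
      ∑ l ∈ Finset.range (n + 1), ∫ Y, ‖iteratedFDeriv ℝ l h Y‖ ∂sympMeasure V := by
    rw [Finset.sum_product]
    simp
  rw [h2, pow_zero, mul_one] at h1
  calc ‖Ξ‖ ^ n * ‖∫ Y, sympChar Ξ Y * h Y ∂sympMeasure V‖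
      = 2 ^ n * ((‖Ξ‖ / 2) ^ n * ‖∫ Y, sympChar Ξ Y * h Y ∂sympMeasure V‖) := by
        rw [div_pow]; field_simp
    _ ≤ 2 ^ n * (|sympForm Ξ Y| ^ n * ‖∫ Y, sympChar Ξ Y * h Y ∂sympMeasure V‖) := by gcongr
    _ ≤ 2 ^ n * (‖Y‖ ^ n * (2 * (0 : ℕ) + 2) ^ n *
          ∑ l ∈ Finset.range (n + 1), ∫ Y, ‖iteratedFDeriv ℝ l h Y‖ ∂sympMeasure V) := by gcongr
    _ ≤ 2 ^ n * (1 ^ n * (2 * (0 : ℕ) + 2) ^ n *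
          ∑ l ∈ Finset.range (n + 1), ∫ Y, ‖iteratedFDeriv ℝ l h Y‖ ∂sympMeasure V) := by gcongr
    _ = _ := by
        have : (4 : ℝ) ^ n = 2 ^ n * 2 ^ n := by rw [← mul_pow]; norm_num
        rw [this]
        simp
        ring

theorem schwartzToDual_modulate (ψ χ : 𝓢(PhaseSpace V, ℂ)) (Ξ : PhaseSpace V) :
    schwartzToDual ψ (modulate Ξ χ) =
      ∫ Y, sympChar Ξ Y * SchwartzMap.pairing (ContinuousLinearMap.mul ℂ ℂ) ψ χ Y
        ∂sympMeasure V := by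
  rw [schwartzToDual_apply]
  congr 1
  funext Y
  rw [modulate_apply, SchwartzMap.pairing_apply_apply, ContinuousLinearMap.mul_apply']
  ring

/-- Rapid decay of `Ξ ↦ ∫ ψ e^{-2πi[Ξ, ·]} χ` if the derivatives of `χ` have polynomial growth. -/
theorem exists_pow_mul_norm_schwartzToDual_modulate_le (V : Type*) [NormedAddCommGroup V]
    [NormedSpace ℝ V] [FiniteDimensional ℝ V] [MeasurableSpace V] [BorelSpace V] (n M : ℕ) :
    ∃ (m : ℕ) (C : ℝ), 0 ≤ C ∧ ∀ (ψ χ : 𝓢(PhaseSpace V, ℂ)) (A : ℝ), 0 ≤ A →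
      (∀ l ≤ n, ∀ Y, ‖iteratedFDeriv ℝ l χ Y‖ ≤ A * (1 + ‖Y‖) ^ M) → ∀ Ξ,
        (1 + ‖Ξ‖) ^ n * ‖schwartzToDual ψ (modulate Ξ χ)‖ ≤
          C * A * (Finset.Iic (m, m)).sup (schwartzSeminormFamily ℂ (PhaseSpace V) ℂ) ψ := by
  set d := (sympMeasure V).integrablePower with hd
  -- M absorbs the growth of the derivatives of χ, d makes the result integrable, and n accounts for
  -- the derivatives falling on ψ.
  set m := M + d + n with hm
  set J := ∫ Y, (1 + ‖Y‖) ^ (-(d : ℝ)) ∂sympMeasure V with hJ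
  have hint : Integrable (fun Y : PhaseSpace V ↦ (1 + ‖Y‖) ^ (-(d : ℝ))) (sympMeasure V) :=
    Measure.integrable_pow_neg_integrablePower (sympMeasure V)
  have hJ0 : 0 ≤ J := integral_nonneg fun Y ↦ by positivity
  refine ⟨m, 2 ^ n * ((4 ^ n + 1) * ((n + 1) * (2 ^ n * 2 ^ m * J))), by positivity,
    fun ψ χ A hA hχ Ξ ↦ ?_⟩
  set q := (Finset.Iic (m, m)).sup (schwartzSeminormFamily ℂ (PhaseSpace V) ℂ) ψ with hq
  have hq0 : 0 ≤ q := apply_nonneg _ _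
  set h := SchwartzMap.pairing (ContinuousLinearMap.mul ℂ ℂ) ψ χ with hh
  have hcoe : (h : PhaseSpace V → ℂ) = fun Y ↦ ψ Y * χ Y := by
    funext Y
    rw [hh, SchwartzMap.pairing_apply_apply, ContinuousLinearMap.mul_apply']
  have hder : ∀ l ≤ n, ∀ Y, ‖iteratedFDeriv ℝ l h Y‖ ≤
      (2 ^ n * 2 ^ m * A * q) * (1 + ‖Y‖) ^ (-(d : ℝ)) := by
    intro l hl Y
    have h1 := norm_iteratedFDeriv_mul_le (n := l) (ψ.smooth ⊤) (χ.smooth ⊤) Y (mod_cast le_top)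
    rw [hcoe, Real.rpow_neg (by positivity), ← div_eq_mul_inv, le_div_iff₀ (by positivity),
      Real.rpow_natCast]
    calc ‖iteratedFDeriv ℝ l (fun Y ↦ ψ Y * χ Y) Y‖ * (1 + ‖Y‖) ^ d
        ≤ (∑ i ∈ Finset.range (l + 1), (l.choose i : ℝ) * ‖iteratedFDeriv ℝ i ψ Y‖ *
            (A * (1 + ‖Y‖) ^ M)) * (1 + ‖Y‖) ^ d := by
          refine mul_le_mul_of_nonneg_right (h1.trans ?_) (by positivity)
          gcongr with i hi
          exact hχ _ (by omega) Y
      _ = ∑ i ∈ Finset.range (l + 1), (l.choose i : ℝ) * A *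
            ((1 + ‖Y‖) ^ (M + d) * ‖iteratedFDeriv ℝ i ψ Y‖) := by
          rw [Finset.sum_mul]
          exact Finset.sum_congr rfl fun i _ ↦ by ring
      _ ≤ ∑ i ∈ Finset.range (l + 1), (l.choose i : ℝ) * A * (2 ^ m * q) := by
          refine Finset.sum_le_sum fun i hi ↦ mul_le_mul_of_nonneg_left ?_ (by positivity)
          have h2 : M + d ≤ m := by omega
          have h3 : i ≤ m := by simp at hi; omega
          exact SchwartzMap.one_add_le_sup_seminorm_apply (𝕜 := ℂ) (m := (m, m)) h2 h3 ψ Y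
      _ = 2 ^ l * (A * (2 ^ m * q)) := by
          rw [← Finset.sum_mul, ← Finset.sum_mul, mul_assoc]
          congr 1
          exact_mod_cast Nat.sum_range_choose l
      _ ≤ 2 ^ n * (A * (2 ^ m * q)) := by
          gcongr
          norm_num
      _ = _ := by ring
  have hI : ∀ l ≤ n, ∫ Y, ‖iteratedFDeriv ℝ l h Y‖ ∂sympMeasure V ≤
      2 ^ n * 2 ^ m * A * q * J := by
    intro l hl
    rw [hJ, ← integral_const_mul]
    refine integral_mono_of_nonneg (.of_forall fun Y ↦ by positivity) (hint.const_mul _)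
      (.of_forall fun Y ↦ hder l hl Y)
  have hsum : ∀ j ≤ n, ∑ l ∈ Finset.range (j + 1), ∫ Y, ‖iteratedFDeriv ℝ l h Y‖ ∂sympMeasure V ≤
      (n + 1) * (2 ^ n * 2 ^ m * A * q * J) := by
    intro j hj
    calc _ ≤ ∑ l ∈ Finset.range (j + 1), 2 ^ n * 2 ^ m * A * q * J := by
          refine Finset.sum_le_sum fun l hl ↦ hI l ?_
          simp at hl; omega
      _ = (j + 1) * (2 ^ n * 2 ^ m * A * q * J) := by simp
      _ ≤ _ := by gcongr
  rw [schwartzToDual_modulate]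
  have h0 := pow_mul_norm_integral_sympChar_le h Ξ 0
  have hn := pow_mul_norm_integral_sympChar_le h Ξ n
  rw [pow_zero, one_mul, pow_zero, one_mul] at h0
  have h0' := h0.trans (hsum 0 (by omega))
  have hn' := hn.trans (mul_le_mul_of_nonneg_left (hsum n le_rfl) (by positivity))
  set I := ‖∫ Y, sympChar Ξ Y * h Y ∂sympMeasure V‖
  have hpow : (1 + ‖Ξ‖) ^ n ≤ 2 ^ n * (1 + ‖Ξ‖ ^ n) := by
    rcases le_total ‖Ξ‖ 1 with h1 | h1
    · calc (1 + ‖Ξ‖) ^ n ≤ 2 ^ n := pow_le_pow_left₀ (by positivity) (by linarith) n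
        _ ≤ _ := le_mul_of_one_le_right (by positivity)
            (by linarith [pow_nonneg (norm_nonneg Ξ) n])
    · calc (1 + ‖Ξ‖) ^ n ≤ (2 * ‖Ξ‖) ^ n := pow_le_pow_left₀ (by positivity) (by linarith) n
        _ = 2 ^ n * ‖Ξ‖ ^ n := mul_pow _ _ _
        _ ≤ _ := by gcongr; linarith
  calc (1 + ‖Ξ‖) ^ n * I ≤ 2 ^ n * (1 + ‖Ξ‖ ^ n) * I := by gcongr
    _ = 2 ^ n * (I + ‖Ξ‖ ^ n * I) := by ring
    _ ≤ 2 ^ n * ((n + 1) * (2 ^ n * 2 ^ m * A * q * J) +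
          4 ^ n * ((n + 1) * (2 ^ n * 2 ^ m * A * q * J))) := by gcongr
    _ = _ := by ring

theorem schwartzToDual_add (ψ ψ' : 𝓢(PhaseSpace V, ℂ)) :
    schwartzToDual (ψ + ψ') = schwartzToDual ψ + schwartzToDual ψ' := by
  simp [schwartzToDual]

theorem schwartzToDual_smul (c : ℂ) (ψ : 𝓢(PhaseSpace V, ℂ)) :
    schwartzToDual (c • ψ) = c • schwartzToDual ψ := by
  simp [schwartzToDual]

end

/-! ### Part (ii): rapidly decaying transforms of Schwartz functions. -/

namespace ProjLinf

variable {E : Type*} [NormedAddCommGroup E] [MeasurableSpace E] {μ : Measure E} [BorelSpace E]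

/-- The class of a measurable function of rapid decay. -/
def ofBound (f : E → ℂ) (hf : AEStronglyMeasurable f μ)
    (h : ∀ n : ℕ, ∃ A : ℝ, ∀ᵐ x ∂μ, (1 + ‖x‖) ^ n * ‖f x‖ ≤ A) : ProjLinf μ :=
  ⟨AEEqFun.mk f hf, (Submodule.mem_iInf _).2 fun s ↦ by
    obtain ⟨n, hn⟩ := exists_nat_ge (s : ℝ)
    obtain ⟨A, hA⟩ := h n
    refine (wENorm_mono μ hn _).trans_lt ((wENorm_le_of_ae_bound (A := A) ?_).trans_lt
      ENNReal.ofReal_lt_top)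
    filter_upwards [hA, AEEqFun.coeFn_mk f hf] with x hx hx'
    rwa [hx', Real.rpow_natCast]⟩

theorem coeFn_ofBound (f : E → ℂ) (hf : AEStronglyMeasurable f μ)
    (h : ∀ n : ℕ, ∃ A : ℝ, ∀ᵐ x ∂μ, (1 + ‖x‖) ^ n * ‖f x‖ ≤ A) :
    (ofBound f hf h).toAEEqFun =ᵐ[μ] f :=
  AEEqFun.coeFn_mk f hf

theorem ext_ae {F G : ProjLinf μ} (h : F.toAEEqFun =ᵐ[μ] G.toAEEqFun) : F = G :=
  Subtype.ext (AEEqFun.ext h)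

theorem coeFn_add (F G : ProjLinf μ) :
    (F + G).toAEEqFun =ᵐ[μ] fun x ↦ F.toAEEqFun x + G.toAEEqFun x :=
  AEEqFun.coeFn_add F.toAEEqFun G.toAEEqFun

theorem coeFn_smul (c : ℂ) (F : ProjLinf μ) :
    (c • F).toAEEqFun =ᵐ[μ] fun x ↦ c * F.toAEEqFun x :=
  AEEqFun.coeFn_smul c F.toAEEqFun

end ProjLinf

namespace RiemMetric.Conf

variable {V : Type*} [NormedAddCommGroup V] [NormedSpace ℝ V]
  [FiniteDimensional ℝ V] [MeasurableSpace V] [BorelSpace V] {g : RiemMetric V}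
  {C₀ r₀ N₀ r : ℝ}

/-- For fixed X, the derivatives of φ_X are of size (1 + |X|)^{−n}(1 + |Y|)^M. The first factor is
the decay in X and acts as a constant in the Fourier estimate, which absorbs the second one into ψ
and yields the decay in Ξ. -/
theorem ae_pow_mul_norm_gstft_schwartzToDual_le (hg : g.IsHormander C₀ r₀ N₀) (hr : 0 < r)
    (hrr₀ : r ≤ r₀) (n : ℕ) :
    ∃ (k m : ℕ) (C : ℝ), 0 ≤ C ∧ ∀ (ψ : 𝓢(PhaseSpace V, ℂ)) (Φ : g.Conf r),
      ∀ᵐ p ∂sympMeasure₂ V, (1 + ‖p‖) ^ n * ‖gstft (schwartzToDual ψ) Φ.toAEEqFun p‖ ≤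
        C * (Finset.Iic (m, m)).sup (schwartzSeminormFamily ℂ (PhaseSpace V) ℂ) ψ *
          confSeminorm g r k Φ := by
  obtain ⟨k, C₁, M, hC₁, h₁⟩ := hg.norm_iteratedFDeriv_le_point hr hrr₀ n
  obtain ⟨m, C₂, hC₂, h₂⟩ := exists_pow_mul_norm_schwartzToDual_modulate_le V n M
  refine ⟨k, m, C₂ * C₁, by positivity, fun ψ Φ ↦ ?_⟩
  filter_upwards [ae_fst (Φ.ae_confNorm_le k)] with p hp
  obtain ⟨X, Ξ⟩ := p
  set R := confSeminorm g r k Φ with hR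
  have hR0 : 0 ≤ R := apply_nonneg _ _
  have hpos : 0 < (1 + ‖X‖) ^ n := by positivity
  have h3 := h₂ ψ (schwartzConj (Φ.toAEEqFun X)) (C₁ * R / (1 + ‖X‖) ^ n) (by positivity)
    (fun l hl Y ↦ by
      rw [div_mul_eq_mul_div, le_div_iff₀ hpos, mul_comm, norm_iteratedFDeriv_schwartzConj]
      exact h₁ X _ R hR0 hp l hl Y) Ξ
  have hnorm : 1 + ‖(X, Ξ)‖ ≤ (1 + ‖X‖) * (1 + ‖Ξ‖) := by
    rw [Prod.norm_def]
    rcases max_choice ‖X‖ ‖Ξ‖ with h | h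
    · rw [h]; nlinarith [norm_nonneg X, norm_nonneg Ξ, mul_nonneg (norm_nonneg X) (norm_nonneg Ξ)]
    · rw [h]; nlinarith [norm_nonneg X, norm_nonneg Ξ, mul_nonneg (norm_nonneg X) (norm_nonneg Ξ)]
  calc (1 + ‖(X, Ξ)‖) ^ n * ‖gstft (schwartzToDual ψ) Φ.toAEEqFun (X, Ξ)‖
      ≤ ((1 + ‖X‖) * (1 + ‖Ξ‖)) ^ n * ‖gstft (schwartzToDual ψ) Φ.toAEEqFun (X, Ξ)‖ := by gcongr
    _ = (1 + ‖X‖) ^ n * ((1 + ‖Ξ‖) ^ n *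
          ‖schwartzToDual ψ (modulate Ξ (schwartzConj (Φ.toAEEqFun X)))‖) := by
        rw [mul_pow, mul_assoc]; rfl
    _ ≤ (1 + ‖X‖) ^ n * (C₂ * (C₁ * R / (1 + ‖X‖) ^ n) *
          (Finset.Iic (m, m)).sup (schwartzSeminormFamily ℂ (PhaseSpace V) ℂ) ψ) := by gcongr
    _ = _ := by
        field_simp

theorem exists_ae_pow_mul_norm_gstft_le (hg : g.IsHormander C₀ r₀ N₀) (hr : 0 < r)
    (hrr₀ : r ≤ r₀) (ψ : 𝓢(PhaseSpace V, ℂ)) (Φ : g.Conf r) (n : ℕ) :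
    ∃ A : ℝ, ∀ᵐ p ∂sympMeasure₂ V,
      (1 + ‖p‖) ^ n * ‖gstft (schwartzToDual ψ) Φ.toAEEqFun p‖ ≤ A := by
  obtain ⟨k, m, C, hC, h⟩ := ae_pow_mul_norm_gstft_schwartzToDual_le hg hr hrr₀ n
  exact ⟨_, h ψ Φ⟩

/-- The geometric short-time Fourier transform of Schwartz functions. -/
def stftSchwartz (hg : g.IsHormander C₀ r₀ N₀) (hr : 0 < r) (hrr₀ : r ≤ r₀) :
    𝓢(PhaseSpace V, ℂ) →ₗ[ℂ] (g.Conf r →ₛₗ[starRingEnd ℂ] ProjLinf (sympMeasure₂ V)) :=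
  LinearMap.mk₂'ₛₗ (RingHom.id ℂ) (starRingEnd ℂ)
    (fun ψ Φ ↦ ProjLinf.ofBound (gstft (schwartzToDual ψ) Φ.toAEEqFun)
      (aestronglyMeasurable_gstft _ Φ) (exists_ae_pow_mul_norm_gstft_le hg hr hrr₀ ψ Φ))
    (fun ψ ψ' Φ ↦ by
      refine ProjLinf.ext_ae ?_
      refine (ProjLinf.coeFn_ofBound _ _ _).trans (.trans ?_ (ProjLinf.coeFn_add _ _).symm)
      filter_upwards [ProjLinf.coeFn_ofBound (gstft (schwartzToDual ψ) Φ.toAEEqFun)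
          (aestronglyMeasurable_gstft _ Φ) (exists_ae_pow_mul_norm_gstft_le hg hr hrr₀ ψ Φ),
        ProjLinf.coeFn_ofBound (gstft (schwartzToDual ψ') Φ.toAEEqFun)
          (aestronglyMeasurable_gstft _ Φ) (exists_ae_pow_mul_norm_gstft_le hg hr hrr₀ ψ' Φ)]
        with p h1 h2
      rw [h1, h2, schwartzToDual_add]
      rfl)
    (fun c ψ Φ ↦ by
      refine ProjLinf.ext_ae ?_
      refine (ProjLinf.coeFn_ofBound _ _ _).trans (.trans ?_ (ProjLinf.coeFn_smul _ _).symm)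
      filter_upwards [ProjLinf.coeFn_ofBound (gstft (schwartzToDual ψ) Φ.toAEEqFun)
        (aestronglyMeasurable_gstft _ Φ) (exists_ae_pow_mul_norm_gstft_le hg hr hrr₀ ψ Φ)]
        with p h1
      rw [h1, schwartzToDual_smul]
      rfl)
    (fun ψ Φ Ψ ↦ by
      refine ProjLinf.ext_ae ?_
      refine (ProjLinf.coeFn_ofBound _ _ _).trans (.trans ?_ (ProjLinf.coeFn_add _ _).symm)
      filter_upwards [ProjLinf.coeFn_ofBound (gstft (schwartzToDual ψ) Φ.toAEEqFun)
          (aestronglyMeasurable_gstft _ Φ) (exists_ae_pow_mul_norm_gstft_le hg hr hrr₀ ψ Φ),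
        ProjLinf.coeFn_ofBound (gstft (schwartzToDual ψ) Ψ.toAEEqFun)
          (aestronglyMeasurable_gstft _ Ψ) (exists_ae_pow_mul_norm_gstft_le hg hr hrr₀ ψ Ψ),
        gstft_congr (schwartzToDual ψ) (coeFn_add Φ Ψ)] with p h1 h2 h3
      rw [h1, h2, h3, gstft_add_right])
    (fun c ψ Φ ↦ by
      refine ProjLinf.ext_ae ?_
      refine (ProjLinf.coeFn_ofBound _ _ _).trans (.trans ?_ (ProjLinf.coeFn_smul _ _).symm)
      filter_upwards [ProjLinf.coeFn_ofBound (gstft (schwartzToDual ψ) Φ.toAEEqFun)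
        (aestronglyMeasurable_gstft _ Φ) (exists_ae_pow_mul_norm_gstft_le hg hr hrr₀ ψ Φ),
        gstft_congr (schwartzToDual ψ) (coeFn_smul c Φ)] with p h1 h2
      rw [h1, h2, gstft_smul_right])

theorem coeFn_stftSchwartz (hg : g.IsHormander C₀ r₀ N₀) (hr : 0 < r) (hrr₀ : r ≤ r₀)
    (ψ : 𝓢(PhaseSpace V, ℂ)) (Φ : g.Conf r) :
    (stftSchwartz hg hr hrr₀ ψ Φ).toAEEqFun =ᵐ[sympMeasure₂ V]
      gstft (schwartzToDual ψ) Φ.toAEEqFun :=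
  ProjLinf.coeFn_ofBound _ _ (exists_ae_pow_mul_norm_gstft_le hg hr hrr₀ ψ Φ)

theorem exists_norm_incl_stftSchwartz_le (hg : g.IsHormander C₀ r₀ N₀) (hr : 0 < r)
    (hrr₀ : r ≤ r₀) (s : ℝ≥0) :
    ∃ (k m : ℕ) (C : ℝ), 0 ≤ C ∧ ∀ (ψ : 𝓢(PhaseSpace V, ℂ)) (Φ : g.Conf r),
      ‖ProjLinf.incl _ s (stftSchwartz hg hr hrr₀ ψ Φ)‖ ≤
        C * (Finset.Iic (m, m)).sup (schwartzSeminormFamily ℂ (PhaseSpace V) ℂ) ψ *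
          confSeminorm g r k Φ := by
  obtain ⟨n, hn⟩ := exists_nat_ge (s : ℝ)
  obtain ⟨k, m, C, hC, h⟩ := ae_pow_mul_norm_gstft_schwartzToDual_le hg hr hrr₀ n
  refine ⟨k, m, C, hC, fun ψ Φ ↦ WLinf.norm_le_of_ae_bound
    (mul_nonneg (mul_nonneg hC (apply_nonneg _ _)) (apply_nonneg _ _)) ?_⟩
  filter_upwards [h ψ Φ, coeFn_stftSchwartz hg hr hrr₀ ψ Φ] with p h1 h2
  change (1 + ‖p‖) ^ (s : ℝ) * ‖(stftSchwartz hg hr hrr₀ ψ Φ).toAEEqFun p‖ ≤ _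
  rw [h2]
  refine le_trans ?_ h1
  rw [← Real.rpow_natCast]
  gcongr
  linarith [norm_nonneg p]

theorem continuous_stftSchwartz (hg : g.IsHormander C₀ r₀ N₀) (hr : 0 < r) (hrr₀ : r ≤ r₀) :
    Continuous fun p : 𝓢(PhaseSpace V, ℂ) × g.Conf r ↦ stftSchwartz hg hr hrr₀ p.1 p.2 := by
  refine continuous_iInf_rng.2 fun s ↦ continuous_induced_rng.2 ?_
  rw [continuous_iff_continuousAt]
  rintro ⟨ψ, Φ⟩
  obtain ⟨k, m, C, hC, h⟩ := exists_norm_incl_stftSchwartz_le hg hr hrr₀ s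
  set q := (Finset.Iic (m, m)).sup (schwartzSeminormFamily ℂ (PhaseSpace V) ℂ) with hq
  set 𝒱 := stftSchwartz hg hr hrr₀ with h𝒱
  have hqc : Continuous q := by
    rw [hq]
    exact Seminorm.continuous_finsetSup fun i _ ↦
      (schwartz_withSeminorms ℂ (PhaseSpace V) ℂ).continuous_seminorm i
  have h1 : Tendsto (fun p : 𝓢(PhaseSpace V, ℂ) × g.Conf r ↦ q (p.1 - ψ)) (𝓝 (ψ, Φ)) (𝓝 0) := by
    have : Continuous fun p : 𝓢(PhaseSpace V, ℂ) × g.Conf r ↦ q (p.1 - ψ) :=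
      hqc.comp (continuous_fst.sub continuous_const)
    simpa using this.tendsto (ψ, Φ)
  have h2 : Tendsto (fun p : 𝓢(PhaseSpace V, ℂ) × g.Conf r ↦ confSeminorm g r k (p.2 - Φ))
      (𝓝 (ψ, Φ)) (𝓝 0) := by
    have h3 : Tendsto (fun p : 𝓢(PhaseSpace V, ℂ) × g.Conf r ↦ confSeminorm g r k (Φ - p.2))
        (𝓝 (ψ, Φ)) (𝓝 0) := (tendsto_confSeminorm k Φ).comp (continuous_snd.tendsto (ψ, Φ))
    refine h3.congr fun p ↦ ?_
    rw [← map_neg_eq_map, neg_sub]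
  have h3 : Tendsto (fun p : 𝓢(PhaseSpace V, ℂ) × g.Conf r ↦
      C * q (p.1 - ψ) * confSeminorm g r k (p.2 - Φ) + C * q (p.1 - ψ) * confSeminorm g r k Φ +
        C * q ψ * confSeminorm g r k (p.2 - Φ)) (𝓝 (ψ, Φ)) (𝓝 0) := by
    have := (((h1.const_mul C).mul h2).add ((h1.const_mul C).mul_const (confSeminorm g r k Φ))).add
      (h2.const_mul (C * q ψ))
    simpa using this
  rw [ContinuousAt, tendsto_iff_norm_sub_tendsto_zero]
  refine squeeze_zero (fun _ ↦ norm_nonneg _) (fun p ↦ ?_) h3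
  -- Expansion of a sesquilinear map around (ψ, Φ); each of the three terms is bounded by a product
  -- of seminorms with at least one factor tending to 0.
  have hsplit : 𝒱 p.1 p.2 - 𝒱 ψ Φ =
      𝒱 (p.1 - ψ) (p.2 - Φ) + 𝒱 (p.1 - ψ) Φ + 𝒱 ψ (p.2 - Φ) := by
    simp only [map_sub, LinearMap.sub_apply]
    abel
  have hincl : ProjLinf.incl (sympMeasure₂ V) s (𝒱 p.1 p.2) - ProjLinf.incl _ s (𝒱 ψ Φ) =
      ProjLinf.incl _ s (𝒱 (p.1 - ψ) (p.2 - Φ)) + ProjLinf.incl _ s (𝒱 (p.1 - ψ) Φ) +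
        ProjLinf.incl _ s (𝒱 ψ (p.2 - Φ)) := by
    change ProjLinf.incl (sympMeasure₂ V) s (𝒱 p.1 p.2 - 𝒱 ψ Φ) = ProjLinf.incl _ s
      (𝒱 (p.1 - ψ) (p.2 - Φ) + 𝒱 (p.1 - ψ) Φ + 𝒱 ψ (p.2 - Φ))
    rw [hsplit]
  change ‖ProjLinf.incl (sympMeasure₂ V) s (𝒱 p.1 p.2) - ProjLinf.incl _ s (𝒱 ψ Φ)‖ ≤ _
  rw [hincl]
  exact (norm_add₃_le).trans (add_le_add (add_le_add (h _ _) (h _ _)) (h _ _))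

end RiemMetric.Conf

/-! ### Differentiability from continuous partial derivatives. -/

/-- Coordinates are moved one at a time: the mean value inequality handles the new coordinate, with
the continuity of its partial derivative, and the induction hypothesis handles the others. -/
theorem exists_norm_sub_sub_sum_le {E F ι : Type*} [NormedAddCommGroup E] [NormedSpace ℝ E]
    [NormedAddCommGroup F] [NormedSpace ℝ F] [Finite ι] (b : Module.Basis ι ℝ E) {f : E → F} {D : ι → E → F}
    (hD : ∀ i, Continuous (D i))
    (h : ∀ x i, HasDerivAt (fun t : ℝ ↦ f (x + t • b i)) (D i x) 0) (x : E) (s : Finset ι)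
    {ε : ℝ} (hε : 0 < ε) :
    ∃ δ > 0, ∀ c : ι → ℝ, (∀ i, |c i| < δ) →
      ‖f (x + ∑ i ∈ s, c i • b i) - f x - ∑ i ∈ s, c i • D i x‖ ≤ ε * ∑ i ∈ s, |c i| := by
  classical
  have := Fintype.ofFinite ι
  induction s using Finset.induction_on with
  | empty => exact ⟨1, one_pos, fun c _ ↦ by simp⟩
  | insert j s hj ih =>
    obtain ⟨δ₁, hδ₁, h₁⟩ := ih
    obtain ⟨δ₂, hδ₂, h₂⟩ := Metric.continuousAt_iff.1 ((hD j).continuousAt (x := x)) ε hε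
    -- Coefficients below δ₂/K displace the point by less than δ₂, so `D j` stays within ε of its
    -- value at x along the whole segment.
    set K := 1 + ∑ i, ‖b i‖ with hK
    have hK0 : 0 < K := by
      have : 0 ≤ ∑ i, ‖b i‖ := Finset.sum_nonneg fun i _ ↦ norm_nonneg _
      linarith
    refine ⟨min δ₁ (δ₂ / K), by positivity, fun c hc ↦ ?_⟩
    have hc₁ : ∀ i, |c i| < δ₁ := fun i ↦ (hc i).trans_le (min_le_left _ _)
    have hc₂ : ∀ i, |c i| < δ₂ / K := fun i ↦ (hc i).trans_le (min_le_right _ _)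
    set z := x + ∑ i ∈ s, c i • b i with hz
    have hder : ∀ t : ℝ, HasDerivAt (fun t : ℝ ↦ f (z + t • b j) - t • D j x)
        (D j (z + t • b j) - D j x) t := by
      intro t
      have h3 : HasDerivAt (fun t' : ℝ ↦ f (z + t' • b j)) (D j (z + t • b j)) t := by
        have h4 : HasDerivAt (fun t' : ℝ ↦ f (z + t • b j + t' • b j)) (D j (z + t • b j))
            ((fun t' : ℝ ↦ t' - t) t) := by
          have h0 : (fun t' : ℝ ↦ t' - t) t = 0 := sub_self t
          rw [h0]
          exact h _ j
        have h5 : HasDerivAt (fun t' : ℝ ↦ t' - t) 1 t := (hasDerivAt_id t).sub_const t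
        have h6 := HasDerivAt.scomp (h := fun t' : ℝ ↦ t' - t) t h4 h5
        rw [one_smul] at h6
        refine h6.congr_of_eventuallyEq (.of_forall fun t' ↦ ?_)
        simp only [Function.comp_apply]
        congr 1
        rw [sub_smul]
        abel
      have h7 : HasDerivAt (fun t' : ℝ ↦ t' • D j x) (D j x) t := by
        simpa using (hasDerivAt_id t).smul_const (D j x)
      exact h3.sub h7
    have hbound : ∀ t ∈ Metric.ball (0 : ℝ) (δ₂ / K), ‖D j (z + t • b j) - D j x‖ ≤ ε := by
      intro t ht
      rw [mem_ball_zero_iff, Real.norm_eq_abs] at ht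
      rw [← dist_eq_norm]
      refine (h₂ ?_).le
      rw [dist_eq_norm, hz]
      have h3 : x + ∑ i ∈ s, c i • b i + t • b j - x = ∑ i ∈ s, c i • b i + t • b j := by abel
      rw [h3]
      have hδK : 0 < δ₂ / K := by positivity
      have h4 : ‖∑ i ∈ s, c i • b i‖ ≤ δ₂ / K * ∑ i ∈ s, ‖b i‖ := by
        rw [Finset.mul_sum]
        refine norm_sum_le_of_le _ fun i _ ↦ ?_
        rw [norm_smul]
        gcongr
        exact (hc₂ i).le
      have h5 : ‖t • b j‖ ≤ δ₂ / K * ‖b j‖ := by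
        rw [norm_smul]
        gcongr
        exact ht.le
      have h6 : ∑ i ∈ s, ‖b i‖ + ‖b j‖ ≤ ∑ i, ‖b i‖ := by
        rw [add_comm, ← Finset.sum_insert (f := fun i ↦ ‖b i‖) hj]
        exact Finset.sum_le_sum_of_subset_of_nonneg (Finset.subset_univ _)
          fun _ _ _ ↦ norm_nonneg _
      calc ‖∑ i ∈ s, c i • b i + t • b j‖ ≤ δ₂ / K * (∑ i ∈ s, ‖b i‖ + ‖b j‖) :=
            (norm_add_le _ _).trans (by linarith)
        _ ≤ δ₂ / K * ∑ i, ‖b i‖ := by gcongr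
        _ < δ₂ / K * K := by
            gcongr
            linarith
        _ = δ₂ := by field_simp
    have hmv := (convex_ball (0 : ℝ) (δ₂ / K)).norm_image_sub_le_of_norm_hasDerivWithin_le
      (fun t _ ↦ (hder t).hasDerivWithinAt) hbound (Metric.mem_ball_self (by positivity))
      (by rw [mem_ball_zero_iff]; exact hc₂ j : c j ∈ Metric.ball (0 : ℝ) (δ₂ / K))
    simp only [zero_smul, add_zero, sub_zero, Real.norm_eq_abs] at hmv
    rw [Finset.sum_insert hj, Finset.sum_insert hj, Finset.sum_insert hj, mul_add]
    have hsplit : f (x + (c j • b j + ∑ i ∈ s, c i • b i)) - f x -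
        (c j • D j x + ∑ i ∈ s, c i • D i x) =
        (f (z + c j • b j) - c j • D j x - f z) + (f z - f x - ∑ i ∈ s, c i • D i x) := by
      rw [hz, show x + (c j • b j + ∑ i ∈ s, c i • b i) = x + ∑ i ∈ s, c i • b i + c j • b j by abel]
      abel
    rw [hsplit]
    exact (norm_add_le _ _).trans (add_le_add hmv (h₁ c hc₁))

section Partial

variable {E F ι : Type*} [NormedAddCommGroup E] [NormedSpace ℝ E] [FiniteDimensional ℝ E]
  [NormedAddCommGroup F] [NormedSpace ℝ F]

/-- The linear map with given values on a basis, as a continuous linear function of the values. -/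
def basisConstr (F : Type*) [NormedAddCommGroup F] [NormedSpace ℝ F] (b : Module.Basis ι ℝ E)
    (i : ι) : F →L[ℝ] E →L[ℝ] F :=
  ContinuousLinearMap.smulRightL ℝ E F (b.coord i).toContinuousLinearMap

variable [Fintype ι]

/-- A function with continuous partial derivatives is differentiable. -/
theorem hasFDerivAt_of_continuous_partial (b : Module.Basis ι ℝ E) {f : E → F} {D : ι → E → F}
    (hD : ∀ i, Continuous (D i))
    (h : ∀ x i, HasDerivAt (fun t : ℝ ↦ f (x + t • b i)) (D i x) 0) (x : E) :
    HasFDerivAt f (∑ i, basisConstr F b i (D i x)) x := by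
  obtain ⟨C, hC, hrepr⟩ : ∃ C > 0, ∀ v i, |b.repr v i| ≤ C * ‖v‖ := by
    refine ⟨1 + ∑ i, ‖(b.coord i).toContinuousLinearMap‖, ?_, fun v i ↦ ?_⟩
    · have : 0 ≤ ∑ i, ‖(b.coord i).toContinuousLinearMap‖ :=
        Finset.sum_nonneg fun i _ ↦ norm_nonneg _
      linarith
    · refine ((b.coord i).toContinuousLinearMap.le_opNorm v).trans ?_
      gcongr
      have := Finset.single_le_sum (f := fun i ↦ ‖(b.coord i).toContinuousLinearMap‖)
        (fun i _ ↦ norm_nonneg _) (Finset.mem_univ i)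
      linarith
  rw [hasFDerivAt_iff_isLittleO_nhds_zero, Asymptotics.isLittleO_iff]
  intro ε hε
  set n : ℝ := Fintype.card ι + 1
  have hn : 0 < n := by positivity
  -- Dividing by nC compensates the sum of at most n coordinates, each bounded by C‖v‖.
  obtain ⟨δ, hδ, hf⟩ := exists_norm_sub_sub_sum_le b hD h x Finset.univ
    (ε := ε / (n * C)) (by positivity)
  filter_upwards [Metric.ball_mem_nhds (0 : E) (show 0 < δ / C by positivity)] with v hv
  rw [mem_ball_zero_iff, lt_div_iff₀ hC] at hv
  have h1 := hf (fun i ↦ b.repr v i) fun i ↦ (hrepr v i).trans_lt (by linarith)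
  rw [b.sum_repr] at h1
  have h2 : (∑ i, basisConstr F b i (D i x)) v = ∑ i, b.repr v i • D i x := by
    rw [sum_apply]
    rfl
  rw [h2]
  refine h1.trans ?_
  calc ε / (n * C) * ∑ i, |b.repr v i| ≤ ε / (n * C) * ∑ _i : ι, C * ‖v‖ := by
        gcongr with i
        exact hrepr v i
    _ = ε / (n * C) * ((Fintype.card ι) * (C * ‖v‖)) := by simp
    _ ≤ ε / (n * C) * (n * (C * ‖v‖)) := by
        gcongr
        exact le_add_of_nonneg_right zero_le_one
    _ = ε * ‖v‖ := by field_simp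

theorem contDiff_succ_of_partial (b : Module.Basis ι ℝ E) {f : E → F} {D : ι → E → F} {n : ℕ}
    (hD : ∀ i, ContDiff ℝ n (D i))
    (h : ∀ x i, HasDerivAt (fun t : ℝ ↦ f (x + t • b i)) (D i x) 0) :
    ContDiff ℝ (n + 1 : ℕ) f := by
  push_cast
  rw [contDiff_succ_iff_hasFDerivAt]
  refine ⟨_, ?_, fun x ↦ hasFDerivAt_of_continuous_partial b (fun i ↦ (hD i).continuous) h x⟩
  exact ContDiff.sum fun i _ ↦ (basisConstr F b i).contDiff.comp (hD i)

theorem norm_iteratedFDeriv_succ_le_of_partial (b : Module.Basis ι ℝ E) {f : E → F}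
    {D : ι → E → F} {n : ℕ} (hD : ∀ i, ContDiff ℝ n (D i))
    (h : ∀ x i, HasDerivAt (fun t : ℝ ↦ f (x + t • b i)) (D i x) 0) (x : E) :
    ‖iteratedFDeriv ℝ (n + 1) f x‖ ≤
      ∑ i, ‖basisConstr F b i‖ * ‖iteratedFDeriv ℝ n (D i) x‖ := by
  have hfd : fderiv ℝ f = fun x ↦ ∑ i, (basisConstr F b i ∘ D i) x := by
    funext x
    exact (hasFDerivAt_of_continuous_partial b (fun i ↦ (hD i).continuous) h x).fderiv
  rw [← norm_iteratedFDeriv_fderiv, hfd, iteratedFDeriv_fun_sum_apply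
    fun i _ ↦ ((basisConstr F b i).contDiff.comp (hD i)).contDiffAt]
  refine norm_sum_le_of_le _ fun i _ ↦ ?_
  exact (basisConstr F b i).norm_iteratedFDeriv_comp_left (hD i).contDiffAt le_rfl

end Partial

/-! ### Smooth maps into topological vector spaces, tested by functionals. -/

section ClassCinfty

variable {E : Type*} [NormedAddCommGroup E] [NormedSpace ℝ E] [FiniteDimensional ℝ E]
  {G : Type*} [AddCommGroup G] [Module ℝ G] [TopologicalSpace G]

/-- `φ'` is the directional derivative of `φ` along `v`. -/
def HasDirDeriv {E : Type*} [NormedAddCommGroup E] [NormedSpace ℝ E]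
    {G : Type*} [AddCommGroup G] [Module ℝ G] [TopologicalSpace G] (φ φ' : E → G) (v : E) : Prop :=
  ∀ x, Tendsto (fun t : ℝ ↦ t⁻¹ • (φ (x + t • v) - φ x)) (𝓝[≠] 0) (𝓝 (φ' x))

theorem HasDirDeriv.hasDerivAt {E : Type*} [NormedAddCommGroup E] [NormedSpace ℝ E]
    {G : Type*} [AddCommGroup G] [Module ℝ G] [TopologicalSpace G] {F : Type*}
    [NormedAddCommGroup F] [NormedSpace ℝ F] {φ φ' : E → G} {v : E}
    (h : HasDirDeriv φ φ' v) (L : G →L[ℝ] F) (x : E) :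
    HasDerivAt (fun t : ℝ ↦ L (φ (x + t • v))) (L (φ' x)) 0 := by
  rw [hasDerivAt_iff_tendsto_slope_zero]
  refine ((L.continuous.tendsto _).comp (h x)).congr fun t ↦ ?_
  simp

theorem IsClassCinfty.continuous {E : Type*} [NormedAddCommGroup E] [NormedSpace ℝ E]
    {G : Type*} [AddCommGroup G] [Module ℝ G] [TopologicalSpace G] {φ : E → G}
    (hφ : IsClassCinfty φ) : Continuous φ := hφ 0

/-- Each order k provides its own directional derivative; uniqueness of limits identifies them all,
so one derivative is smooth of every order. -/
theorem IsClassCinfty.exists_hasDirDeriv {E : Type*} [NormedAddCommGroup E] [NormedSpace ℝ E]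
    {G : Type*} [AddCommGroup G] [Module ℝ G] [TopologicalSpace G] [T2Space G] {φ : E → G}
    (hφ : IsClassCinfty φ) (v : E) : ∃ φ', HasDirDeriv φ φ' v ∧ IsClassCinfty φ' := by
  choose φ' h h' using fun k ↦ (hφ (k + 1)).2 v
  have heq : ∀ k, φ' k = φ' 0 := fun k ↦ funext fun x ↦ tendsto_nhds_unique (h k x) (h 0 x)
  exact ⟨φ' 0, h 0, fun k ↦ heq k ▸ h' k⟩

theorem IsClassCinfty.contDiff_comp [T2Space G] {F : Type*}
    [NormedAddCommGroup F] [NormedSpace ℝ F] (L : G →L[ℝ] F) (n : ℕ) {φ : E → G}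
    (hφ : IsClassCinfty φ) : ContDiff ℝ n fun x ↦ L (φ x) := by
  induction n generalizing φ with
  | zero =>
    rw [Nat.cast_zero, contDiff_zero]
    exact L.continuous.comp hφ.continuous
  | succ n ih =>
    set b := Module.finBasis ℝ E
    choose φ' h h' using fun i ↦ hφ.exists_hasDirDeriv (b i)
    exact contDiff_succ_of_partial b (D := fun i x ↦ L (φ' i x)) (fun i ↦ ih (h' i))
      fun x i ↦ (h i).hasDerivAt L x

theorem HasDirDeriv.fderiv_apply [T2Space G] {F : Type*}
    [NormedAddCommGroup F] [NormedSpace ℝ F] {φ φ' : E → G} {v : E}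
    (h : HasDirDeriv φ φ' v) (hφ : IsClassCinfty φ) (L : G →L[ℝ] F) (x : E) :
    fderiv ℝ (fun x ↦ L (φ x)) x v = L (φ' x) := by
  have hd : DifferentiableAt ℝ (fun x ↦ L (φ x)) x :=
    ((hφ.contDiff_comp L 1).differentiable (by simp)).differentiableAt
  have h1 : HasDerivAt (fun t : ℝ ↦ x + t • v) v 0 := by
    simpa using ((hasDerivAt_id (0 : ℝ)).smul_const v).const_add x
  have h2 : HasFDerivAt (fun x ↦ L (φ x)) (fderiv ℝ (fun x ↦ L (φ x)) x) (x + (0 : ℝ) • v) := by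
    rw [zero_smul, add_zero]
    exact hd.hasFDerivAt
  have h3 : HasDerivAt (fun t : ℝ ↦ L (φ (x + t • v))) (fderiv ℝ (fun x ↦ L (φ x)) x v) 0 :=
    HasFDerivAt.comp_hasDerivAt (l := fun x ↦ L (φ x)) 0 h2 h1
  exact h3.unique (h.hasDerivAt L x)

end ClassCinfty

section EvalDeriv

variable {E F : Type*} [NormedAddCommGroup E] [NormedSpace ℝ E] [NormedAddCommGroup F]
  [NormedSpace ℝ F]

/-- The functional `χ ↦ χ^{(l)}(Y; S₁, …, S_l)`. -/
def SchwartzMap.evalDeriv (l : ℕ) (Y : E) (S : Fin l → E) : 𝓢(E, F) →L[ℝ] F :=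
  SchwartzMap.mkCLMtoNormedSpace (fun χ ↦ iteratedFDeriv ℝ l χ Y S)
    (fun χ η ↦ by
      have : ((χ + η : 𝓢(E, F)) : E → F) = (χ : E → F) + η := rfl
      rw [this, iteratedFDeriv_add_apply (χ.smooth l).contDiffAt (η.smooth l).contDiffAt]
      rfl)
    (fun a χ ↦ by
      have : ((a • χ : 𝓢(E, F)) : E → F) = a • (χ : E → F) := rfl
      rw [this, iteratedFDeriv_const_smul_apply (χ.smooth l).contDiffAt]
      rfl)
    ⟨{(0, l)}, ∏ j, ‖S j‖, by positivity, fun χ ↦ by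
      refine ((iteratedFDeriv ℝ l χ Y).le_opNorm S).trans ?_
      rw [mul_comm, Finset.sup_singleton]
      gcongr
      exact SchwartzMap.norm_iteratedFDeriv_le_seminorm ℝ χ l Y⟩

theorem SchwartzMap.seminorm_Iic_mono [NormedSpace ℂ F] [SMulCommClass ℝ ℂ F] {m m' : ℕ} (h : m ≤ m') (ψ : 𝓢(E, F)) :
    (Finset.Iic (m, m)).sup (schwartzSeminormFamily ℂ E F) ψ ≤
      (Finset.Iic (m', m')).sup (schwartzSeminormFamily ℂ E F) ψ :=
  Finset.sup_mono (f := schwartzSeminormFamily ℂ E F)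
    (Finset.Iic_subset_Iic.2 (Prod.mk_le_mk.2 ⟨h, h⟩)) ψ

end EvalDeriv

/-! ### Rapid decay in X of all mixed derivatives. -/

section Regular

variable {V : Type*} [NormedAddCommGroup V] [NormedSpace ℝ V]

/-- The derivatives of `φ(X, Y) = φ(X)(Y)` decay rapidly in `X`, up to powers of `|Y|`. -/
def HasRapidBounds (φ : PhaseSpace V → 𝓢(PhaseSpace V, ℂ)) : Prop :=
  ∀ l' l'' N : ℕ, ∃ (M : ℕ) (C : ℝ), 0 ≤ C ∧ ∀ (X Y : PhaseSpace V) (T : Fin l' → PhaseSpace V)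
    (S : Fin l'' → PhaseSpace V),
    (1 + ‖X‖) ^ N * ‖iteratedFDeriv ℝ l' (fun X' ↦ iteratedFDeriv ℝ l'' (φ X') Y S) X T‖ ≤
      C * (1 + ‖Y‖) ^ M * (∏ j, ‖T j‖) * ∏ j, ‖S j‖

variable [FiniteDimensional ℝ V]

theorem HasRapidBounds.of_hasDirDeriv {φ φ' : PhaseSpace V → 𝓢(PhaseSpace V, ℂ)}
    {v : PhaseSpace V} (hb : HasRapidBounds φ) (hφ : IsClassCinfty φ) (h : HasDirDeriv φ φ' v) :
    HasRapidBounds φ' := by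
  intro l' l'' N
  obtain ⟨M, C, hC, hM⟩ := hb (l' + 1) l'' N
  refine ⟨M, C * ‖v‖, by positivity, fun X Y T S ↦ ?_⟩
  set L : 𝓢(PhaseSpace V, ℂ) →L[ℝ] ℂ := SchwartzMap.evalDeriv l'' Y S with hL
  have h1 : (fun X' ↦ iteratedFDeriv ℝ l'' (φ' X') Y S) =
      fun X' ↦ fderiv ℝ (fun X' ↦ L (φ X')) X' v := by
    funext X'
    rw [h.fderiv_apply hφ L X']
    rfl
  have hs : ContDiff ℝ l' (fderiv ℝ fun X' ↦ L (φ X')) :=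
    (hφ.contDiff_comp L (l' + 1)).fderiv_right (by push_cast; rfl)
  -- The bound of order l' + 1 with v as last argument, the slot in which the innermost derivative
  -- stands.
  have h2 := hM X Y (Fin.snoc T v) S
  have h3 : (fun X' ↦ iteratedFDeriv ℝ l'' (φ X') Y S) = fun X' ↦ L (φ X') := rfl
  rw [h3, iteratedFDeriv_succ_apply_right, Fin.init_snoc, Fin.snoc_last, Fin.prod_univ_castSucc]
    at h2
  simp only [Fin.snoc_castSucc, Fin.snoc_last] at h2
  rw [h1, iteratedFDeriv_clm_apply_const_apply hs le_rfl]
  refine h2.trans (le_of_eq ?_)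
  ring

variable [MeasurableSpace V] [BorelSpace V]

/-- All losses in |X|, from s and from replacing g_X^{1/2} by the norm, have an exponent fixed
before m is chosen. A large m then supplies enough of the confinement weight to trade them, and N
further powers, for powers of 1 + |Y|. -/
theorem HasMixedBounds.hasRapidBounds {g : RiemMetric V} {C₀ r₀ N₀ r : ℝ}
    (hg : g.IsHormander C₀ r₀ N₀) (hr : 0 < r) (hrr₀ : r ≤ r₀)
    {φ : PhaseSpace V → 𝓢(PhaseSpace V, ℂ)} (hφ : HasMixedBounds g r φ) : HasRapidBounds φ := by
  intro l' l'' N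
  obtain ⟨s, hs, h⟩ := hφ (max l' l'')
  obtain ⟨n, hn⟩ := exists_nat_ge s
  obtain ⟨C₁, M₁, hC₁, h₁⟩ := hg.sqrt_quad_le
  obtain ⟨C₂, M₂, hC₂, h₂⟩ := hg.center_le_confDist hr hrr₀
  set p₀ := M₁ * l' + M₁ * l'' + n with hp₀
  set p := N + p₀ with hp
  -- The factor 2 cancels the exponent m/2, and the 1 keeps m positive when M₂p = 0.
  obtain ⟨C, hC⟩ := h (2 * ((M₂ * p + 1 : ℕ) : ℝ)) (by positivity)
  refine ⟨M₂ * p + n, C₂ ^ p * (|C| * C₁ ^ l' * C₁ ^ l''), by positivity, fun X Y T S ↦ ?_⟩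
  by_cases hT : ∃ j, T j = 0
  · obtain ⟨j, hj⟩ := hT
    rw [ContinuousMultilinearMap.map_coord_zero _ j hj, norm_zero, mul_zero]
    positivity
  by_cases hS : ∃ j, S j = 0
  · obtain ⟨j, hj⟩ := hS
    have : (fun X' ↦ iteratedFDeriv ℝ l'' (φ X') Y S) = fun _ ↦ 0 := by
      funext X'
      exact ContinuousMultilinearMap.map_coord_zero _ j hj
    rw [this]
    simp only [iteratedFDeriv_fun_zero, Pi.zero_apply, zero_apply, norm_zero, mul_zero]
    positivity
  push Not at hT hS
  have hd := g.confDist_nonneg X r Y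
  have h3 := hC l' (le_max_left _ _) l'' (le_max_right _ _) X Y (fun j ↦ ⟨T j, hT j⟩)
    fun j ↦ ⟨S j, hS j⟩
  have hTpos : 0 < ∏ j, Real.sqrt (g.quad X (T j)) :=
    Finset.prod_pos fun j _ ↦ Real.sqrt_pos.2 (g.pos X _ (hT j))
  have hSpos : 0 < ∏ j, Real.sqrt (g.quad X (S j)) :=
    Finset.prod_pos fun j _ ↦ Real.sqrt_pos.2 (g.pos X _ (hS j))
  rw [div_le_iff₀ (by positivity), mul_div_cancel_left₀ _ (two_ne_zero), Real.rpow_natCast] at h3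
  set D := ‖iteratedFDeriv ℝ l' (fun X' ↦ iteratedFDeriv ℝ l'' (φ X') Y S) X T‖ with hD
  have hD0 : 0 ≤ D := norm_nonneg _
  set a := 1 + ‖X‖ with ha
  set b := 1 + ‖Y‖ with hb
  set e := 1 + g.confDist X r Y with he
  have ha1 : 1 ≤ a := by linarith [norm_nonneg X]
  have hb1 : 1 ≤ b := by linarith [norm_nonneg Y]
  have he1 : 1 ≤ e := by linarith
  have hprod : ∀ (l : ℕ) (T : Fin l → PhaseSpace V), ∏ j, Real.sqrt (g.quad X (T j)) ≤
      C₁ ^ l * a ^ (M₁ * l) * ∏ j, ‖T j‖ := by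
    intro l T
    calc ∏ j, Real.sqrt (g.quad X (T j)) ≤ ∏ j, C₁ * a ^ M₁ * ‖T j‖ :=
          Finset.prod_le_prod (fun _ _ ↦ Real.sqrt_nonneg _) fun j _ ↦ h₁ X (T j)
      _ = _ := by simp [Finset.prod_mul_distrib, mul_pow, pow_mul]
  have hs' : ∀ {t : ℝ}, 1 ≤ t → t ^ s ≤ t ^ n := fun {t} ht ↦ by
    rw [← Real.rpow_natCast]
    exact Real.rpow_le_rpow_of_exponent_le ht hn
  have h4 : D * e ^ (M₂ * p) ≤
      |C| * C₁ ^ l' * C₁ ^ l'' * (a ^ p₀ * b ^ n * (∏ j, ‖T j‖) * ∏ j, ‖S j‖) := by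
    calc D * e ^ (M₂ * p) ≤ D * e ^ (M₂ * p + 1) := by
          gcongr
          omega
      _ ≤ C * ((∏ j, Real.sqrt (g.quad X (T j))) * (∏ j, Real.sqrt (g.quad X (S j))) *
            a ^ s * b ^ s) := h3
      _ ≤ |C| * ((C₁ ^ l' * a ^ (M₁ * l') * ∏ j, ‖T j‖) * (C₁ ^ l'' * a ^ (M₁ * l'') *
            ∏ j, ‖S j‖) * a ^ n * b ^ n) := by
          have hC' := le_abs_self C
          have h5 := hprod l' T
          have h6 := hprod l'' S
          have h7 := hs' ha1
          have h8 := hs' hb1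
          gcongr
      _ = _ := by rw [hp₀, pow_add, pow_add]; ring
  have hX : a ^ p ≤ C₂ ^ p * b ^ (M₂ * p) * e ^ (M₂ * p) := by
    calc a ^ p ≤ (C₂ * b ^ M₂ * e ^ M₂) ^ p := by
          gcongr
          exact h₂ X Y
      _ = _ := by rw [mul_pow, mul_pow, ← pow_mul, ← pow_mul]
  have hpos : 0 < a ^ p₀ := by positivity
  refine le_of_mul_le_mul_left ?_ hpos
  calc a ^ p₀ * (a ^ N * D) = a ^ p * D := by rw [hp, pow_add]; ring
    _ ≤ C₂ ^ p * b ^ (M₂ * p) * e ^ (M₂ * p) * D := by gcongr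
    _ = C₂ ^ p * b ^ (M₂ * p) * (D * e ^ (M₂ * p)) := by ring
    _ ≤ C₂ ^ p * b ^ (M₂ * p) *
        (|C| * C₁ ^ l' * C₁ ^ l'' * (a ^ p₀ * b ^ n * (∏ j, ‖T j‖) * ∏ j, ‖S j‖)) := by gcongr
    _ = _ := by rw [pow_add b]; ring

end Regular

/-! ### Part (iii): smoothness and decay in both variables. -/

section JointRegularity

variable {V : Type*} [NormedAddCommGroup V] [NormedSpace ℝ V]

/-- The multiplication operator `ψ ↦ -2πi[v, ·] ψ`. -/
def mulSymp (v : PhaseSpace V) : 𝓢(PhaseSpace V, ℂ) →L[ℂ] 𝓢(PhaseSpace V, ℂ) :=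
  (-(2 * Real.pi * Complex.I)) • SchwartzMap.smulLeftCLM ℂ
    fun Y ↦ (Complex.ofRealCLM ∘L (sympFunctional v : PhaseSpace V →L[ℝ] ℝ)) Y

theorem mulSymp_apply (v : PhaseSpace V) (ψ : 𝓢(PhaseSpace V, ℂ)) (Y : PhaseSpace V) :
    mulSymp v ψ Y = -(2 * Real.pi * Complex.I) * (sympForm v Y * ψ Y) := by
  rw [mulSymp, smul_apply, smul_apply, smul_eq_mul,
    SchwartzMap.smulLeftCLM_apply_apply (ContinuousLinearMap.hasTemperateGrowth _)]
  rfl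

theorem exists_seminorm_mulSymp_le (v : PhaseSpace V) (m : ℕ) :
    ∃ (m' : ℕ) (C : ℝ), 0 ≤ C ∧ ∀ ψ : 𝓢(PhaseSpace V, ℂ),
      (Finset.Iic (m, m)).sup (schwartzSeminormFamily ℂ (PhaseSpace V) ℂ) (mulSymp v ψ) ≤
        C * (Finset.Iic (m', m')).sup (schwartzSeminormFamily ℂ (PhaseSpace V) ℂ) ψ := by
  have hc : Continuous (((Finset.Iic (m, m)).sup
      (schwartzSeminormFamily ℂ (PhaseSpace V) ℂ)).comp (mulSymp v).toLinearMap) :=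
    (Seminorm.continuous_finsetSup fun i _ ↦
      (schwartz_withSeminorms ℂ (PhaseSpace V) ℂ).continuous_seminorm i).comp (mulSymp v).continuous
  obtain ⟨s, C, -, hC⟩ :=
    Seminorm.bound_of_continuous (schwartz_withSeminorms ℂ (PhaseSpace V) ℂ) _ hc
  refine ⟨s.sup fun i ↦ max i.1 i.2, C, C.2, fun ψ ↦ ?_⟩
  refine (hC ψ).trans ?_
  rw [smul_apply, NNReal.smul_def, smul_eq_mul]
  have hsub : s ⊆ Finset.Iic (s.sup fun i ↦ max i.1 i.2, s.sup fun i ↦ max i.1 i.2) := by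
    intro i hi
    have := Finset.le_sup (f := fun i : ℕ × ℕ ↦ max i.1 i.2) hi
    exact Finset.mem_Iic.2 ⟨(le_max_left _ _).trans this, (le_max_right _ _).trans this⟩
  have hle := Finset.sup_mono (f := schwartzSeminormFamily ℂ (PhaseSpace V) ℂ) hsub
  exact mul_le_mul_of_nonneg_left (hle ψ) C.2

variable [FiniteDimensional ℝ V] [MeasurableSpace V] [BorelSpace V]

/-- The functional `χ ↦ ⟨ψ, e^{-2πi[Ξ, ·]} \overline{χ}⟩`. -/
def modulateConjCLM (ψ : 𝓢(PhaseSpace V, ℂ)) (Ξ : PhaseSpace V) :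
    𝓢(PhaseSpace V, ℂ) →L[ℝ] ℂ :=
  ((schwartzToDual ψ ∘L SchwartzMap.smulLeftCLM ℂ (sympChar Ξ)).restrictScalars ℝ) ∘L
    SchwartzMap.postcompCLM (Complex.conjCLE : ℂ →L[ℝ] ℂ)

theorem gstft_eq_modulateConjCLM (ψ : 𝓢(PhaseSpace V, ℂ))
    (φ : PhaseSpace V → 𝓢(PhaseSpace V, ℂ)) (p : PhaseSpace V × PhaseSpace V) :
    gstft (schwartzToDual ψ) φ p = modulateConjCLM ψ p.2 (φ p.1) := rfl

/-- Differentiation under the integral brings down −2πi[v, Y]. Attached to ψ, this factor makes the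
derivative again a transform of a Schwartz function with the same family, which the inductions below
require. -/
theorem hasDerivAt_schwartzToDual_modulate (ψ χ : 𝓢(PhaseSpace V, ℂ)) (Ξ v : PhaseSpace V) :
    HasDerivAt (fun t : ℝ ↦ schwartzToDual ψ (modulate (Ξ + t • v) χ))
      (schwartzToDual (mulSymp v ψ) (modulate Ξ χ)) 0 := by
  set h := SchwartzMap.pairing (ContinuousLinearMap.mul ℂ ℂ) ψ χ with hh
  have hi : Integrable h (sympMeasure V) := h.integrable
  have hi' : Integrable (fun Y ↦ ‖Y‖ * ‖h Y‖) (sympMeasure V) := by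
    simpa using h.integrable_pow_mul (sympMeasure V) 1
  have h1 := VectorFourier.hasFDerivAt_fourierIntegral (sympBilin V) hi hi' Ξ
  have h2 : HasDerivAt (fun t : ℝ ↦ Ξ + t • v) v 0 := by
    simpa using ((hasDerivAt_id (0 : ℝ)).smul_const v).const_add Ξ
  have h3 : Ξ + (0 : ℝ) • v = Ξ := by simp
  rw [← h3] at h1
  have h4 := h1.comp_hasDerivAt 0 h2
  rw [h3] at h4
  have h5 : (VectorFourier.fourierIntegral Real.fourierChar (sympMeasure V)
      (sympBilin V).toLinearMap₁₂ h) ∘ (fun t : ℝ ↦ Ξ + t • v) =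
      fun t : ℝ ↦ schwartzToDual ψ (modulate (Ξ + t • v) χ) := by
    funext t
    rw [Function.comp_apply, fourierIntegral_sympBilin, schwartzToDual_modulate]
  rw [h5] at h4
  convert! h4 using 1
  have hint : Integrable (VectorFourier.fourierSMulRight (sympBilin V) h) (sympMeasure V) := by
    refine Integrable.mono' (hi'.const_mul (4 * Real.pi))
      hi.aestronglyMeasurable.fourierSMulRight (.of_forall fun Y ↦ ?_)
    have h6 : ‖sympBilin V Y‖ ≤ 2 * ‖Y‖ :=
      ContinuousLinearMap.opNorm_le_bound _ (by positivity) fun Z ↦ by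
        rw [sympBilin_apply, Real.norm_eq_abs]
        exact (abs_sympForm_le Z Y).trans (le_of_eq (by ring))
    rw [VectorFourier.norm_fourierSMulRight]
    calc 2 * Real.pi * ‖sympBilin V Y‖ * ‖h Y‖ ≤ 2 * Real.pi * (2 * ‖Y‖) * ‖h Y‖ := by gcongr
      _ = _ := by ring
  rw [VectorFourier.fourierIntegral_continuousLinearMap_apply Real.continuous_fourierChar hint, fourierIntegral_sympBilin,
    schwartzToDual_modulate]
  congr 1
  funext Y
  simp only [hh, VectorFourier.fourierSMulRight_apply, SchwartzMap.pairing_apply_apply,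
    ContinuousLinearMap.mul_apply', mulSymp_apply, sympBilin_apply, smul_eq_mul,
    Complex.real_smul]
  ring

theorem exists_norm_modulateConjCLM_le (ψ : 𝓢(PhaseSpace V, ℂ)) :
    ∃ C, 0 ≤ C ∧ ∀ (Ξ : PhaseSpace V) (χ : 𝓢(PhaseSpace V, ℂ)),
      ‖modulateConjCLM ψ Ξ χ‖ ≤ C * schwartzSeminormFamily ℝ (PhaseSpace V) ℂ (0, 0) χ := by
  obtain ⟨m, C, hC, h⟩ := exists_pow_mul_norm_schwartzToDual_modulate_le V 0 0
  set q := (Finset.Iic (m, m)).sup (schwartzSeminormFamily ℂ (PhaseSpace V) ℂ) ψ with hq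
  have hq0 : 0 ≤ q := apply_nonneg _ _
  refine ⟨C * q, by positivity, fun Ξ χ ↦ ?_⟩
  have h1 := h ψ (schwartzConj χ) (schwartzSeminormFamily ℝ (PhaseSpace V) ℂ (0, 0) χ)
    (apply_nonneg _ _) (fun l hl Y ↦ by
      obtain rfl : l = 0 := by omega
      rw [norm_iteratedFDeriv_schwartzConj, pow_zero, mul_one]
      exact SchwartzMap.norm_iteratedFDeriv_le_seminorm ℝ χ 0 Y) Ξ
  rw [pow_zero, one_mul] at h1
  exact h1.trans (le_of_eq (by ring))

/-- The functionals χ ↦ ⟨ψ, e^{−2πi[Ξ,·]} \overline{χ}⟩ are bounded by one seminorm uniformly in Ξ.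
So continuity in X and continuity in Ξ combine to joint continuity. -/
theorem continuous_gstft_schwartzToDual (ψ : 𝓢(PhaseSpace V, ℂ))
    {φ : PhaseSpace V → 𝓢(PhaseSpace V, ℂ)} (hφ : Continuous φ) :
    Continuous (gstft (schwartzToDual ψ) φ) := by
  obtain ⟨C, hC, h⟩ := exists_norm_modulateConjCLM_le ψ
  rw [continuous_iff_continuousAt]
  rintro ⟨X, Ξ⟩
  have h1 : Tendsto (fun p : PhaseSpace V × PhaseSpace V ↦
      C * schwartzSeminormFamily ℝ (PhaseSpace V) ℂ (0, 0) (φ p.1 - φ X)) (𝓝 (X, Ξ)) (𝓝 0) := by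
    have hc : Continuous fun p : PhaseSpace V × PhaseSpace V ↦
        C * schwartzSeminormFamily ℝ (PhaseSpace V) ℂ (0, 0) (φ p.1 - φ X) :=
      continuous_const.mul (((schwartz_withSeminorms ℝ (PhaseSpace V) ℂ).continuous_seminorm
        (0, 0)).comp ((hφ.comp continuous_fst).sub continuous_const))
    have h2 := hc.tendsto (X, Ξ)
    simp only [sub_self, map_zero, mul_zero] at h2
    exact h2
  have h2 : Tendsto (fun p : PhaseSpace V × PhaseSpace V ↦ modulateConjCLM ψ p.2 (φ p.1 - φ X))
      (𝓝 (X, Ξ)) (𝓝 0) :=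
    squeeze_zero_norm (fun p ↦ h p.2 _) h1
  have h3 : Tendsto (fun p : PhaseSpace V × PhaseSpace V ↦ modulateConjCLM ψ p.2 (φ X))
      (𝓝 (X, Ξ)) (𝓝 (modulateConjCLM ψ Ξ (φ X))) := by
    have hc : Continuous fun Ξ ↦ modulateConjCLM ψ Ξ (φ X) :=
      (schwartzToDual ψ).continuous.comp (continuous_modulate (schwartzConj (φ X)))
    exact (hc.tendsto Ξ).comp (continuous_snd.tendsto (X, Ξ))
  have h4 := h2.add h3
  rw [zero_add] at h4
  refine h4.congr fun p ↦ ?_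
  rw [map_sub, sub_add_cancel, gstft_eq_modulateConjCLM]

/-- The partial derivatives of the geometric short-time Fourier transform. -/
theorem hasDerivAt_gstft_schwartzToDual {ι : Type*} (b : Module.Basis ι ℝ (PhaseSpace V))
    (ψ : 𝓢(PhaseSpace V, ℂ)) {φ : PhaseSpace V → 𝓢(PhaseSpace V, ℂ)}
    {φ' : ι → PhaseSpace V → 𝓢(PhaseSpace V, ℂ)} (h : ∀ i, HasDirDeriv φ (φ' i) (b i))
    (p : PhaseSpace V × PhaseSpace V) (i : ι ⊕ ι) :
    HasDerivAt (fun t : ℝ ↦ gstft (schwartzToDual ψ) φ (p + t • b.prod b i))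
      (Sum.elim (fun i ↦ gstft (schwartzToDual ψ) (φ' i))
        (fun i ↦ gstft (schwartzToDual (mulSymp (b i) ψ)) φ) i p) 0 := by
  rcases i with i | i
  · have h1 := (h i).hasDerivAt (modulateConjCLM ψ p.2) p.1
    have h2 : (fun t : ℝ ↦ gstft (schwartzToDual ψ) φ (p + t • b.prod b (Sum.inl i))) =
        fun t : ℝ ↦ modulateConjCLM ψ p.2 (φ (p.1 + t • b i)) := by
      funext t
      simp [gstft_eq_modulateConjCLM, Module.Basis.prod_apply]
    rw [h2]
    exact h1
  · have h1 := hasDerivAt_schwartzToDual_modulate ψ (schwartzConj (φ p.1)) p.2 (b i)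
    have h2 : (fun t : ℝ ↦ gstft (schwartzToDual ψ) φ (p + t • b.prod b (Sum.inr i))) =
        fun t : ℝ ↦ schwartzToDual ψ (modulate (p.2 + t • b i) (schwartzConj (φ p.1))) := by
      funext t
      simp [gstft, Module.Basis.prod_apply]
    rw [h2]
    exact h1

/-- Induction with both ψ and φ free: the partial derivatives are transforms of (ψ, φ'_i) or of
(`mulSymp` ψ, φ), to which the induction hypothesis applies. -/
theorem contDiff_gstft_schwartzToDual (n : ℕ) (ψ : 𝓢(PhaseSpace V, ℂ))
    {φ : PhaseSpace V → 𝓢(PhaseSpace V, ℂ)} (hφ : IsClassCinfty φ) :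
    ContDiff ℝ n (gstft (schwartzToDual ψ) φ) := by
  induction n generalizing ψ φ with
  | zero =>
    rw [Nat.cast_zero, contDiff_zero]
    exact continuous_gstft_schwartzToDual ψ hφ.continuous
  | succ n ih =>
    set b := Module.finBasis ℝ (PhaseSpace V)
    choose φ' h h' using fun i ↦ hφ.exists_hasDirDeriv (b i)
    refine contDiff_succ_of_partial (b.prod b) (fun i ↦ ?_)
      (hasDerivAt_gstft_schwartzToDual b ψ h)
    rcases i with i | i
    · exact ih ψ (h' i)
    · exact ih (mulSymp (b i) ψ) hφ

theorem pow_mul_norm_gstft_schwartzToDual_le {φ : PhaseSpace V → 𝓢(PhaseSpace V, ℂ)}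
    (hb : HasRapidBounds φ) (N : ℕ) :
    ∃ (m : ℕ) (C : ℝ), 0 ≤ C ∧ ∀ (ψ : 𝓢(PhaseSpace V, ℂ)) p,
      (1 + ‖p‖) ^ N * ‖gstft (schwartzToDual ψ) φ p‖ ≤
        C * (Finset.Iic (m, m)).sup (schwartzSeminormFamily ℂ (PhaseSpace V) ℂ) ψ := by
  choose M C hC hM using fun l ↦ hb 0 l N
  -- Sums serve as common upper bounds for the exponents and constants of the finitely many orders l
  -- ≤ N.
  set M₀ := ∑ l ∈ Finset.range (N + 1), M l with hM₀
  set C₀ := ∑ l ∈ Finset.range (N + 1), C l with hC₀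
  have hC₀0 : 0 ≤ C₀ := Finset.sum_nonneg fun l _ ↦ hC l
  obtain ⟨m, C₂, hC₂, h₂⟩ := exists_pow_mul_norm_schwartzToDual_modulate_le V N M₀
  refine ⟨m, C₂ * C₀, by positivity, fun ψ p ↦ ?_⟩
  obtain ⟨X, Ξ⟩ := p
  have hpos : 0 < (1 + ‖X‖) ^ N := by positivity
  have h3 := h₂ ψ (schwartzConj (φ X)) (C₀ / (1 + ‖X‖) ^ N) (by positivity)
    (fun l hl Y ↦ by
      have hlm : l ∈ Finset.range (N + 1) := Finset.mem_range.2 (by omega)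
      have hCl : C l ≤ C₀ := Finset.single_le_sum (fun l _ ↦ hC l) hlm
      have hMl : M l ≤ M₀ := Finset.single_le_sum (fun l _ ↦ Nat.zero_le _) hlm
      rw [norm_iteratedFDeriv_schwartzConj]
      refine ContinuousMultilinearMap.opNorm_le_bound (by positivity) fun S ↦ ?_
      have h4 := hM l X Y 0 S
      rw [iteratedFDeriv_zero_apply, Finset.univ_eq_empty, Finset.prod_empty, mul_one] at h4
      rw [div_mul_eq_mul_div, div_mul_eq_mul_div, le_div_iff₀ hpos, mul_comm]
      refine h4.trans ?_
      gcongr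
      linarith [norm_nonneg Y]) Ξ
  have hnorm : 1 + ‖(X, Ξ)‖ ≤ (1 + ‖X‖) * (1 + ‖Ξ‖) := by
    rw [Prod.norm_def]
    rcases max_choice ‖X‖ ‖Ξ‖ with h | h
    · rw [h]; nlinarith [norm_nonneg X, norm_nonneg Ξ, mul_nonneg (norm_nonneg X) (norm_nonneg Ξ)]
    · rw [h]; nlinarith [norm_nonneg X, norm_nonneg Ξ, mul_nonneg (norm_nonneg X) (norm_nonneg Ξ)]
  calc (1 + ‖(X, Ξ)‖) ^ N * ‖gstft (schwartzToDual ψ) φ (X, Ξ)‖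
      ≤ ((1 + ‖X‖) * (1 + ‖Ξ‖)) ^ N * ‖gstft (schwartzToDual ψ) φ (X, Ξ)‖ := by gcongr
    _ = (1 + ‖X‖) ^ N * ((1 + ‖Ξ‖) ^ N *
          ‖schwartzToDual ψ (modulate Ξ (schwartzConj (φ X)))‖) := by
        rw [mul_pow, mul_assoc]; rfl
    _ ≤ (1 + ‖X‖) ^ N * (C₂ * (C₀ / (1 + ‖X‖) ^ N) *
          (Finset.Iic (m, m)).sup (schwartzSeminormFamily ℂ (PhaseSpace V) ℂ) ψ) := by gcongr
    _ = _ := by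
        field_simp

/-- The same induction as for smoothness, now quantitative: `HasRapidBounds` survives
differentiation in X, and the factor [b_i, ·] produced in Ξ only raises the order of the seminorm of
ψ. -/
theorem pow_mul_norm_iteratedFDeriv_gstft_le (n N : ℕ)
    {φ : PhaseSpace V → 𝓢(PhaseSpace V, ℂ)} (hφ : IsClassCinfty φ) (hb : HasRapidBounds φ) :
    ∃ (m : ℕ) (C : ℝ), 0 ≤ C ∧ ∀ (ψ : 𝓢(PhaseSpace V, ℂ)) p,
      (1 + ‖p‖) ^ N * ‖iteratedFDeriv ℝ n (gstft (schwartzToDual ψ) φ) p‖ ≤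
        C * (Finset.Iic (m, m)).sup (schwartzSeminormFamily ℂ (PhaseSpace V) ℂ) ψ := by
  induction n generalizing φ with
  | zero => simpa only [norm_iteratedFDeriv_zero] using pow_mul_norm_gstft_schwartzToDual_le hb N
  | succ n ih =>
    set b := Module.finBasis ℝ (PhaseSpace V)
    choose φ' h h' using fun i ↦ hφ.exists_hasDirDeriv (b i)
    choose m₁ C₁ hC₁ h₁ using fun i ↦ ih (h' i) (hb.of_hasDirDeriv hφ (h i))
    obtain ⟨m₂, C₂, hC₂, h₂⟩ := ih hφ hb
    choose m₃ C₃ hC₃ h₃ using fun i ↦ exists_seminorm_mulSymp_le (b i) m₂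
    set m := ∑ i, (m₁ i + m₃ i) with hm
    have hm₁ : ∀ i, m₁ i ≤ m := fun i ↦ (Nat.le_add_right _ _).trans
      (Finset.single_le_sum (f := fun i ↦ m₁ i + m₃ i) (fun _ _ ↦ Nat.zero_le _)
        (Finset.mem_univ i))
    have hm₃ : ∀ i, m₃ i ≤ m := fun i ↦ (Nat.le_add_left _ _).trans
      (Finset.single_le_sum (f := fun i ↦ m₁ i + m₃ i) (fun _ _ ↦ Nat.zero_le _)
        (Finset.mem_univ i))
    refine ⟨m, ∑ i, ‖basisConstr ℂ (b.prod b) i‖ * Sum.elim C₁ (fun i ↦ C₂ * C₃ i) i,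
      Finset.sum_nonneg fun i _ ↦ mul_nonneg (ContinuousLinearMap.opNorm_nonneg _) ?_, fun ψ p ↦ ?_⟩
    · rcases i with i | i
      · exact hC₁ i
      · exact mul_nonneg hC₂ (hC₃ i)
    set D : (Fin _ ⊕ Fin _) → PhaseSpace V × PhaseSpace V → ℂ :=
      Sum.elim (fun i ↦ gstft (schwartzToDual ψ) (φ' i))
        (fun i ↦ gstft (schwartzToDual (mulSymp (b i) ψ)) φ) with hD
    have hDs : ∀ i, ContDiff ℝ n (D i) := by
      rintro (i | i)
      · exact contDiff_gstft_schwartzToDual n ψ (h' i)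
      · exact contDiff_gstft_schwartzToDual n _ hφ
    have h4 := norm_iteratedFDeriv_succ_le_of_partial (b.prod b) hDs
      (hasDerivAt_gstft_schwartzToDual b ψ h) p
    set q := (Finset.Iic (m, m)).sup (schwartzSeminormFamily ℂ (PhaseSpace V) ℂ) ψ with hq
    have h5 : ∀ i, (1 + ‖p‖) ^ N * ‖iteratedFDeriv ℝ n (D i) p‖ ≤
        Sum.elim C₁ (fun i ↦ C₂ * C₃ i) i * q := by
      rintro (i | i)
      · exact (h₁ i ψ p).trans (mul_le_mul_of_nonneg_left (SchwartzMap.seminorm_Iic_mono (hm₁ i) ψ) (hC₁ i))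
      · refine (h₂ (mulSymp (b i) ψ) p).trans ?_
        rw [Sum.elim_inr, mul_assoc]
        exact mul_le_mul_of_nonneg_left ((h₃ i ψ).trans
          (mul_le_mul_of_nonneg_left (SchwartzMap.seminorm_Iic_mono (hm₃ i) ψ) (hC₃ i))) hC₂
    calc (1 + ‖p‖) ^ N * ‖iteratedFDeriv ℝ (n + 1) (gstft (schwartzToDual ψ) φ) p‖
        ≤ (1 + ‖p‖) ^ N *
            ∑ i, ‖basisConstr ℂ (b.prod b) i‖ * ‖iteratedFDeriv ℝ n (D i) p‖ := by gcongr
      _ = ∑ i, ‖basisConstr ℂ (b.prod b) i‖ *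
            ((1 + ‖p‖) ^ N * ‖iteratedFDeriv ℝ n (D i) p‖) := by
          rw [Finset.mul_sum]
          exact Finset.sum_congr rfl fun i _ ↦ by ring
      _ ≤ ∑ i, ‖basisConstr ℂ (b.prod b) i‖ * (Sum.elim C₁ (fun i ↦ C₂ * C₃ i) i * q) :=
          Finset.sum_le_sum fun i _ ↦ mul_le_mul_of_nonneg_left (h5 i) (ContinuousLinearMap.opNorm_nonneg _)
      _ = _ := by
          rw [Finset.sum_mul]
          exact Finset.sum_congr rfl fun i _ ↦ by ring

/-- The geometric short-time Fourier transform as a map between Schwartz spaces. -/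
def gstftCLM {φ : PhaseSpace V → 𝓢(PhaseSpace V, ℂ)} (hφ : IsClassCinfty φ)
    (hb : HasRapidBounds φ) : 𝓢(PhaseSpace V, ℂ) →L[ℂ] 𝓢(PhaseSpace V × PhaseSpace V, ℂ) :=
  SchwartzMap.mkCLM (fun ψ ↦ gstft (schwartzToDual ψ) φ)
    (fun ψ ψ' p ↦ by rw [schwartzToDual_add]; rfl)
    (fun c ψ p ↦ by rw [schwartzToDual_smul]; rfl)
    (fun ψ ↦ contDiff_infty.2 fun n ↦ contDiff_gstft_schwartzToDual n ψ hφ)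
    (fun ⟨N, n⟩ ↦ by
      obtain ⟨m, C, hC, h⟩ := pow_mul_norm_iteratedFDeriv_gstft_le n N hφ hb
      refine ⟨Finset.Iic (m, m), C, hC, fun ψ p ↦ le_trans ?_ (h ψ p)⟩
      gcongr
      linarith)

theorem gstftCLM_apply {φ : PhaseSpace V → 𝓢(PhaseSpace V, ℂ)} (hφ : IsClassCinfty φ)
    (hb : HasRapidBounds φ) (ψ : 𝓢(PhaseSpace V, ℂ)) (p : PhaseSpace V × PhaseSpace V) :
    gstftCLM hφ hb ψ p = gstft (schwartzToDual ψ) φ p := rfl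

end JointRegularity

end

theorem proposition3p1 {V : Type*} [NormedAddCommGroup V] [NormedSpace ℝ V]
    [FiniteDimensional ℝ V] [MeasurableSpace V] [BorelSpace V]
    (g : RiemMetric V) (C₀ r₀ N₀ : ℝ) (hg : g.IsHormander C₀ r₀ N₀)
    (r : ℝ) (hr : 0 < r) (hrr₀ : r ≤ r₀) :
    (∃ 𝒱 : (𝓢(PhaseSpace V, ℂ) →L[ℂ] ℂ) →ₗ[ℂ]
        (g.Conf r →ₛₗ[starRingEnd ℂ] IndLinf (sympMeasure₂ V)),
      (∀ f Φ (φ : PhaseSpace V → 𝓢(PhaseSpace V, ℂ)), φ =ᵐ[sympMeasure V] Φ.toAEEqFun →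
        (𝒱 f Φ).toAEEqFun =ᵐ[sympMeasure₂ V] gstft f φ) ∧
      IsHypocontinuous (fun f Φ ↦ 𝒱 f Φ) ∧
      ∀ B : Set (𝓢(PhaseSpace V, ℂ) →L[ℂ] ℂ), Bornology.IsVonNBounded ℂ B →
        ∃ s : ℝ, 0 < s ∧
          (∀ f ∈ B, ∀ Φ : g.Conf r,
            (𝒱 f Φ).toAEEqFun ∈ wLinfSubmodule (sympMeasure₂ V) (-s)) ∧
          ∃ A : B → (g.Conf r →L[ℂ] WLinf (sympMeasure₂ V) (-s)),
            (∀ (f : B) (Φ : g.Conf r) (φ : PhaseSpace V → 𝓢(PhaseSpace V, ℂ)),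
              φ =ᵐ[sympMeasure V] Φ.toAEEqFun →
              (A f Φ).toAEEqFun =ᵐ[sympMeasure₂ V]
                gstft (f : 𝓢(PhaseSpace V, ℂ) →L[ℂ] ℂ) (fun X ↦ schwartzConj (φ X))) ∧
            Equicontinuous (fun (f : B) (Φ : g.Conf r) ↦ A f Φ)) ∧
    (∃ 𝒱 : 𝓢(PhaseSpace V, ℂ) →ₗ[ℂ]
        (g.Conf r →ₛₗ[starRingEnd ℂ] ProjLinf (sympMeasure₂ V)),
      (∀ ψ Φ (φ : PhaseSpace V → 𝓢(PhaseSpace V, ℂ)), φ =ᵐ[sympMeasure V] Φ.toAEEqFun →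
        (𝒱 ψ Φ).toAEEqFun =ᵐ[sympMeasure₂ V] gstft (schwartzToDual ψ) φ) ∧
      Continuous (fun p : 𝓢(PhaseSpace V, ℂ) × g.Conf r ↦ 𝒱 p.1 p.2)) ∧
    (∀ (Φ : g.Conf r) (φ : PhaseSpace V → 𝓢(PhaseSpace V, ℂ)),
      φ =ᵐ[sympMeasure V] Φ.toAEEqFun → IsClassCinfty φ → HasMixedBounds g r φ →
      ∃ 𝒱 : 𝓢(PhaseSpace V, ℂ) →L[ℂ] 𝓢(PhaseSpace V × PhaseSpace V, ℂ),
        ∀ ψ p, 𝒱 ψ p = gstft (schwartzToDual ψ) φ p) := by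
  refine ⟨⟨RiemMetric.Conf.stft hg r,
    fun f Φ φ hφ ↦ (RiemMetric.Conf.coeFn_stft hg f Φ).trans
      (RiemMetric.Conf.gstft_congr f hφ).symm,
    RiemMetric.Conf.isHypocontinuous_stft hg r,
    fun B hB ↦ RiemMetric.Conf.exists_equicontinuous_stft hg r hB⟩,
    ⟨RiemMetric.Conf.stftSchwartz hg hr hrr₀,
      fun ψ Φ φ hφ ↦ (RiemMetric.Conf.coeFn_stftSchwartz hg hr hrr₀ ψ Φ).trans
        (RiemMetric.Conf.gstft_congr _ hφ).symm,
      RiemMetric.Conf.continuous_stftSchwartz hg hr hrr₀⟩,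
    fun Φ φ _ hφ hb ↦ ⟨gstftCLM hφ (hb.hasRapidBounds hg hr hrr₀), gstftCLM_apply _ _⟩⟩
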